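/- **Definitions.** A *plane graph* is a connected simple planar graph with a planar embedding (given by the circular orders of the edges around the vertices) and a designated outer face; subgraphs inherit the embedding. It is *maximal* if its graph is a maximal planar graph, i.e. no edge can be added without losing planarity or simplicity. A connected graph is *biconnected* if it has no cut-vertex. Let $H$ be a plane graph with $n\ge 3$ vertices and let $u,v$ be vertices such that $u$ immediately precedes $v$ in the counter-clockwise order along the boundary of the outer face of $H$. A *canonical ordering* of $H$ with first vertex $u$ (and second vertex $v$) is a labeling $v_1=u,v_2=v,v_3,\dots,v_n$ of the vertices such that, for $k=3,\dots,n-1$: (CO-1) the plane subgraph $H_k$ induced by $v_1,\dots,v_k$ is biconnected; let $C_k$ be the cycle bounding its outer face; (CO-2) $v_{k+1}$ lies in the outer face of $H_k$, and its neighbors in $H_k$ form a subinterval with at least two elements of the path $C_k-(u,v)$. If $H$ is a maximal plane graph whose outer face is delimited by the cycle $(u,v,z)$, it is also required that $v_n=z$. The *canonical orientation* defined by a canonical ordering directs each edge $(v_i,v_j)$ with $i<j$ from $v_i$ to $v_j$; the ordering is said to *extend* this orientation. A *canonical orientation with first vertex $u$* is one that is defined by some canonical ordering with first vertex $u$. The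 *FPP algorithm* (de Fraysseix, Pach, Pollack) maps a canonical ordering $v_1,\dots,v_n$ to a straight-line drawing as follows. It places $v_1,v_2,v_3$ at $(0,0),(2,0),(1,1)$ and sets $M(v_1)=\{v_1,v_2,v_3\}$, $M(v_3)=\{v_2,v_3\}$, $M(v_2)=\{v_2\}$. For $k=3,\dots,n-1$, let $w_1=u,w_2,\dots,w_r=v$ be the vertices of $H_k$ in clockwise order along its outer face, and let $w_p,\dots,w_q$ be the neighbors of $v_{k+1}$ in $H_k$, where $p<q$. The algorithm increases by $1$ the $x$-coordinate of each vertex in $M(w_{p+1})$, then by $1$ again the $x$-coordinate of each vertex in $M(w_q)$, and places $v_{k+1}$ at the intersection of the line through $w_p$ with slope $+1$ and the line through $w_q$ with slope $-1$. Then it sets $M(v_{k+1})=M(w_{p+1})\cup\{v_{k+1}\}$, adds $v_{k+1}$ to $M(w_i)$ for $i\le p$, and leaves $M(w_i)$ unchanged for $i\ge q$. The final drawing is the *canonical drawing* with base edge $(u,v)$ that corresponds to the ordering. **Theorem.** 1. Let $G$ be an $n$-vertex maximal plane graph and let $(u,v,z)$ be the cycle delimiting its outer face, where $u$, $v$, $z$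 appear in this counter-clockwise order along the outer face. There is a bijection $f$ from the canonical orientations of $G$ with first vertex $u$ to the canonical drawings of $G$ with base edge $(u,v)$. For every canonical orientation $\mathcal D$ with first vertex $u$ and every canonical ordering $\pi$ with first vertex $u$ that extends $\mathcal D$, the drawing $f(\mathcal D)$ is the canonical drawing that corresponds to $\pi$; in particular, any two canonical orderings that extend the same canonical orientation give the same drawing. 2. There is an algorithm that, given $G$ (with its embedding and outer face) and a canonical orientation $\mathcal D$ of $G$ with first vertex $u$, constructs $f(\mathcal D)$ in $\mathcal O(n)$ time, on a RAM with words of $\mathcal O(\log n)$ bits. 3. More generally, let $H$ be a biconnected plane graph with at least three vertices, all of whose internal faces are delimited by $3$-cycles, and let $u$ immediately precede $v$ in the counter-clockwise order along the outer face of $H$. Any two canonical orderings of $H$ with first vertex $u$ that extend the same canonical orientation of $H$ give the same canonical drawing of $H$ with base edge $(u,v)$. -/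

import Mathlib

/-! ## Plane graphs -/

/-- A rotation system of a simple graph: for every vertex, a cyclic order of the edges leaving it,
given as a permutation of the darts (edges with a direction) that maps a dart to the clockwise next
dart with the same tail. -/
structure RotationSystem {V : Type*} (G : SimpleGraph V) where
  cw : Equiv.Perm G.Dart
  fst_cw : ∀ d, (cw d).fst = d.fst
  sameCycle_cw : ∀ d d', d.fst = d'.fst → cw.SameCycle d d'

namespace RotationSystem

variable {V : Type*} {G : SimpleGraph V}

/-- The face permutation. The dart `a → b` is mapped to the clockwise next dart at `b` after
`b → a`, which is the dart that follows `a → b` on the boundary of the face to its left. -/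
def face (R : RotationSystem G) : Equiv.Perm G.Dart :=
  (Function.Involutive.toPerm SimpleGraph.Dart.symm SimpleGraph.Dart.symm_involutive).trans R.cw

/-- The faces are the cycles of the face permutation; a dart lies on the cycle of its left face. -/
abbrev Face (R : RotationSystem G) : Type _ :=
  Quotient (Equiv.Perm.SameCycle.setoid R.face)

/-- The face to the left of a dart. -/
def leftFace (R : RotationSystem G) (d : G.Dart) : R.Face :=
  Quotient.mk (Equiv.Perm.SameCycle.setoid R.face) d

/-- A rotation system of a finite connected graph (with at least one edge) is the rotation system
of a planar drawing if and only if it has genus zero, i.e. `#V - #E + #F = 2`. -/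
def IsPlanar (R : RotationSystem G) : Prop :=
  G.Connected ∧ Nat.card V + Nat.card R.Face = Nat.card G.edgeSet + 2

end RotationSystem

/-- Planarity of a connected simple graph. -/
def IsPlanarGraph {V : Type*} (G : SimpleGraph V) : Prop :=
  ∃ R : RotationSystem G, R.IsPlanar

/-- A connected simple plane graph: a planar embedding, given by the clockwise orders of the edges
around the vertices, and a designated outer face. -/
structure PlaneGraph (V : Type*) where
  graph : SimpleGraph V
  rot : RotationSystem graph
  planar : rot.IsPlanar
  outer : rot.Face

/-- A connected graph that has no cut-vertex. -/
def Biconnected {V : Type*} (G : SimpleGraph V) : Prop :=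
  G.Connected ∧ ∀ x : V, (G.induce {x}ᶜ).Preconnected

namespace PlaneGraph

variable {V : Type*} (G : PlaneGraph V)

/-- The underlying graph is a maximal planar graph: no edge can be added to it. -/
def IsMaximal : Prop :=
  Maximal IsPlanarGraph G.graph

/-- The outer face is delimited by the 3-cycle with vertices `u`, `v`, `z` in this
counter-clockwise order. A boundary walk that has the outer face to its left is clockwise, so it
traverses `v → u`, `u → z`, `z → v`. -/
def IsOuterCycle {u v z : V} (hvu : G.graph.Adj v u) (huz : G.graph.Adj u z)
    (hzv : G.graph.Adj z v) : Prop :=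
  G.outer = G.rot.leftFace ⟨(v, u), hvu⟩ ∧
    G.rot.face ⟨(v, u), hvu⟩ = ⟨(u, z), huz⟩ ∧
    G.rot.face ⟨(u, z), huz⟩ = ⟨(z, v), hzv⟩ ∧
    G.rot.face ⟨(z, v), hzv⟩ = ⟨(v, u), hvu⟩

/-- Every internal face is delimited by a 3-cycle. -/
def InternallyTriangulated : Prop :=
  ∀ d : G.graph.Dart, G.rot.leftFace d ≠ G.outer →
    G.rot.face (G.rot.face (G.rot.face d)) = d

/-! ### Plane subgraphs induced by a set `S` of vertices -/

open Classical in
/-- The first dart clockwise after `d`, around the tail of `d`, that belongs to the subgraph induced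
by `S`. On the darts of this subgraph, it is the rotation system inherited from `G`. -/
noncomputable def nextIn (S : Set V) (d : G.graph.Dart) : G.graph.Dart :=
  if h : ∃ j : ℕ, ((G.rot.cw ^ (j + 1)) d).snd ∈ S then (G.rot.cw ^ (Nat.find h + 1)) d else d

/-- The face permutation of the plane subgraph induced by `S`. -/
noncomputable def faceIn (S : Set V) (d : G.graph.Dart) : G.graph.Dart :=
  G.nextIn S d.symm

/-- Let `b` be the dart from `v` to `u`, where the outer face of `G` is to the left of `b`. The list
`w₁ = u, w₂, …, w_r = v` of the vertices of the plane subgraph induced by `S` in clockwise order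
along its outer face (the face to the left of `b`). -/
noncomputable def outerPath (b : G.graph.Dart) (S : Set V) : List V :=
  (List.range (Function.minimalPeriod (G.faceIn S) b)).map fun i => ((G.faceIn S)^[i] b).snd

/-- The dart `d`, from a vertex in `S` to a vertex not in `S`, leaves its tail inside the outer face
of the plane subgraph induced by `S`. -/
def LeavesInOuterFace (b : G.graph.Dart) (S : Set V) (d : G.graph.Dart) : Prop :=
  ∃ i : ℕ, G.nextIn S d = (G.faceIn S)^[i] b

/-! ### Canonical orderings, orientations and drawings

A labeling `v₁, …, vₙ` of the vertices is a bijection `π` with `π vᵢ = i - 1`. The dart `b` goes from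
`v` to `u` and has the outer face to its left. -/

/-- The first `k` vertices of a labeling. -/
def firstVertices {V : Type*} (π : V ≃ Fin (Nat.card V)) (k : ℕ) : Set V :=
  {y | (π y : ℕ) < k}

/-- A canonical ordering with first vertex `u = b.snd` and second vertex `v = b.fst`. The conditions
on `G_k` and `v_{k+1}`, for `3 ≤ k ≤ n - 1`, are written with `x = v_{k+1}` and `π x = k`. -/
structure IsCanonicalOrdering (b : G.graph.Dart) (π : V ≃ Fin (Nat.card V)) : Prop where
  first : (π b.snd : ℕ) = 0
  second : (π b.fst : ℕ) = 1
  biconnected : ∀ x : V, 3 ≤ (π x : ℕ) →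
    Biconnected (G.graph.induce (firstVertices π (π x)))
  inOuterFace : ∀ x : V, 3 ≤ (π x : ℕ) → ∀ d : G.graph.Dart,
    d.fst ∈ firstVertices π (π x) → d.snd = x → G.LeavesInOuterFace b (firstVertices π (π x)) d
  interval : ∀ x : V, 3 ≤ (π x : ℕ) →
    ∃ B : List V, B <:+: G.outerPath b (firstVertices π (π x)) ∧ 2 ≤ B.length ∧
      ∀ y ∈ firstVertices π (π x), G.graph.Adj x y ↔ y ∈ B

/-- A canonical ordering of a maximal plane graph with outer cycle `(u, v, z)`: the last vertex
is `z`. -/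
def IsCanonicalOrderingTo (b : G.graph.Dart) (z : V) (π : V ≃ Fin (Nat.card V)) : Prop :=
  G.IsCanonicalOrdering b π ∧ (π z : ℕ) + 1 = Nat.card V

/-- The orientation of `G` defined by `π`: every edge is directed away from the end-vertex that
comes first in `π`. -/
def orientation (π : V ≃ Fin (Nat.card V)) : Digraph V where
  Adj a b := G.graph.Adj a b ∧ π a < π b

/-- The canonical orientations of `G` with first vertex `u = b.snd`. -/
def canonicalOrientations (b : G.graph.Dart) (z : V) : Set (Digraph V) :=
  {D | ∃ π, G.IsCanonicalOrderingTo b z π ∧ G.orientation π = D}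

end PlaneGraph

/-! ### The algorithm of de Fraysseix, Pach and Pollack -/

/-- The data maintained by the algorithm: the positions of the vertices (a straight-line drawing is
determined by them) and the set `M w` for each vertex `w` of the outer face of the current graph. -/
structure FPPState (V : Type*) where
  pos : V → ℝ × ℝ
  M : V → Set V

/-- The intersection of the line through `P` with slope `+1` and the line through `Q` with
slope `-1`. -/
noncomputable def slopeIntersection (P Q : ℝ × ℝ) : ℝ × ℝ :=
  (((P.1 - P.2) + (Q.1 + Q.2)) / 2, ((Q.1 + Q.2) - (P.1 - P.2)) / 2)

namespace PlaneGraph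

variable {V : Type*} (G : PlaneGraph V)

open Classical in
/-- The drawing of `G₃`. Positions of vertices that are not drawn yet are irrelevant. -/
noncomputable def fppInit (π : V ≃ Fin (Nat.card V)) : FPPState V where
  pos y := if (π y : ℕ) = 1 then (2, 0) else if (π y : ℕ) = 2 then (1, 1) else (0, 0)
  M y := if (π y : ℕ) = 0 then {x | (π x : ℕ) < 3}
    else if (π y : ℕ) = 1 then {x | (π x : ℕ) = 1}
    else if (π y : ℕ) = 2 then {x | (π x : ℕ) = 1 ∨ (π x : ℕ) = 2} else ∅

open Classical in
/-- The insertion of the vertex `x = v_{k+1}`, where `L = [w₁, …, w_r]` is the outer path of `G_k`.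
The neighbors of `x` on `L` are `wp, wp1, …, wq`, in this order. -/
noncomputable def fppStep (x : V) (L : List V) (s : FPPState V) : FPPState V :=
  match L.filter fun y => G.graph.Adj x y with
  | wp :: wp1 :: rest =>
    let wq := (wp1 :: rest).getLast (List.cons_ne_nil _ _)
    let shifted : V → ℝ × ℝ := fun y =>
      ((s.pos y).1 + (if y ∈ s.M wp1 then 1 else 0) + (if y ∈ s.M wq then 1 else 0), (s.pos y).2)
    { pos := fun y => if y = x then slopeIntersection (shifted wp) (shifted wq) else shifted y
      M := fun y =>
        if y = x then insert x (s.M wp1)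
        else if y ∈ L.takeWhile (fun w => ¬ G.graph.Adj x w) ∨ y = wp then insert x (s.M y)
        else s.M y }
  | _ => s

/-- The state of the algorithm when the first `3 + j` vertices have been drawn. -/
noncomputable def fppState (b : G.graph.Dart) (π : V ≃ Fin (Nat.card V)) : ℕ → FPPState V
  | 0 => fppInit π
  | j + 1 =>
    if h : 3 + j < Nat.card V then
      G.fppStep (π.symm ⟨3 + j, h⟩) (G.outerPath b (firstVertices π (3 + j))) (fppState b π j)
    else fppState b π j

/-- The drawing constructed by the algorithm with the canonical ordering `π`. -/
noncomputable def fppDrawing (b : G.graph.Dart) (π : V ≃ Fin (Nat.card V)) : V → ℝ × ℝ :=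
  (G.fppState b π (Nat.card V - 3)).pos

/-- The canonical drawings with base edge `(u, v) = (b.snd, b.fst)`. -/
def canonicalDrawings (b : G.graph.Dart) (z : V) : Set (V → ℝ × ℝ) :=
  {Γ | ∃ π, G.IsCanonicalOrderingTo b z π ∧ G.fppDrawing b π = Γ}

end PlaneGraph

/-! ## Running time: programs for a word RAM

The machine has registers and a memory, both indexed by natural numbers, whose cells hold natural
numbers smaller than a bound `w`. A program refers to finitely many registers; the memory is
addressed indirectly through registers. Every instruction and every test costs one time unit. -/

structure RAMState where
  reg : ℕ → ℕ
  mem : ℕ → ℕ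

inductive RAMInstr where
  /-- `reg r := c` -/
  | const (r c : ℕ)
  /-- `reg r := reg a` -/
  | move (r a : ℕ)
  /-- `reg r := reg a + reg b` -/
  | add (r a b : ℕ)
  /-- `reg r := reg a - reg b`, or `0` if this is negative -/
  | sub (r a b : ℕ)
  /-- `reg r := ⌊reg a / 2⌋` -/
  | half (r a : ℕ)
  /-- `reg r := mem (reg a)` -/
  | load (r a : ℕ)
  /-- `mem (reg a) := reg r` -/
  | store (a r : ℕ)

namespace RAMInstr

/-- The value that an instruction writes. -/
def value (s : RAMState) : RAMInstr → ℕ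
  | const _ c => c
  | move _ a => s.reg a
  | add _ a b => s.reg a + s.reg b
  | sub _ a b => s.reg a - s.reg b
  | half _ a => s.reg a / 2
  | load _ a => s.mem (s.reg a)
  | store _ r => s.reg r

/-- Write the value `c` to the target of an instruction. -/
def write (s : RAMState) (c : ℕ) : RAMInstr → RAMState
  | const r _ => { s with reg := Function.update s.reg r c }
  | move r _ => { s with reg := Function.update s.reg r c }
  | add r _ _ => { s with reg := Function.update s.reg r c }
  | sub r _ _ => { s with reg := Function.update s.reg r c }
  | half r _ => { s with reg := Function.update s.reg r c }
  | load r _ => { s with reg := Function.update s.reg r c }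
  | store a _ => { s with mem := Function.update s.mem (s.reg a) c }

end RAMInstr

inductive RAMProg where
  | instr (i : RAMInstr)
  | seq (p q : RAMProg)
  /-- if `reg a < reg b` then `p` else `q` -/
  | ite (a b : ℕ) (p q : RAMProg)
  /-- while `reg a < reg b` do `p` -/
  | loop (a b : ℕ) (p : RAMProg)

/-- `Exec w p s t s'`: started in the state `s`, the program `p` halts in the state `s'` after
exactly `t` time units, and every value that it writes is smaller than `w`. -/
inductive RAMProg.Exec (w : ℕ) : RAMProg → RAMState → ℕ → RAMState → Prop
  | instr (i : RAMInstr) (s : RAMState) (h : i.value s < w) :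
      Exec w (.instr i) s 1 (i.write s (i.value s))
  | seq {p q : RAMProg} {s s' s'' : RAMState} {t t' : ℕ}
      (hp : Exec w p s t s') (hq : Exec w q s' t' s'') : Exec w (.seq p q) s (t + t') s''
  | ite_true {a b : ℕ} {p q : RAMProg} {s s' : RAMState} {t : ℕ}
      (h : s.reg a < s.reg b) (hp : Exec w p s t s') : Exec w (.ite a b p q) s (t + 1) s'
  | ite_false {a b : ℕ} {p q : RAMProg} {s s' : RAMState} {t : ℕ}
      (h : ¬ s.reg a < s.reg b) (hq : Exec w q s t s') : Exec w (.ite a b p q) s (t + 1) s'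
  | loop_true {a b : ℕ} {p : RAMProg} {s s' s'' : RAMState} {t t' : ℕ}
      (h : s.reg a < s.reg b) (hp : Exec w p s t s') (hl : Exec w (.loop a b p) s' t' s'') :
      Exec w (.loop a b p) s (t + t' + 1) s''
  | loop_false {a b : ℕ} {p : RAMProg} {s : RAMState}
      (h : ¬ s.reg a < s.reg b) : Exec w (.loop a b p) s 1 s

/-- A numbering of the vertices and of the darts, and a choice of a dart leaving each vertex. -/
structure GraphNumbering {V : Type*} (G : SimpleGraph V) where
  vtx : V ≃ Fin (Nat.card V)
  dart : G.Dart ≃ Fin (Nat.card G.Dart)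
  outDart : V → G.Dart
  fst_outDart : ∀ x, (outDart x).fst = x

open Classical in
/-- The initial state for an orientation `D` of the plane graph `G`: all registers are `0`, and the
memory holds a doubly-connected edge list of `G` and one bit per dart, which tells whether `D`
directs the edge as the dart. Here `b` is the dart from `v` to `u` on the outer face; the cells that
are not mentioned are `0`. -/
structure IsInput {V : Type*} (G : PlaneGraph V) (b : G.graph.Dart) (D : Digraph V)
    (N : GraphNumbering G.graph) (s : RAMState) : Prop where
  reg : ∀ r, s.reg r = 0
  numVertices : s.mem 0 = Nat.card V
  numDarts : s.mem 1 = Nat.card G.graph.Dart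
  base : s.mem 2 = N.dart b
  tail : ∀ d, s.mem (3 + N.dart d) = N.vtx d.fst
  head : ∀ d, s.mem (3 + Nat.card G.graph.Dart + N.dart d) = N.vtx d.snd
  twin : ∀ d, s.mem (3 + 2 * Nat.card G.graph.Dart + N.dart d) = N.dart d.symm
  next : ∀ d, s.mem (3 + 3 * Nat.card G.graph.Dart + N.dart d) = N.dart (G.rot.cw d)
  bit : ∀ d, s.mem (3 + 4 * Nat.card G.graph.Dart + N.dart d) = if D.Adj d.fst d.snd then 1 else 0
  outDart : ∀ x, s.mem (3 + 5 * Nat.card G.graph.Dart + N.vtx x) = N.dart (N.outDart x)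
  rest : ∀ a, 3 + 5 * Nat.card G.graph.Dart + Nat.card V ≤ a → s.mem a = 0

/-- The first `2n` memory cells hold the `x`-coordinates and then the `y`-coordinates of the
vertices in the drawing `Γ`. -/
def IsOutput {V : Type*} {G : SimpleGraph V} (N : GraphNumbering G) (Γ : V → ℝ × ℝ)
    (s : RAMState) : Prop :=
  ∀ x, Γ x = ((s.mem (N.vtx x) : ℝ), (s.mem (Nat.card V + N.vtx x) : ℝ))

/-- The program `p` computes the function `f`, which maps orientations of the `n`-vertex plane graph
`G` to drawings of `G`, in at most `c * n` time units and on words of at most `c * log n` bits, for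
all representations of the input. -/
def ComputesLinear {V : Type*} (p : RAMProg) (c : ℕ) (G : PlaneGraph V) (b : G.graph.Dart)
    (Ds : Set (Digraph V)) (f : Ds → V → ℝ × ℝ) : Prop :=
  ∀ (D : Ds) (N : GraphNumbering G.graph) (s : RAMState), IsInput G b D N s →
    ∃ (t : ℕ) (s' : RAMState), t ≤ c * Nat.card V ∧ p.Exec (Nat.card V ^ c) s t s' ∧
      IsOutput N (f D) s'

/-! The drawing admits a description in which the order of insertion does not occur. Let `w_p, …,
w_q` be the neighbors of `x` that precede it, in clockwise order along the outer face into which `x`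
is inserted (`preds`). The contour always has slopes `±1`, so the horizontal distance from `w_p` to
`w_q` is the total variation of the heights between them. Intersecting the two lines after the
shifts by `0` and `2` gives `2 Y(x) = 2 + Y(w_p) + |Y(w_p) - Y(w_{p+1})| + … + |Y(w_{q-1}) - Y(w_q)|
+ Y(w_q)`, which is written with `headHeight` and `heightSum`. A vertex `y` strictly between `w_p`
and `w_q` is covered by `x`; it satisfies `X(y) + 1 + heightSum (y, …, w_q) = X(x) + Y(x)`. Later
shifts preserve this equation, because each set `M` in use contains both `x` and `y` or neither
(`Drawn`, `Canon.drawn_succ`). Hence the heights are determined upwards from the predecessor lists,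
the final contour is determined by its heights and `X(u) = 0`, and the remaining abscissae follow
backwards from the covering vertices (`Canon.fppDrawing_eq`).

The orientation determines these data. The predecessors of `x` are its in-neighbors, and their order
is the clockwise order around `x`, cut at the right place (`Canon.preds_eq_of_orientation_eq`). The
vertex that covers `y` is the last out-neighbor of `y` (`Canon.le_of_covers`). Conversely, every
edge except the horizontal base edge is directed upwards in the drawing, so the drawing determines
the orientation (`Canon.orientation_eq`).

The topology rests on Euler's formula. Inserting `x` into the outer face replaces one face by at
most as many faces as there are new edges, so `V - E + F ≤ 2` throughout. Equality for the whole
graph forces equality in each step: the darts into `x` lie on distinct faces (`Canon.sep`). This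
determines the rotation around `x` and the new contour, which stays a simple cycle
(`ContourStep.contour_insert`).

For the running time, the vertices are sorted topologically by their in-degrees. One clockwise walk
around each vertex `x`, in which out-neighbors count as height `0`, yields its height and, as
partial sums, the offsets of the vertices it covers. Every neighbor of `y` is visited no later than
the vertex that covers `y`, so what that vertex writes for `y` is never overwritten. A pass in the
reverse order then computes the abscissae. There are at most `6 n` darts, and each is handled a
constant number of times. -/

namespace PlaneGraph

/-! ### Rotations and faces of induced plane subgraphs -/

variable {V : Type*} (G : PlaneGraph V)

/-- `e` is the first dart strictly clockwise after `d` whose head is in `S`. -/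
def IsNext (S : Set V) (d e : G.graph.Dart) : Prop :=
  ∃ j : ℕ, (G.rot.cw ^ (j + 1)) d = e ∧ e.snd ∈ S ∧
    ∀ i < j, ((G.rot.cw ^ (i + 1)) d).snd ∉ S

/-- Both ends of the dart are in `S`. -/
def InS (S : Set V) (d : G.graph.Dart) : Prop :=
  d.fst ∈ S ∧ d.snd ∈ S

/-- `e` is reached from `d` along the boundary of a face of the subgraph induced by `S`. -/
def Reach (S : Set V) (d e : G.graph.Dart) : Prop :=
  ∃ n : ℕ, (G.faceIn S)^[n] d = e

variable {G} {S : Set V} {x : V} {b d e f g : G.graph.Dart}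

theorem fst_cw_pow (d : G.graph.Dart) (j : ℕ) : ((G.rot.cw ^ j) d).fst = d.fst := by
  induction j with
  | zero => rfl
  | succ j ih => rw [pow_succ', Equiv.Perm.mul_apply, G.rot.fst_cw, ih]

theorem dart_ext_iff {d e : G.graph.Dart} : d = e ↔ d.fst = e.fst ∧ d.snd = e.snd := by
  constructor
  · rintro rfl; exact ⟨rfl, rfl⟩
  · rintro ⟨h1, h2⟩; exact SimpleGraph.Dart.ext _ _ (Prod.ext h1 h2)

theorem isNext_nextIn (h : ∃ j : ℕ, ((G.rot.cw ^ (j + 1)) d).snd ∈ S) :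
    G.IsNext S d (G.nextIn S d) := by
  classical
  unfold nextIn
  rw [dif_pos h]
  exact ⟨Nat.find h, rfl, Nat.find_spec h, fun i hi => Nat.find_min h hi⟩

theorem IsNext.unique (h : G.IsNext S d e) (h' : G.IsNext S d f) : e = f := by
  obtain ⟨j, hj, hjS, hj'⟩ := h
  obtain ⟨k, hk, hkS, hk'⟩ := h'
  rcases lt_trichotomy j k with hlt | rfl | hlt
  · exact absurd (hj ▸ hjS) (hk' j hlt)
  · rw [← hj, ← hk]
  · exact absurd (hk ▸ hkS) (hj' k hlt)

theorem IsNext.nextIn_eq (h : G.IsNext S d e) : G.nextIn S d = e := by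
  obtain ⟨j, hj, hjS, hj'⟩ := id h
  exact (isNext_nextIn ⟨j, hj ▸ hjS⟩).unique h

theorem IsNext.fst_eq (h : G.IsNext S d e) : e.fst = d.fst := by
  obtain ⟨j, rfl, -⟩ := h
  exact fst_cw_pow d _

theorem IsNext.snd_mem (h : G.IsNext S d e) : e.snd ∈ S := h.choose_spec.2.1

theorem exists_cw_pow [Finite V] {d d' : G.graph.Dart} (h : d.fst = d'.fst) :
    ∃ j : ℕ, (G.rot.cw ^ (j + 1)) d = d' := by
  have : Finite G.graph.Dart := Finite.of_injective _ SimpleGraph.Dart.toProd_injective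
  have h1 := G.rot.sameCycle_cw d d' h
  obtain ⟨i, hi, -, h2⟩ := h1.exists_pow_eq''
  exact ⟨i - 1, by rwa [Nat.sub_add_cancel hi]⟩

theorem isNext_nextIn_of_adj [Finite V] (hf : d.fst = e.fst) (he : e.snd ∈ S) :
    G.IsNext S d (G.nextIn S d) := by
  obtain ⟨j, hj⟩ := exists_cw_pow hf
  exact isNext_nextIn ⟨j, hj ▸ he⟩

/-- Two darts with the same next dart, one of which is in `S` at its head, agree unless the other
one lies strictly between. -/
theorem IsNext.left_unique (h : G.IsNext S f e) (h' : G.IsNext S g e) (hf : f.snd ∈ S)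
    (hg : g.snd ∈ S) : f = g := by
  obtain ⟨j, hj, hjS, hj'⟩ := h
  obtain ⟨k, hk, hkS, hk'⟩ := h'
  rcases lt_trichotomy j k with hlt | rfl | hlt
  · have h1 : f = (G.rot.cw ^ (k - j - 1 + 1)) g := by
      apply (G.rot.cw ^ (j + 1)).injective
      rw [hj, ← Equiv.Perm.mul_apply, ← pow_add, ← hk]
      congr 2; omega
    exact absurd (h1 ▸ hf) (hk' _ (by omega))
  · exact (G.rot.cw ^ (j + 1)).injective (hj.trans hk.symm)
  · have h1 : g = (G.rot.cw ^ (j - k - 1 + 1)) f := by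
      apply (G.rot.cw ^ (k + 1)).injective
      rw [hk, ← Equiv.Perm.mul_apply, ← pow_add, ← hj]
      congr 2; omega
    exact absurd (h1 ▸ hg) (hj' _ (by omega))

/-- The larger set offers one more candidate, a dart to `x`. If that comes first, the search in `S`
continues behind it and still ends at `e`. -/
theorem IsNext.insert_cases (h : G.IsNext S d e) (h' : G.IsNext (insert x S) d f) :
    f = e ∨ (f.snd = x ∧ G.IsNext S f e) := by
  obtain ⟨j, hj, hjS, hj'⟩ := h
  obtain ⟨k, hk, hkS, hk'⟩ := h'
  rcases lt_trichotomy j k with hlt | rfl | hlt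
  · exact absurd (Or.inr (hj ▸ hjS)) (hk' j hlt)
  · exact Or.inl (hk.symm.trans hj)
  · right
    have h1 : f.snd ∉ S := hk ▸ hj' k hlt
    refine ⟨hkS.resolve_right h1, j - k - 1, ?_, hjS, fun i hi => ?_⟩
    · rw [← hk, ← Equiv.Perm.mul_apply, ← pow_add, ← hj]
      congr 2; omega
    · have h2 := hj' (i + k + 1) (by omega)
      rw [← hk, ← Equiv.Perm.mul_apply, ← pow_add]
      have h3 : i + 1 + (k + 1) = i + k + 1 + 1 := by omega
      rwa [h3]

/-- The graph is simple, so `f` is the only dart at its tail with head `x`. Meeting it again takes a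
full turn, after which `e` would have a smaller index than the minimal one. -/
theorem IsNext.insert_of_snd_eq (h : G.IsNext S f e) (hf : f.snd = x) :
    G.IsNext (insert x S) f e := by
  obtain ⟨j, hj, hjS, hj'⟩ := h
  refine ⟨j, hj, Or.inr hjS, fun i hi hmem => ?_⟩
  rcases hmem with hmem | hmem
  · have h1 : (G.rot.cw ^ (i + 1)) f = f := dart_ext_iff.2 ⟨fst_cw_pow f _, hmem.trans hf.symm⟩
    have h2 : (G.rot.cw ^ (j - i - 1 + 1)) f = e := by
      conv_lhs => rw [← h1]
      rw [← Equiv.Perm.mul_apply, ← pow_add, ← hj]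
      congr 2; omega
    exact hj' (j - i - 1) (by omega) (h2 ▸ hjS)
  · exact hj' i hi hmem

theorem Reach.refl (d : G.graph.Dart) : G.Reach S d d := ⟨0, rfl⟩

theorem Reach.trans (h : G.Reach S d e) (h' : G.Reach S e f) : G.Reach S d f := by
  obtain ⟨m, rfl⟩ := h
  obtain ⟨n, rfl⟩ := h'
  exact ⟨n + m, Function.iterate_add_apply _ _ _ _⟩

theorem reach_faceIn (d : G.graph.Dart) : G.Reach S d (G.faceIn S d) := ⟨1, rfl⟩

/-- A nodup cyclic list of darts along a face determines the outer path. -/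
theorem outerPath_eq_map {C : List G.graph.Dart} (hb : C.head? = some b)
    (hC : (C ++ [b]).IsChain fun d e => G.faceIn S d = e) (hnd : C.Nodup) :
    G.outerPath b S = C.map fun d => d.snd := by
  have h1 : ∀ i (hi : i < (C ++ [b]).length), (G.faceIn S)^[i] b = (C ++ [b])[i] := by
    intro i
    induction i with
    | zero =>
      intro hi
      cases C with
      | nil => simp at hb
      | cons c C => simpa using hb.symm
    | succ i ih =>
      intro hi
      rw [Function.iterate_succ_apply', ih (by omega)]
      exact List.isChain_iff_getElem.1 hC i hi
  have hpos : 0 < C.length := by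
    cases C with
    | nil => simp at hb
    | cons c C => simp
  have h2 : Function.minimalPeriod (G.faceIn S) b = C.length := by
    apply le_antisymm
    · apply Function.IsPeriodicPt.minimalPeriod_le hpos
      have := h1 C.length (by simp)
      simpa [Function.IsPeriodicPt, Function.IsFixedPt] using this
    -- A smaller period would put `b` into the duplicate-free list twice.
    · by_contra! hlt
      have hper : (G.faceIn S)^[Function.minimalPeriod (G.faceIn S) b] b = b :=
        Function.iterate_minimalPeriod
      have hp : 0 < Function.minimalPeriod (G.faceIn S) b := by
        apply Function.IsPeriodicPt.minimalPeriod_pos hpos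
        have := h1 C.length (by simp)
        simpa [Function.IsPeriodicPt, Function.IsFixedPt] using this
      have h3 := h1 _ (show Function.minimalPeriod (G.faceIn S) b < (C ++ [b]).length by
        simp; omega)
      have h4 := h1 0 (by simp)
      rw [hper] at h3
      simp only [Function.iterate_zero, id] at h4
      rw [h3] at h4
      rw [List.getElem_append_left hlt, List.getElem_append_left hpos] at h4
      have := (List.Nodup.getElem_inj_iff hnd).1 h4
      omega
  unfold outerPath
  rw [h2]
  apply List.ext_getElem
  · simp
  · intro i hi hi'
    simp only [List.length_map] at hi'
    simp only [List.getElem_map, List.getElem_range]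
    rw [h1 i (by simp; omega), List.getElem_append_left hi']

variable [Finite V]

theorem isNext_faceIn (h : G.InS S d) : G.IsNext S d.symm (G.faceIn S d) :=
  isNext_nextIn_of_adj (e := d.symm) rfl h.1

theorem fst_faceIn (h : G.InS S d) : (G.faceIn S d).fst = d.snd := (isNext_faceIn h).fst_eq

theorem inS_faceIn (h : G.InS S d) : G.InS S (G.faceIn S d) :=
  ⟨fst_faceIn h ▸ h.2, (isNext_faceIn h).snd_mem⟩

/-- Thus `faceIn S` permutes the finitely many darts in `S`: faces are orbits, and `Reach` is
symmetric. -/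
theorem faceIn_inj (hd : G.InS S d) (he : G.InS S e) (h : G.faceIn S d = G.faceIn S e) : d = e := by
  have h1 := isNext_faceIn hd
  rw [h] at h1
  exact SimpleGraph.Dart.symm_involutive.injective
    (h1.left_unique (isNext_faceIn he) hd.1 he.1)

theorem inS_iterate (h : G.InS S d) (n : ℕ) : G.InS S ((G.faceIn S)^[n] d) := by
  induction n with
  | zero => exact h
  | succ n ih => rw [Function.iterate_succ_apply']; exact inS_faceIn ih

theorem Reach.inS (h : G.Reach S d e) (hd : G.InS S d) : G.InS S e := by
  obtain ⟨n, rfl⟩ := h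
  exact inS_iterate hd n

theorem finite_dart : Finite G.graph.Dart :=
  Finite.of_injective _ SimpleGraph.Dart.toProd_injective

theorem exists_iterate_eq (h : G.InS S d) : ∃ m > 0, (G.faceIn S)^[m] d = d := by
  have : Finite G.graph.Dart := finite_dart
  let F : {d // G.InS S d} → {d // G.InS S d} := fun d => ⟨G.faceIn S d.1, inS_faceIn d.2⟩
  have hF : Function.Injective F := fun d e h =>
    Subtype.ext (faceIn_inj d.2 e.2 (congrArg Subtype.val h))
  obtain ⟨m, hm, hm'⟩ := hF.mem_periodicPts ⟨d, h⟩
  refine ⟨m, hm, ?_⟩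
  have h1 : ∀ k, ((F^[k] ⟨d, h⟩) : G.graph.Dart) = (G.faceIn S)^[k] d := by
    intro k
    induction k with
    | zero => rfl
    | succ k ih => rw [Function.iterate_succ_apply', Function.iterate_succ_apply', ← ih]
  rw [← h1, hm']

theorem Reach.symm (h : G.Reach S d e) (hd : G.InS S d) : G.Reach S e d := by
  obtain ⟨n, rfl⟩ := h
  obtain ⟨m, hm, hm'⟩ := exists_iterate_eq hd
  have h1 : ∀ k, (G.faceIn S)^[m * k] d = d := fun k => by
    rw [Function.iterate_mul]; exact Function.iterate_fixed hm' k
  -- `m * n` steps lead from `d` back to `d`, and the first `n` of them end at `e`.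
  refine ⟨m * n - n, ?_⟩
  rw [← Function.iterate_add_apply, Nat.sub_add_cancel (Nat.le_mul_of_pos_left n hm), h1]

end PlaneGraph

/-! ### Inserting a vertex into the outer face -/

namespace PlaneGraph

variable {V : Type*} {G : PlaneGraph V} {S : Set V} {x : V} {b d e f g : G.graph.Dart}

variable (G) in
/-- The edges between `S` and the new vertex `x` leave `S` inside the face to the left of `b`. -/
structure Insertable (b : G.graph.Dart) (S : Set V) (x : V) : Prop where
  notMem : x ∉ S
  base : G.InS S b
  out : ∀ d : G.graph.Dart, d.fst ∈ S → d.snd = x → G.LeavesInOuterFace b S d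

variable (G) in
/-- `T` meets every face of the subgraph induced by `S`. -/
def Hit (S : Set V) (T : Finset G.graph.Dart) : Prop :=
  ∀ d, G.InS S d → ∃ t ∈ T, G.Reach S d t

variable (G) in
/-- `C` is the list of darts along the face to the left of `b`, which is a simple cycle. -/
structure Contour (b : G.graph.Dart) (S : Set V) (C : List G.graph.Dart) : Prop where
  head : C.head? = some b
  chain : (C ++ [b]).IsChain fun d e => G.faceIn S d = e
  inS : ∀ d ∈ C, G.InS S d
  nodup : (C.map fun d => d.snd).Nodup

theorem InS.mono (h : G.InS S d) : G.InS (insert x S) d := ⟨Or.inr h.1, Or.inr h.2⟩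

theorem reach_of_isChain {a : G.graph.Dart} {l : List G.graph.Dart}
    (h : (a :: l).IsChain fun d e => G.faceIn S d = e) : ∀ d ∈ a :: l, G.Reach S a d := by
  induction l generalizing a with
  | nil => intro d hd; simp at hd; subst hd; exact Reach.refl _
  | cons c l ih =>
    rw [List.isChain_cons_cons] at h
    intro d hd
    rcases List.mem_cons.1 hd with rfl | hd
    · exact Reach.refl _
    · exact (show G.Reach S a c from ⟨1, h.1⟩).trans (ih h.2 d hd)

theorem Contour.nodup_darts {C : List G.graph.Dart} (h : G.Contour b S C) : C.Nodup :=
  List.Nodup.of_map _ h.nodup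

theorem Contour.outerPath_eq {C : List G.graph.Dart} (h : G.Contour b S C) :
    G.outerPath b S = C.map fun d => d.snd :=
  outerPath_eq_map h.head h.chain h.nodup_darts

theorem Contour.exists_eq_cons {C : List G.graph.Dart} (h : G.Contour b S C) :
    ∃ C', C = b :: C' := by
  have := h.head
  cases C with
  | nil => simp at this
  | cons c C => simp at this; exact ⟨C, by rw [this]⟩

theorem Contour.faceIn_mem {C : List G.graph.Dart} (h : G.Contour b S C) (hd : d ∈ C) :
    G.faceIn S d ∈ C := by
  obtain ⟨l1, l2, rfl⟩ := List.append_of_mem hd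
  have h1 := h.chain
  rw [List.append_assoc, List.cons_append, List.isChain_split] at h1
  cases l2 with
  | nil =>
    have h2 : G.faceIn S d = b := by simpa using h1.2
    rw [h2]
    obtain ⟨C', hC'⟩ := h.exists_eq_cons
    simp [hC']
  | cons c l2 =>
    have h2 := h1.2
    rw [List.cons_append, List.isChain_cons_cons] at h2
    rw [h2.1]; simp

theorem Contour.mem_iff {C : List G.graph.Dart} (h : G.Contour b S C) :
    d ∈ C ↔ G.Reach S b d := by
  obtain ⟨C', rfl⟩ := h.exists_eq_cons
  constructor
  · intro hd
    exact reach_of_isChain (l := C' ++ [b]) h.chain d (by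
      rcases List.mem_cons.1 hd with rfl | hd <;> simp [*])
  · rintro ⟨n, rfl⟩
    induction n with
    | zero => simp
    | succ n ih => rw [Function.iterate_succ_apply']; exact h.faceIn_mem ih

theorem Contour.eq_of_snd {C : List G.graph.Dart} (h : G.Contour b S C) (hd : d ∈ C) (he : e ∈ C)
    (hs : d.snd = e.snd) : d = e :=
  List.inj_on_of_nodup_map h.nodup hd he hs

theorem isChain_congr_append {S' : Set V} {l : List G.graph.Dart} {c : G.graph.Dart}
    (h : (l ++ [c]).IsChain fun d e => G.faceIn S d = e)
    (hl : ∀ d ∈ l, G.faceIn S' d = G.faceIn S d) :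
    (l ++ [c]).IsChain fun d e => G.faceIn S' d = e := by
  induction l with
  | nil => simp
  | cons a l ih =>
    rw [List.cons_append, List.isChain_cons] at h ⊢
    refine ⟨fun y hy => ?_, ih h.2 fun d hd => hl d (by simp [hd])⟩
    rw [hl a (by simp)]
    exact h.1 y hy

theorem eq_last_or_exists_next {α : Type*} {l : List α} {a z : α} (h : a ∈ l ++ [z]) :
    a = z ∨ ∃ l1 c l2, l ++ [z] = l1 ++ a :: c :: l2 := by
  obtain ⟨l1, l2, h2⟩ := List.append_of_mem h
  cases l2 with
  | nil => exact Or.inl (by simpa using (List.append_inj' h2 rfl).2.symm)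
  | cons c l2 => exact Or.inr ⟨l1, c, l2, h2⟩

variable [Finite V]

theorem faceIn_insert_cases (hd : G.InS S d) :
    G.faceIn (insert x S) d = G.faceIn S d ∨
      ((G.faceIn (insert x S) d).snd = x ∧
        G.IsNext S (G.faceIn (insert x S) d) (G.faceIn S d)) :=
  (isNext_faceIn hd).insert_cases (isNext_faceIn hd.mono)

/-- The dart `f` lies in the corner between `g.symm` and `faceIn S g`. If the new face skipped it,
`f` and `g.symm` would have the same next dart in the larger graph, so `IsNext.left_unique` would
identify them. -/
theorem faceIn_insert_eq (hx : x ∉ S) (hg : G.InS S g) (hf : f.fst = g.snd) (hfx : f.snd = x)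
    (hn : G.nextIn S f = G.faceIn S g) : G.faceIn (insert x S) g = f := by
  rcases faceIn_insert_cases (x := x) hg with h | ⟨h, -⟩
  · exfalso
    have h1 : G.IsNext S f (G.faceIn S g) :=
      hn ▸ isNext_nextIn_of_adj (e := g.symm) hf hg.1
    have h2 : G.IsNext (insert x S) g.symm (G.faceIn S g) := h ▸ isNext_faceIn hg.mono
    have h3 := (h1.insert_of_snd_eq hfx).left_unique h2 (Or.inl hfx) (Or.inr hg.1)
    subst h3
    exact hx (hfx ▸ hg.1)
  · exact dart_ext_iff.2 ⟨(fst_faceIn hg.mono).trans hf.symm, h.trans hfx.symm⟩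

set_option linter.unusedSectionVars false in
theorem faceIn_insert_symm (hf : f.snd = x) (h : G.IsNext S f e) :
    G.faceIn (insert x S) f.symm = e := by
  unfold faceIn
  rw [SimpleGraph.Dart.symm_symm]
  exact (h.insert_of_snd_eq hf).nextIn_eq

/-- A change after `d` means that a dart to `x` leaves inside the corner after `d`, and by
`Insertable.out` such a corner belongs to the face of `b`. -/
theorem Insertable.faceIn_eq (h : G.Insertable b S x) (hd : G.InS S d) (hr : ¬ G.Reach S b d) :
    G.faceIn (insert x S) d = G.faceIn S d := by
  refine (faceIn_insert_cases hd).resolve_right fun ⟨h1, h2⟩ => hr ?_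
  obtain ⟨i, hi⟩ := h.out _ ((fst_faceIn hd.mono).symm ▸ hd.2) h1
  have h3 : G.Reach S b (G.faceIn S d) := ⟨i, by rw [← hi, h2.nextIn_eq]⟩
  exact h3.trans ((reach_faceIn d).symm hd)

theorem Insertable.iterate_eq (h : G.Insertable b S x) (hd : G.InS S d) (hr : ¬ G.Reach S b d)
    (n : ℕ) : (G.faceIn (insert x S))^[n] d = (G.faceIn S)^[n] d := by
  induction n with
  | zero => rfl
  | succ n ih =>
    rw [Function.iterate_succ_apply', Function.iterate_succ_apply', ih]
    exact h.faceIn_eq (inS_iterate hd n) fun h1 =>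
      hr (h1.trans ((show G.Reach S d _ from ⟨n, rfl⟩).symm hd))

theorem Insertable.not_reach (h : G.Insertable b S x) (hd : G.InS S d) (hr : ¬ G.Reach S b d) :
    ¬ G.Reach (insert x S) b d := by
  intro h1
  obtain ⟨n, hn⟩ := h1.symm h.base.mono
  rw [h.iterate_eq hd hr] at hn
  exact hr ((show G.Reach S d b from ⟨n, hn⟩).symm hd)

/-- The walk from `d` agrees with the old outer face up to the first corner that contains a dart to
`x`. There is such a corner because `x` has a neighbor in `S`. -/
theorem Insertable.reach_new (h : G.Insertable b S x) (hx : ∃ y ∈ S, G.graph.Adj x y)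
    (hd : G.Reach S b d) : ∃ f, f.fst ∈ S ∧ f.snd = x ∧ G.Reach (insert x S) d f := by
  classical
  obtain ⟨y, hy, hxy⟩ := hx
  let f0 : G.graph.Dart := ⟨(y, x), hxy.symm⟩
  obtain ⟨i, hi⟩ := h.out f0 hy rfl
  have heR : G.Reach S b (G.nextIn S f0) := ⟨i, hi.symm⟩
  have he := heR.inS h.base
  obtain ⟨m, hm, hm'⟩ := exists_iterate_eq he
  -- `g` is the dart of the outer face before the corner that contains `f0`.
  set g := (G.faceIn S)^[m - 1] (G.nextIn S f0) with hg
  have hgR : G.Reach S b g := heR.trans ⟨m - 1, rfl⟩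
  have hgS := hgR.inS h.base
  have hge : G.faceIn S g = G.nextIn S f0 := by
    rw [hg, ← Function.iterate_succ_apply' (G.faceIn S), Nat.succ_eq_add_one,
      Nat.sub_add_cancel hm, hm']
  have hnext : G.IsNext S f0 (G.nextIn S f0) := by
    apply isNext_nextIn_of_adj (e := G.nextIn S f0) _ he.2
    unfold nextIn
    split_ifs
    · rw [fst_cw_pow]
    · rfl
  have hfg : f0.fst = g.snd := by rw [← fst_faceIn hgS, hge, hnext.fst_eq]
  have hg' : G.faceIn (insert x S) g = f0 := faceIn_insert_eq h.notMem hgS hfg rfl hge.symm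
  have hdS := hd.inS h.base
  obtain ⟨n, hn⟩ := (hd.symm h.base).trans hgR
  have hex : ∃ n, G.faceIn (insert x S) ((G.faceIn S)^[n] d) ≠ G.faceIn S ((G.faceIn S)^[n] d) := by
    refine ⟨n, fun h1 => h.notMem ?_⟩
    rw [hn, hg', hge] at h1
    have := he.2
    rw [← h1] at this
    exact this
  have hit : ∀ k ≤ Nat.find hex, (G.faceIn (insert x S))^[k] d = (G.faceIn S)^[k] d := by
    intro k hk
    induction k with
    | zero => rfl
    | succ k ih =>
      rw [Function.iterate_succ_apply', Function.iterate_succ_apply', ih (by omega)]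
      exact not_not.1 (Nat.find_min hex (show k < Nat.find hex by omega))
  have hS := inS_iterate hdS (Nat.find hex)
  have hspec := (faceIn_insert_cases (x := x) hS).resolve_left (Nat.find_spec hex)
  refine ⟨_, ?_, hspec.1, Nat.find hex + 1, ?_⟩
  · rw [fst_faceIn hS.mono]; exact hS.2
  · rw [Function.iterate_succ_apply', hit _ le_rfl]

/-- This is the inductive step of Euler's inequality, with hitting sets in place of numbers of
faces. The element `t0` for the old outer face is given up; all faces that are new contain a dart
from `S` to `x` and are met by `U`; the other faces are unchanged. -/
theorem Insertable.hit (h : G.Insertable b S x) (hx : ∃ y ∈ S, G.graph.Adj x y)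
    {T U : Finset G.graph.Dart} (hT : G.Hit S T)
    (hU : ∀ f, f.fst ∈ S → f.snd = x → ∃ u ∈ U, G.Reach (insert x S) f u) :
    ∃ T', G.Hit (insert x S) T' ∧ T'.card + 1 ≤ T.card + U.card := by
  classical
  obtain ⟨t0, ht0, hbt⟩ := hT b h.base
  have hnew : ∀ d, G.Reach S b d → ∃ u ∈ U, G.Reach (insert x S) d u := fun d hd => by
    obtain ⟨f, hf, hfx, hdf⟩ := h.reach_new hx hd
    obtain ⟨u, hu, hfu⟩ := hU f hf hfx
    exact ⟨u, hu, hdf.trans hfu⟩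
  refine ⟨T.erase t0 ∪ U, fun d hd => ?_, ?_⟩
  · rcases hd with ⟨hd1, hd2⟩
    rcases hd1 with hd1 | hd1
    · rcases hd2 with hd2 | hd2
      · exact absurd (hd1.trans hd2.symm) d.adj.ne
      · obtain ⟨i, hi⟩ := h.out d.symm hd2 hd1
        have hn : G.IsNext S d.symm (G.nextIn S d.symm) := by
          have h1 : G.InS S (G.nextIn S d.symm) := hi ▸ inS_iterate h.base i
          apply isNext_nextIn_of_adj (e := G.nextIn S d.symm) _ h1.2
          unfold nextIn
          split_ifs
          · rw [fst_cw_pow]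
          · rfl
        have h2 := faceIn_insert_symm hd1 hn
        rw [SimpleGraph.Dart.symm_symm] at h2
        obtain ⟨u, hu, hru⟩ := hnew _ ⟨i, hi.symm⟩
        exact ⟨u, by simp [hu], (h2 ▸ reach_faceIn d).trans hru⟩
    · rcases hd2 with hd2 | hd2
      · obtain ⟨u, hu, hru⟩ := hU d hd1 hd2
        exact ⟨u, by simp [hu], hru⟩
      · by_cases hr : G.Reach S b d
        · obtain ⟨u, hu, hru⟩ := hnew d hr
          exact ⟨u, by simp [hu], hru⟩
        · obtain ⟨t, ht, n, hn⟩ := hT d ⟨hd1, hd2⟩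
          refine ⟨t, ?_, n, (h.iterate_eq ⟨hd1, hd2⟩ hr n).trans hn⟩
          simp only [Finset.mem_union, Finset.mem_erase]
          refine Or.inl ⟨fun htt => hr ?_, ht⟩
          subst htt
          exact hbt.trans ((show G.Reach S d t from ⟨n, hn⟩).symm ⟨hd1, hd2⟩)
  · have h1 := Finset.card_union_le (T.erase t0) U
    have h2 := Finset.card_erase_add_one ht0
    omega

/-- The contour visits each vertex once, so the outer face has a single corner at the head of `e`,
and `f` leaves in that corner. -/
theorem Contour.nextIn_eq {C : List G.graph.Dart} (hC : G.Contour b S C)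
    (h : G.Insertable b S x) (he : e ∈ C) (hf : f.fst = e.snd) (hfx : f.snd = x) :
    G.nextIn S f = G.faceIn S e := by
  have heS := hC.inS e he
  obtain ⟨i, hi⟩ := h.out f (hf ▸ heS.2) hfx
  have hn : G.IsNext S f (G.nextIn S f) := isNext_nextIn_of_adj (e := e.symm) hf heS.1
  have hR : G.Reach S b (G.nextIn S f) := ⟨i, hi.symm⟩
  obtain ⟨m, hm, hm'⟩ := exists_iterate_eq (hR.inS h.base)
  have hgR : G.Reach S b ((G.faceIn S)^[m - 1] (G.nextIn S f)) := hR.trans ⟨m - 1, rfl⟩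
  have hge : G.faceIn S ((G.faceIn S)^[m - 1] (G.nextIn S f)) = G.nextIn S f := by
    rw [← Function.iterate_succ_apply' (G.faceIn S), Nat.succ_eq_add_one, Nat.sub_add_cancel hm,
      hm']
  rw [← hge]
  congr 1
  apply hC.eq_of_snd (hC.mem_iff.2 hgR) he
  rw [← fst_faceIn (hgR.inS h.base), hge, hn.fst_eq, hf]

theorem Contour.faceIn_insert {C : List G.graph.Dart} (hC : G.Contour b S C)
    (h : G.Insertable b S x) (he : e ∈ C) (hf : f.fst = e.snd) (hfx : f.snd = x) :
    G.faceIn (insert x S) e = f :=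
  faceIn_insert_eq h.notMem (hC.inS e he) hf hfx (hC.nextIn_eq h he hf hfx)

theorem Contour.faceIn_insert_symm {C : List G.graph.Dart} (hC : G.Contour b S C)
    (h : G.Insertable b S x) (he : e ∈ C) (hf : f.fst = e.snd) (hfx : f.snd = x) :
    G.faceIn (insert x S) f.symm = G.faceIn S e := by
  apply PlaneGraph.faceIn_insert_symm hfx
  rw [← hC.nextIn_eq h he hf hfx]
  exact isNext_nextIn_of_adj (e := e.symm) hf (hC.inS e he).1

theorem Contour.faceIn_insert_of_not_adj {C : List G.graph.Dart} (hC : G.Contour b S C)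
    (he : e ∈ C) (hx : ¬ G.graph.Adj x e.snd) : G.faceIn (insert x S) e = G.faceIn S e := by
  refine (faceIn_insert_cases (hC.inS e he)).resolve_right fun ⟨h1, h2⟩ => hx ?_
  have := (G.faceIn (insert x S) e).adj
  rw [h1, fst_faceIn (hC.inS e he).mono] at this
  exact this.symm

/-! ### The new contour and the rotation around the inserted vertex -/

section Insertion

variable {ep eq : G.graph.Dart} {CA CM CA' : List G.graph.Dart}

/-- The situation when `x` is added to the graph induced by `S`: its neighbors are the heads of a
sublist of the contour, and its edges are on distinct new faces. -/
structure ContourStep (b : G.graph.Dart) (S : Set V) (x : V) (ep eq : G.graph.Dart)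
    (CA CM CA' : List G.graph.Dart) : Prop where
  ins : G.Insertable b S x
  contour : G.Contour b S (CA ++ (ep :: (CM ++ [eq]) ++ CA'))
  adj : ∀ y ∈ S, G.graph.Adj x y ↔ y ∈ (ep :: (CM ++ [eq])).map fun d => d.snd
  sep : ∀ f f' : G.graph.Dart, f.fst ∈ S → f.snd = x → f'.fst ∈ S → f'.snd = x →
    G.Reach (insert x S) f f' → f = f'

namespace ContourStep

set_option linter.unusedSectionVars false

theorem adj_of_mem (h : ContourStep b S x ep eq CA CM CA') (he : e ∈ ep :: (CM ++ [eq])) :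
    G.graph.Adj x e.snd :=
  (h.adj e.snd (h.contour.inS e (by
    simp only [List.mem_append]; exact Or.inr (Or.inl he))).2).2 (List.mem_map_of_mem he)

theorem mem_contour (_h : ContourStep b S x ep eq CA CM CA') (he : e ∈ ep :: (CM ++ [eq])) :
    e ∈ CA ++ (ep :: (CM ++ [eq]) ++ CA') := by
  simp only [List.mem_append]; exact Or.inr (Or.inl he)

theorem disjoint (h : ContourStep b S x ep eq CA CM CA') (he : e ∈ CA ∨ e ∈ CA')
    (hf : f ∈ ep :: (CM ++ [eq])) : e.snd ≠ f.snd := by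
  have h1 := h.contour.nodup
  rw [List.map_append, List.map_append, List.nodup_append, List.nodup_append] at h1
  obtain ⟨-, ⟨-, -, h3⟩, h2⟩ := h1
  rcases he with he | he
  · exact h2 _ (List.mem_map_of_mem he) _
      (List.mem_append_left _ (List.mem_map_of_mem (f := fun d => d.snd) hf))
  · exact (h3 _ (List.mem_map_of_mem (f := fun d => d.snd) hf) _ (List.mem_map_of_mem he)).symm

theorem not_adj (h : ContourStep b S x ep eq CA CM CA') (he : e ∈ CA ∨ e ∈ CA') :
    ¬ G.graph.Adj x e.snd := by
  have heC : e ∈ CA ++ (ep :: (CM ++ [eq]) ++ CA') := by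
    simp only [List.mem_append]; tauto
  rw [h.adj e.snd (h.contour.inS e heC).2, List.mem_map]
  rintro ⟨f, hf, hfe⟩
  exact h.disjoint he hf hfe.symm

theorem chain_left (h : ContourStep b S x ep eq CA CM CA') :
    (CA ++ [ep]).IsChain fun d e => G.faceIn (insert x S) d = e := by
  apply isChain_congr_append (S := S)
  · have h1 := h.contour.chain
    rw [List.cons_append, List.append_assoc, List.cons_append, List.isChain_split] at h1
    exact h1.1
  · intro d hd
    exact h.contour.faceIn_insert_of_not_adj (by simp [hd]) (h.not_adj (Or.inl hd))

theorem chain_eq_right (h : ContourStep b S x ep eq CA CM CA') :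
    (eq :: (CA' ++ [b])).IsChain fun d e => G.faceIn S d = e := by
  have h1 := h.contour.chain
  rw [show CA ++ (ep :: (CM ++ [eq]) ++ CA') ++ [b] = (CA ++ ep :: CM) ++ eq :: (CA' ++ [b]) by
      simp,
    List.isChain_split] at h1
  exact h1.2

theorem chain_right (h : ContourStep b S x ep eq CA CM CA') :
    (CA' ++ [b]).IsChain fun d e => G.faceIn (insert x S) d = e := by
  apply isChain_congr_append (S := S)
  · exact h.chain_eq_right.tail
  · intro d hd
    exact h.contour.faceIn_insert_of_not_adj (by simp [hd]) (h.not_adj (Or.inr hd))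

theorem reach_ep (h : ContourStep b S x ep eq CA CM CA') : G.Reach (insert x S) b ep := by
  have h1 := h.chain_left
  have h2 := h.contour.head
  cases CA with
  | nil => simp at h2; rw [h2]; exact Reach.refl _
  | cons c CA => simp at h2; subst h2; exact reach_of_isChain h1 ep (by simp)

theorem reach_first (h : ContourStep b S x ep eq CA CM CA') (hf : f.fst = ep.snd)
    (hfx : f.snd = x) : G.Reach (insert x S) b f := by
  have := h.contour.faceIn_insert h.ins (e := ep) (h.mem_contour (by simp)) hf hfx
  exact h.reach_ep.trans (this ▸ reach_faceIn ep)

/-- After the dart from `x` to the head of `eq`, the face follows the remaining contour back to `b`.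
-/
theorem reach_base_of_last (h : ContourStep b S x ep eq CA CM CA') (hf : f.fst = x)
    (hfq : f.snd = eq.snd) :
    G.Reach (insert x S) f b := by
  have h1 := h.contour.faceIn_insert_symm h.ins (e := eq) (f := f.symm)
    (h.mem_contour (by simp)) hfq hf
  rw [SimpleGraph.Dart.symm_symm] at h1
  have h2 := h.chain_right
  have h3 := h.chain_eq_right
  have h4 := reach_faceIn (S := insert x S) f
  cases CA' with
  | nil =>
    simp at h3
    rw [h1, h3] at h4
    exact h4
  | cons c CA' =>
    rw [List.cons_append, List.isChain_cons_cons] at h3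
    rw [h1, h3.1] at h4
    exact h4.trans (reach_of_isChain h2 b (by simp))

theorem chain_mid (h : ContourStep b S x ep eq CA CM CA') {l1 l2 : List G.graph.Dart}
    {e e' : G.graph.Dart}
    (hl : ep :: (CM ++ [eq]) = l1 ++ e :: e' :: l2) : G.faceIn S e = e' := by
  have h1 := h.contour.chain
  rw [hl, show CA ++ (l1 ++ e :: e' :: l2 ++ CA') ++ [b] =
    (CA ++ l1) ++ e :: (e' :: l2 ++ CA' ++ [b]) by simp, List.isChain_split] at h1
  exact (List.isChain_cons_cons.1 h1.2).1

/-- Successor structure around `x`: if the dart `f` to `x` is followed by the dart to the head of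
`e` on its new face, then `f` starts at the vertex after `e` on the contour. -/
theorem around (h : ContourStep b S x ep eq CA CM CA') {l1 l2 : List G.graph.Dart}
    {e e' : G.graph.Dart}
    (hl : ep :: (CM ++ [eq]) = l1 ++ e :: e' :: l2) (hf : f.fst ∈ S) (hfx : f.snd = x)
    (hfe : (G.faceIn (insert x S) f).snd = e.snd) : f.fst = e'.snd := by
  have he' : e' ∈ ep :: (CM ++ [eq]) := by rw [hl]; simp
  have he : e ∈ ep :: (CM ++ [eq]) := by rw [hl]; simp
  have hfS : G.InS (insert x S) f := ⟨Or.inr hf, Or.inl hfx⟩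
  have h1 := h.contour.faceIn_insert_symm h.ins (e := e)
    (f := (G.faceIn (insert x S) f).symm) (h.mem_contour he) hfe
    ((fst_faceIn hfS).trans hfx)
  rw [SimpleGraph.Dart.symm_symm, h.chain_mid hl] at h1
  let f' : G.graph.Dart := ⟨(e'.snd, x), (h.adj_of_mem he').symm⟩
  have h2 := h.contour.faceIn_insert h.ins (f := f') (h.mem_contour he') rfl rfl
  -- The face runs along `f`, back to the head of `e`, along `e'`, and then along `f'` to `x`. Since
  -- distinct darts into `x` lie on distinct faces, `f = f'`.
  have h3 : G.Reach (insert x S) f f' := ⟨3, by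
    simp only [Function.iterate_succ, Function.iterate_zero, Function.comp, id]
    rw [h1, h2]⟩
  exact congrArg (fun d : G.graph.Dart => d.fst)
    (h.sep f f' hf hfx (h.contour.inS e' (h.mem_contour he')).2 rfl h3)

theorem exists_snd (h : ContourStep b S x ep eq CA CM CA') (hf : f.fst ∈ S) (hfx : f.snd = x) :
    ∃ e ∈ ep :: (CM ++ [eq]), (G.faceIn (insert x S) f).snd = e.snd := by
  have hfS : G.InS (insert x S) f := ⟨Or.inr hf, Or.inl hfx⟩
  have h1 := (inS_faceIn hfS).2
  have h2 := (G.faceIn (insert x S) f).adj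
  rw [fst_faceIn hfS, hfx] at h2
  have h3 := (h.adj _ (h1.resolve_left h2.ne')).1 h2
  obtain ⟨e, he, hes⟩ := List.mem_map.1 h3
  exact ⟨e, he, hes.symm⟩

/-- The dart from the head of `ep` to `x` lies on the outer face already, and `sep` admits only one
such dart. -/
theorem not_reach_tail (h : ContourStep b S x ep eq CA CM CA') {c : G.graph.Dart}
    (hc : c ∈ CM ++ [eq]) (hf : f.fst = c.snd)
    (hfx : f.snd = x) : ¬ G.Reach (insert x S) b f := by
  intro hr
  let f0 : G.graph.Dart := ⟨(ep.snd, x), (h.adj_of_mem (e := ep) (by simp)).symm⟩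
  have h1 := h.reach_first (f := f0) rfl rfl
  have hcC := h.mem_contour (List.mem_cons_of_mem ep hc)
  have h2 := h.sep f f0 (hf ▸ (h.contour.inS c hcC).2) hfx
    (h.contour.inS ep (h.mem_contour (by simp))).2 rfl ((hr.symm h.ins.base.mono).trans h1)
  have h3 : c.snd = ep.snd := by rw [← hf, h2]
  have h4 := h.contour.nodup
  rw [List.map_append, List.map_append, List.nodup_append, List.nodup_append, List.map_cons,
    List.nodup_cons] at h4
  exact h4.2.1.1.1 (h3 ▸ List.mem_map_of_mem hc)

/-- Consecutive neighbors on the contour are consecutive around `x`. If the face turned to the last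
neighbor, `f` would be on the outer face; any other neighbor is identified by `around`. -/
theorem faceIn_mid (h : ContourStep b S x ep eq CA CM CA') {l1 l2 : List G.graph.Dart}
    {e e' : G.graph.Dart}
    (hl : ep :: (CM ++ [eq]) = l1 ++ e :: e' :: l2) (hf : f.fst = e'.snd) (hfx : f.snd = x) :
    (G.faceIn (insert x S) f).snd = e.snd := by
  have he' : e' ∈ ep :: (CM ++ [eq]) := by rw [hl]; simp
  have he : e ∈ ep :: (CM ++ [eq]) := by rw [hl]; simp
  have he't : e' ∈ CM ++ [eq] := by
    cases l1 with
    | nil => rw [(List.cons.inj hl).2]; simp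
    | cons a l1 => rw [(List.cons.inj hl).2]; simp
  have hfS : f.fst ∈ S := hf ▸ (h.contour.inS e' (h.mem_contour he')).2
  have hfS' : G.InS (insert x S) f := ⟨Or.inr hfS, Or.inl hfx⟩
  obtain ⟨c, hc, hcs⟩ := h.exists_snd hfS hfx
  rcases eq_last_or_exists_next (l := ep :: CM) (z := eq) hc with rfl | ⟨k1, c', k2, hk⟩
  · exfalso
    have h1 := h.reach_base_of_last ((fst_faceIn hfS').trans hfx) hcs
    exact h.not_reach_tail he't hf hfx
      (((reach_faceIn f).trans h1).symm hfS')
  · have hk' : ep :: (CM ++ [eq]) = k1 ++ c :: c' :: k2 := hk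
    have h1 := h.around hk' hfS hfx hcs
    have hc' : c' ∈ ep :: (CM ++ [eq]) := by rw [hk']; simp
    have h2 : c' = e' := h.contour.eq_of_snd (h.mem_contour hc') (h.mem_contour he')
      (h1.symm.trans hf)
    have h3 : c = e := faceIn_inj (h.contour.inS c (h.mem_contour hc))
      (h.contour.inS e (h.mem_contour he)) (by rw [h.chain_mid hk', h.chain_mid hl, h2])
    rw [hcs, h3]

/-- If the face turned to a neighbor other than the last, `around` would make the head of `ep` also
the head of a later dart of the contour. -/
theorem faceIn_first (h : ContourStep b S x ep eq CA CM CA') (hf : f.fst = ep.snd)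
    (hfx : f.snd = x) :
    (G.faceIn (insert x S) f).snd = eq.snd := by
  have hfS : f.fst ∈ S := hf ▸ (h.contour.inS ep (h.mem_contour (by simp))).2
  obtain ⟨c, hc, hcs⟩ := h.exists_snd hfS hfx
  rcases eq_last_or_exists_next (l := ep :: CM) (z := eq) hc with rfl | ⟨k1, c', k2, hk⟩
  · exact hcs
  · exfalso
    have hk' : ep :: (CM ++ [eq]) = k1 ++ c :: c' :: k2 := hk
    have h1 := h.around hk' hfS hfx hcs
    have h4 := h.contour.nodup
    rw [List.map_append, List.map_append, List.nodup_append, List.nodup_append, hk'] at h4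
    have h5 := h4.2.1.1
    cases k1 with
    | nil =>
      have h6 := (List.cons.inj hk').1
      subst h6
      simp only [List.nil_append, List.map_cons, List.nodup_cons, List.mem_cons, not_or] at h5
      exact h5.1.1 (hf.symm.trans h1)
    | cons a k1 =>
      have h6 := (List.cons.inj hk').1
      subst h6
      simp only [List.cons_append, List.map_cons, List.map_append, List.nodup_cons, List.mem_cons,
        List.mem_append, not_or] at h5
      exact h5.1.2.2.1 (hf.symm.trans h1)

/-- The darts of `CM ++ [eq]` are replaced by the two darts through `x`. By induction, all contours
are simple cycles. -/
theorem contour_insert (h : ContourStep b S x ep eq CA CM CA') {f g : G.graph.Dart}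
    (hf : f.fst = ep.snd) (hfx : f.snd = x)
    (hg : g.fst = x) (hgq : g.snd = eq.snd) :
    G.Contour b (insert x S) (CA ++ ep :: f :: g :: CA') := by
  have hep : ep ∈ CA ++ (ep :: (CM ++ [eq]) ++ CA') := h.mem_contour (by simp)
  have heq : eq ∈ CA ++ (ep :: (CM ++ [eq]) ++ CA') := h.mem_contour (by simp)
  have hfS : G.InS (insert x S) f :=
    ⟨Or.inr (hf ▸ (h.contour.inS ep hep).2), Or.inl hfx⟩
  refine ⟨?_, ?_, ?_, ?_⟩
  · have := h.contour.head
    cases CA <;> simpa using this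
  · rw [show CA ++ ep :: f :: g :: CA' ++ [b] = CA ++ ep :: (f :: g :: (CA' ++ [b])) by simp,
      List.isChain_split, List.isChain_cons_cons, List.isChain_cons_cons]
    refine ⟨h.chain_left, h.contour.faceIn_insert h.ins hep hf hfx, ?_, ?_⟩
    · exact dart_ext_iff.2 ⟨(fst_faceIn hfS).trans (hfx.trans hg.symm),
        (h.faceIn_first hf hfx).trans hgq.symm⟩
    · rw [List.isChain_cons]
      refine ⟨fun y hy => ?_, h.chain_right⟩
      have h1 := h.contour.faceIn_insert_symm h.ins (e := eq) (f := g.symm) heq hgq hg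
      rw [SimpleGraph.Dart.symm_symm] at h1
      rw [h1]
      exact h.chain_eq_right.rel_head? hy
  · intro d hd
    simp only [List.mem_append, List.mem_cons] at hd
    rcases hd with hd | rfl | rfl | rfl | hd
    · exact (h.contour.inS d (by simp [hd])).mono
    · exact (h.contour.inS d hep).mono
    · exact hfS
    · exact ⟨Or.inl hg, Or.inr (hgq ▸ (h.contour.inS eq heq).2)⟩
    · exact (h.contour.inS d (by simp [hd])).mono
  · have h1 := h.contour.nodup
    have hx : ∀ d ∈ CA ++ (ep :: (CM ++ [eq]) ++ CA'), d.snd ≠ x := fun d hd h2 =>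
      h.ins.notMem (h2 ▸ (h.contour.inS d hd).2)
    simp only [List.map_append, List.map_cons, List.nodup_append, List.nodup_cons, List.mem_append,
      List.mem_cons, List.mem_map, hfx, hgq, List.cons_append] at h1 hx ⊢
    grind

end ContourStep

end Insertion

end PlaneGraph

/-! ### Canonical orderings: Euler's formula, contours and predecessors -/

namespace PlaneGraph

variable {V : Type*} {G : PlaneGraph V} {x y : V} {b d e f g : G.graph.Dart}
  {π : V ≃ Fin (Nat.card V)} {k : ℕ}

variable (G) in
/-- A canonical ordering of a graph with at least three vertices, the first three of which form a
triangle. -/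
structure Canon (b : G.graph.Dart) (π : V ≃ Fin (Nat.card V)) : Prop where
  ord : G.IsCanonicalOrdering b π
  card : 3 ≤ Nat.card V
  tri : ∀ x, (π x : ℕ) = 2 → G.graph.Adj x b.snd ∧ G.graph.Adj x b.fst

/-- The number of edges of the graph induced by the first `k` vertices. -/
noncomputable def edgeCount (G : PlaneGraph V) (π : V ≃ Fin (Nat.card V)) (k : ℕ) : ℕ :=
  {d : G.graph.Dart | π d.fst < π d.snd ∧ (π d.snd : ℕ) < k}.ncard

open Classical in
/-- The neighbors of `x` that precede it, in clockwise order along the outer face. -/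
noncomputable def preds (G : PlaneGraph V) (b : G.graph.Dart) (π : V ≃ Fin (Nat.card V)) (x : V) :
    List V :=
  (G.outerPath b (firstVertices π (π x))).filter fun y => G.graph.Adj x y

/-- `x` covers `y`: it is adjacent to `y` and to both neighbors of `y` on the outer face. -/
def Covers (G : PlaneGraph V) (b : G.graph.Dart) (π : V ≃ Fin (Nat.card V)) (x y : V) : Prop :=
  ∃ l₁ l₂, G.preds b π x = l₁ ++ y :: l₂ ∧ l₁ ≠ [] ∧ l₂ ≠ []

theorem mem_firstVertices : y ∈ firstVertices π k ↔ (π y : ℕ) < k := Iff.rfl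

theorem firstVertices_succ (hx : (π x : ℕ) = k) :
    firstVertices π (k + 1) = insert x (firstVertices π k) := by
  ext y
  simp only [mem_firstVertices, Set.mem_insert_iff]
  constructor
  · intro h
    by_cases hy : (π y : ℕ) = k
    · exact Or.inl (π.injective (Fin.ext (hy.trans hx.symm)))
    · exact Or.inr (by omega)
  · rintro (rfl | h) <;> omega

theorem firstVertices_card : firstVertices π (Nat.card V) = Set.univ := by
  ext y; simp [mem_firstVertices]

theorem nextIn_univ (d : G.graph.Dart) : G.nextIn Set.univ d = G.rot.cw d :=
  IsNext.nextIn_eq ⟨0, by simp, trivial, by simp⟩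

theorem faceIn_univ : G.faceIn Set.univ = G.rot.face := by
  funext d
  unfold faceIn
  rw [nextIn_univ]; rfl

/-- Two consecutive entries cannot lie on both sides of `p`, so a cut that keeps `p` in both halves
loses no pair. -/
theorem pair_infix_split {α : Type*} {a c p : α} {A R : List α} (h : [a, c] <:+: A ++ p :: R) :
    [a, c] <:+: A ++ [p] ∨ [a, c] <:+: p :: R := by
  induction A with
  | nil => exact Or.inr h
  | cons a0 A ih =>
    rw [List.cons_append, List.infix_cons_iff] at h
    rcases h with h | h
    · left
      obtain ⟨t, ht⟩ := h
      simp only [List.cons_append, List.nil_append, List.cons.injEq] at ht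
      obtain ⟨rfl, ht⟩ := ht
      cases A with
      | nil => simp at ht; obtain ⟨rfl, -⟩ := ht; exact ⟨[], [], by simp⟩
      | cons a1 A =>
        simp only [List.cons_append, List.cons.injEq] at ht
        obtain ⟨rfl, -⟩ := ht
        exact ⟨[], A ++ [p], by simp⟩
    · rcases ih h with h | h
      · left; rw [List.cons_append]; exact List.infix_cons h
      · exact Or.inr h

theorem filter_eq_of_nodup {α : Type*} {A B A' : List α} {P : α → Prop} [DecidablePred P]
    (hA : ∀ a ∈ A, ¬ P a) (hB : ∀ a ∈ B, P a) (hA' : ∀ a ∈ A', ¬ P a) :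
    (A ++ (B ++ A')).filter (fun a => P a) = B := by
  have h1 : A.filter (fun a => P a) = [] := List.filter_eq_nil_iff.2 (by simpa using hA)
  have h2 : A'.filter (fun a => P a) = [] := List.filter_eq_nil_iff.2 (by simpa using hA')
  have h3 : B.filter (fun a => P a) = B := List.filter_eq_self.2 (by simpa using hB)
  rw [List.filter_append, List.filter_append, h1, h2, h3]
  simp

namespace Canon

set_option linter.unusedSectionVars false

section NoFinite


theorem mem_two_iff (h : G.Canon b π) : y ∈ firstVertices π 2 ↔ y = b.snd ∨ y = b.fst := by
  rw [mem_firstVertices]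
  have h1 := h.ord.first
  have h2 := h.ord.second
  constructor
  · intro hy
    rcases (show (π y : ℕ) = 0 ∨ (π y : ℕ) = 1 by omega) with h0 | h0
    · exact Or.inl (π.injective (Fin.ext (h0.trans h1.symm)))
    · exact Or.inr (π.injective (Fin.ext (h0.trans h2.symm)))
  · rintro (rfl | rfl) <;> omega

theorem inS_base (h : G.Canon b π) (hk : 2 ≤ k) : G.InS (firstVertices π k) b := by
  have h1 := h.ord.first
  have h2 := h.ord.second
  constructor <;> rw [mem_firstVertices] <;> omega

end NoFinite

variable [Finite V]

theorem isNext_two (h : G.Canon b π) (hd : d.fst = b.snd) :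
    G.IsNext (firstVertices π 2) d b.symm := by
  have h1 : G.IsNext (firstVertices π 2) d (G.nextIn (firstVertices π 2) d) :=
    isNext_nextIn_of_adj (e := b.symm) hd (h.inS_base le_rfl).1
  have h2 : G.nextIn (firstVertices π 2) d = b.symm := by
    refine dart_ext_iff.2 ⟨h1.fst_eq.trans hd, (h.mem_two_iff.1 h1.snd_mem).resolve_left ?_⟩
    intro h3
    exact (G.nextIn (firstVertices π 2) d).adj.ne' (by rw [h3, h1.fst_eq, hd])
  exact h2 ▸ h1

theorem isNext_two' (h : G.Canon b π) (hd : d.fst = b.fst) : G.IsNext (firstVertices π 2) d b := by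
  have h1 : G.IsNext (firstVertices π 2) d (G.nextIn (firstVertices π 2) d) :=
    isNext_nextIn_of_adj (e := b) hd (h.inS_base le_rfl).2
  have h2 : G.nextIn (firstVertices π 2) d = b := by
    refine dart_ext_iff.2 ⟨h1.fst_eq.trans hd, (h.mem_two_iff.1 h1.snd_mem).resolve_right ?_⟩
    intro h3
    exact (G.nextIn (firstVertices π 2) d).adj.ne' (by rw [h3, h1.fst_eq, hd])
  exact h2 ▸ h1

/-- An edge has a single face, which passes both of its sides. Starting with two vertices allows the
third one to be treated like all others. -/
theorem contour_two (h : G.Canon b π) : G.Contour b (firstVertices π 2) [b, b.symm] := by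
  refine ⟨rfl, ?_, ?_, ?_⟩
  · simp only [List.cons_append, List.nil_append, List.isChain_cons_cons, List.isChain_singleton,
      and_true]
    exact ⟨(h.isNext_two rfl).nextIn_eq, by
      unfold faceIn; rw [SimpleGraph.Dart.symm_symm]; exact (h.isNext_two' rfl).nextIn_eq⟩
  · have := h.inS_base le_rfl
    intro d hd
    simp at hd
    rcases hd with rfl | rfl
    · exact this
    · exact ⟨this.2, this.1⟩
  · simp

/-- For the third vertex there is nothing to require: every corner belongs to the only face of the
base edge. -/
theorem insertable (h : G.Canon b π) (hx : 2 ≤ (π x : ℕ)) :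
    G.Insertable b (firstVertices π (π x)) x := by
  refine ⟨by simp [mem_firstVertices], h.inS_base hx, fun d hd hdx => ?_⟩
  rcases Nat.lt_or_ge 2 (π x : ℕ) with h3 | h3
  · exact h.ord.inOuterFace x h3 d hd hdx
  · have h2 : (π x : ℕ) = 2 := by omega
    rw [h2] at hd ⊢
    rcases h.mem_two_iff.1 hd with h4 | h4
    · exact ⟨1, by rw [(h.isNext_two h4).nextIn_eq]; exact (h.isNext_two rfl).nextIn_eq.symm⟩
    · exact ⟨0, (h.isNext_two' h4).nextIn_eq⟩

theorem interval (h : G.Canon b π) (hx : 2 ≤ (π x : ℕ)) :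
    ∃ B : List V, B <:+: G.outerPath b (firstVertices π (π x)) ∧ 2 ≤ B.length ∧
      ∀ y ∈ firstVertices π (π x), G.graph.Adj x y ↔ y ∈ B := by
  rcases Nat.lt_or_ge 2 (π x : ℕ) with h3 | h3
  · exact h.ord.interval x h3
  · have h2 : (π x : ℕ) = 2 := by omega
    rw [h2, h.contour_two.outerPath_eq]
    refine ⟨_, List.infix_refl _, by simp, fun y hy => ?_⟩
    have h4 := h.tri x h2
    rcases h.mem_two_iff.1 hy with rfl | rfl <;> simp [h4]

theorem exists_adj (h : G.Canon b π) (hx : 2 ≤ (π x : ℕ)) :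
    ∃ y ∈ firstVertices π (π x), G.graph.Adj x y := by
  obtain ⟨B, hB, hB2, hadj⟩ := h.interval hx
  cases B with
  | nil => simp at hB2
  | cons y B =>
    have hy : y ∈ firstVertices π (π x) := by
      have h1 := hB.subset (List.mem_cons_self ..)
      unfold outerPath at h1
      obtain ⟨i, -, rfl⟩ := List.mem_map.1 h1
      exact (inS_iterate (h.inS_base hx) i).2
    exact ⟨y, hy, (hadj y hy).2 (by simp)⟩

theorem edgeCount_succ (hx : (π x : ℕ) = k) :
    G.edgeCount π (k + 1) = G.edgeCount π k +
      {d : G.graph.Dart | d.fst ∈ firstVertices π k ∧ d.snd = x}.ncard := by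
  have : Finite G.graph.Dart := finite_dart
  unfold edgeCount
  rw [← Set.ncard_union_eq _ (Set.toFinite _) (Set.toFinite _)]
  · congr 1
    ext d
    simp only [Set.mem_ofPred_eq, Set.mem_union, mem_firstVertices, Fin.lt_def]
    constructor
    · rintro ⟨h1, h2⟩
      by_cases h3 : (π d.snd : ℕ) = k
      · exact Or.inr ⟨by omega, π.injective (Fin.ext (h3.trans hx.symm))⟩
      · exact Or.inl ⟨h1, by omega⟩
    · rintro (⟨h1, h2⟩ | ⟨h1, h2⟩)
      · exact ⟨h1, by omega⟩
      · rw [h2]; exact ⟨by omega, by omega⟩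
  · rw [Set.disjoint_left]
    rintro d ⟨-, h1⟩ ⟨-, h2⟩
    rw [h2] at h1
    omega

/-- There is a hitting set of the faces which is small by `c` compared with Euler's formula. -/
def Deficient (G : PlaneGraph V) (π : V ≃ Fin (Nat.card V)) (k c : ℕ) : Prop :=
  ∃ T, G.Hit (firstVertices π k) T ∧ T.card + k + c ≤ G.edgeCount π k + 2

/-- The vertex contributes `1`, the edges grow by the number of darts into `x`, and the hitting set
grows by at most `U.card - 1`. Hence every dart saved in `U` is added to the deficiency. -/
theorem deficient_insert (h : G.Canon b π) {c : ℕ} (hx : 2 ≤ (π x : ℕ)) (hD : Deficient G π (π x) c)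
    {c' : ℕ} (hc : ∃ U : Finset G.graph.Dart,
      (∀ f, f.fst ∈ firstVertices π (π x) → f.snd = x →
        ∃ u ∈ U, G.Reach (insert x (firstVertices π (π x))) f u) ∧
      U.card + c' ≤ {d : G.graph.Dart | d.fst ∈ firstVertices π (π x) ∧ d.snd = x}.ncard) :
    Deficient G π (π x + 1) (c + c') := by
  obtain ⟨T, hT, hTc⟩ := hD
  obtain ⟨U, hU, hUc⟩ := hc
  obtain ⟨T', hT', hTc'⟩ := (h.insertable hx).hit (h.exists_adj hx) hT hU
  refine ⟨T', by rwa [firstVertices_succ rfl], ?_⟩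
  rw [edgeCount_succ rfl]
  omega

theorem deficient_succ (h : G.Canon b π) {c : ℕ} (hx : 2 ≤ (π x : ℕ)) (hD : Deficient G π (π x) c) :
    Deficient G π (π x + 1) c := by
  classical
  have : Finite G.graph.Dart := finite_dart
  refine h.deficient_insert hx hD (c' := 0) ⟨(Set.toFinite _).toFinset, fun f hf hfx =>
    ⟨f, ?_, Reach.refl f⟩, (Set.ncard_eq_toFinset_card _ (Set.toFinite _)).ge⟩
  simp [hf, hfx]

theorem deficient_mono (h : G.Canon b π) {c k l : ℕ} (hk : 2 ≤ k) (hkl : k ≤ l)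
    (hl : l ≤ Nat.card V)
    (hD : Deficient G π k c) : Deficient G π l c := by
  induction l, hkl using Nat.le_induction with
  | base => exact hD
  | succ l hkl ih =>
    have h1 := h.deficient_succ (x := π.symm ⟨l, hl⟩) (c := c)
    simp only [Equiv.apply_symm_apply] at h1
    exact h1 (by omega) (ih (by omega))

theorem card_edgeSet : Nat.card G.graph.edgeSet = G.edgeCount π (Nat.card V) := by
  have h0 : {d : G.graph.Dart | π d.fst < π d.snd ∧ (π d.snd : ℕ) < Nat.card V} =
      {d : G.graph.Dart | π d.fst < π d.snd} := by
    ext d; simp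
  unfold edgeCount
  rw [h0, ← Nat.card_coe_set_eq]
  symm
  apply Nat.card_eq_of_bijective
    (f := fun d : {d : G.graph.Dart | π d.fst < π d.snd} => (⟨d.1.edge, d.1.edge_mem⟩ :
      G.graph.edgeSet))
  constructor
  · rintro ⟨d, hd⟩ ⟨e, he⟩ hde
    have h1 : d.edge = e.edge := congrArg Subtype.val hde
    rcases SimpleGraph.dart_edge_eq_iff d e |>.1 h1 with h2 | h2
    · exact Subtype.ext h2
    · subst h2
      exact absurd (show π e.fst < π e.snd from he) (lt_asymm hd)
  · rintro ⟨p, hp⟩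
    induction p using Sym2.ind with
    | _ a c =>
      have hac : G.graph.Adj a c := hp
      rcases lt_or_gt_of_ne (fun h1 => hac.ne (π.injective h1) : π a ≠ π c) with h1 | h1
      · exact ⟨⟨⟨(a, c), hac⟩, h1⟩, rfl⟩
      · exact ⟨⟨⟨(c, a), hac.symm⟩, h1⟩, Subtype.ext Sym2.eq_swap⟩

theorem card_dart : Nat.card G.graph.Dart = 2 * G.edgeCount π (Nat.card V) := by
  classical
  have := Fintype.ofFinite V
  rw [← card_edgeSet, Nat.card_eq_fintype_card, Nat.card_eq_fintype_card,
    G.graph.dart_card_eq_twice_card_edges, SimpleGraph.edgeFinset_card]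

/-- Planarity enters here: a set that meets all faces of `G` has at least `E - V + 2` elements. -/
theorem deficient_card {c : ℕ} (hD : Deficient G π (Nat.card V) c) : c = 0 := by
  obtain ⟨T, hT, hTc⟩ := hD
  rw [firstVertices_card] at hT
  have h1 : Nat.card G.rot.Face ≤ T.card := by
    have h2 : Function.Surjective fun t : T => G.rot.leftFace t.1 := by
      intro q
      induction q using Quotient.inductionOn with
      | _ d =>
        obtain ⟨t, ht, n, hn⟩ := hT d ⟨trivial, trivial⟩
        refine ⟨⟨t, ht⟩, Quotient.sound ?_⟩
        rw [faceIn_univ] at hn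
        refine Equiv.Perm.SameCycle.symm ⟨n, ?_⟩
        change (G.rot.face ^ (n : ℤ)) d = t
        rw [← hn, zpow_natCast, Equiv.Perm.iterate_eq_pow]
    have h3 := Nat.card_le_card_of_surjective _ h2
    simpa using h3
  have h2 := G.planar.2
  rw [card_edgeSet (π := π)] at h2
  omega

theorem deficient_two (h : G.Canon b π) : Deficient G π 2 0 := by
  have h1 := h.contour_two
  refine ⟨{b}, fun d hd => ⟨b, by simp, ?_⟩, ?_⟩
  · apply Reach.symm _ (h.inS_base le_rfl)
    rw [← h1.mem_iff]
    have h3 := d.adj.ne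
    rcases h.mem_two_iff.1 hd.1 with h2 | h2 <;> rcases h.mem_two_iff.1 hd.2 with h4 | h4
    · exact absurd (h2.trans h4.symm) h3
    · simp [show d = b.symm from dart_ext_iff.2 ⟨h2, h4⟩]
    · simp [show d = b from dart_ext_iff.2 ⟨h2, h4⟩]
    · exact absurd (h2.trans h4.symm) h3
  · have : Finite G.graph.Dart := finite_dart
    have h2 : 0 < G.edgeCount π 2 := by
      unfold edgeCount
      rw [Set.ncard_pos (Set.toFinite _)]
      refine ⟨b.symm, ?_, ?_⟩
      · change π b.snd < π b.fst
        rw [Fin.lt_def, h.ord.first, h.ord.second]; exact Nat.one_pos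
      · change (π b.fst : ℕ) < 2
        rw [h.ord.second]; exact Nat.one_lt_two
    simp; omega

/-- If two darts into `x` shared a face, one could be left out of `U`. The deficiency `1` would
persist up to the whole graph and contradict Euler's formula. -/
theorem sep (h : G.Canon b π) (hx : 2 ≤ (π x : ℕ)) {f f' : G.graph.Dart}
    (hf : f.fst ∈ firstVertices π (π x))
    (hfx : f.snd = x) (hf' : f'.fst ∈ firstVertices π (π x)) (hfx' : f'.snd = x)
    (hr : G.Reach (insert x (firstVertices π (π x))) f f') : f = f' := by
  classical
  have : Finite G.graph.Dart := finite_dart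
  by_contra hne
  have h1 : Deficient G π (π x + 1) (0 + 1) := by
    refine h.deficient_insert hx (h.deficient_mono le_rfl hx (π x).2.le h.deficient_two)
      ⟨(Set.toFinite {d : G.graph.Dart | d.fst ∈ firstVertices π (π x) ∧ d.snd = x}).toFinset.erase
        f, fun g hg hgx => ?_, ?_⟩
    · by_cases hgf : g = f
      · exact ⟨f', by simp [hf', hfx', Ne.symm hne], hgf ▸ hr⟩
      · exact ⟨g, by simp [hg, hgx, hgf], Reach.refl g⟩
    · rw [Set.ncard_eq_toFinset_card _ (Set.toFinite _), Finset.card_erase_add_one]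
      simp [hf, hfx]
  have h2 := deficient_card (h.deficient_mono (by omega) (π x).2 le_rfl h1)
  omega

theorem exists_contourStep_of_contour (h : G.Canon b π) (hx : 2 ≤ (π x : ℕ)) {C : List G.graph.Dart}
    (hC : G.Contour b (firstVertices π (π x)) C) :
    ∃ ep eq CA CM CA', ContourStep b (firstVertices π (π x)) x ep eq CA CM CA' := by
  obtain ⟨B, ⟨A, A', hB⟩, hB2, hadj⟩ := h.interval hx
  rw [hC.outerPath_eq, eq_comm, List.append_assoc, List.map_eq_append_iff] at hB
  obtain ⟨CA, C2, rfl, rfl, hB⟩ := hB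
  rw [List.map_eq_append_iff] at hB
  obtain ⟨CB, CA', rfl, rfl, rfl⟩ := hB
  rw [List.length_map] at hB2
  cases CB with
  | nil => simp at hB2
  | cons ep CB =>
    rcases List.eq_nil_or_concat CB with rfl | ⟨CM, eq, rfl⟩
    · simp at hB2
    · rw [List.concat_eq_append] at *
      exact ⟨ep, eq, CA, CM, CA', h.insertable hx, hC, hadj,
        fun f f' hf hfx hf' hfx' => h.sep hx hf hfx hf' hfx'⟩

theorem exists_contour (h : G.Canon b π) (hk : 2 ≤ k) (hkn : k ≤ Nat.card V) :
    ∃ C, G.Contour b (firstVertices π k) C := by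
  induction k, hk using Nat.le_induction with
  | base => exact ⟨_, h.contour_two⟩
  | succ k hk ih =>
    obtain ⟨C, hC⟩ := ih (by omega)
    obtain ⟨x, hx⟩ : ∃ x, (π x : ℕ) = k := ⟨π.symm ⟨k, hkn⟩, by simp⟩
    subst hx
    obtain ⟨ep, eq, CA, CM, CA', hs⟩ := h.exists_contourStep_of_contour hk hC
    have h1 := hs.contour_insert (f := ⟨(ep.snd, x), (hs.adj_of_mem (e := ep) (by simp)).symm⟩)
      (g := ⟨(x, eq.snd), hs.adj_of_mem (e := eq) (by simp)⟩) rfl rfl rfl rfl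
    exact ⟨_, by rwa [firstVertices_succ rfl]⟩

theorem exists_contourStep (h : G.Canon b π) (hx : 2 ≤ (π x : ℕ)) :
    ∃ ep eq CA CM CA', ContourStep b (firstVertices π (π x)) x ep eq CA CM CA' := by
  obtain ⟨C, hC⟩ := h.exists_contour hx (π x).2.le
  exact h.exists_contourStep_of_contour hx hC

theorem mem_outerPath (h : G.Canon b π) (hk : 2 ≤ k) (hy : y ∈ G.outerPath b (firstVertices π k)) :
    y ∈ firstVertices π k := by
  unfold outerPath at hy
  obtain ⟨i, -, rfl⟩ := List.mem_map.1 hy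
  exact (inS_iterate (h.inS_base hk) i).2

theorem outerPath_nodup (h : G.Canon b π) (hk : 2 ≤ k) (hkn : k ≤ Nat.card V) :
    (G.outerPath b (firstVertices π k)).Nodup := by
  obtain ⟨C, hC⟩ := h.exists_contour hk hkn
  rw [hC.outerPath_eq]; exact hC.nodup

theorem preds_eq {ep eq : G.graph.Dart} {CA CM CA' : List G.graph.Dart}
    (hs : ContourStep b (firstVertices π (π x)) x ep eq CA CM CA') :
    G.preds b π x = (ep :: (CM ++ [eq])).map fun d => d.snd := by
  classical
  unfold preds
  rw [hs.contour.outerPath_eq, List.map_append, List.map_append]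
  apply filter_eq_of_nodup (P := fun y => G.graph.Adj x y)
  · intro a ha
    obtain ⟨d, hd, rfl⟩ := List.mem_map.1 ha
    exact hs.not_adj (Or.inl hd)
  · intro a ha
    obtain ⟨d, hd, rfl⟩ := List.mem_map.1 ha
    exact hs.adj_of_mem hd
  · intro a ha
    obtain ⟨d, hd, rfl⟩ := List.mem_map.1 ha
    exact hs.not_adj (Or.inr hd)

/-- The change of the outer path when `x` is added. -/
theorem outerPath_step (h : G.Canon b π) (hx : 2 ≤ (π x : ℕ)) :
    ∃ A wp M wq A', G.preds b π x = wp :: (M ++ [wq]) ∧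
      G.outerPath b (firstVertices π (π x)) = A ++ (wp :: (M ++ [wq]) ++ A') ∧
      G.outerPath b (firstVertices π (π x + 1)) = A ++ wp :: x :: wq :: A' ∧
      (∀ y ∈ A, ¬ G.graph.Adj x y) ∧ ∀ y ∈ A', ¬ G.graph.Adj x y := by
  obtain ⟨ep, eq, CA, CM, CA', hs⟩ := h.exists_contourStep hx
  have h1 := hs.contour_insert (f := ⟨(ep.snd, x), (hs.adj_of_mem (e := ep) (by simp)).symm⟩)
      (g := ⟨(x, eq.snd), hs.adj_of_mem (e := eq) (by simp)⟩) rfl rfl rfl rfl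
  refine ⟨CA.map fun d => d.snd, ep.snd, CM.map fun d => d.snd, eq.snd, CA'.map fun d => d.snd,
    ?_, ?_, ?_, ?_, ?_⟩
  · rw [preds_eq hs]; simp
  · rw [hs.contour.outerPath_eq]; simp
  · rw [firstVertices_succ rfl, h1.outerPath_eq]; simp
  · intro a ha
    obtain ⟨d, hd, rfl⟩ := List.mem_map.1 ha
    exact hs.not_adj (Or.inl hd)
  · intro a ha
    obtain ⟨d, hd, rfl⟩ := List.mem_map.1 ha
    exact hs.not_adj (Or.inr hd)

theorem mem_preds (h : G.Canon b π) (hx : 2 ≤ (π x : ℕ)) :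
    y ∈ G.preds b π x ↔ G.graph.Adj x y ∧ π y < π x := by
  obtain ⟨ep, eq, CA, CM, CA', hs⟩ := h.exists_contourStep hx
  constructor
  · intro hy
    rw [preds_eq hs] at hy
    obtain ⟨d, hd, rfl⟩ := List.mem_map.1 hy
    exact ⟨hs.adj_of_mem hd, (hs.contour.inS d (hs.mem_contour hd)).2⟩
  · rintro ⟨h1, h2⟩
    rw [preds_eq hs]
    exact (hs.adj y h2).1 h1

theorem preds_nodup (h : G.Canon b π) (hx : 2 ≤ (π x : ℕ)) : (G.preds b π x).Nodup :=
  (h.outerPath_nodup hx (π x).2.le).filter _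

/-- Later vertices are put into the outer face, so a corner of an inner face of `G_k` is never
divided again. -/
theorem corner_persists (h : G.Canon b π) (hk : 2 ≤ k) (hkn : k ≤ Nat.card V)
    (hd : G.InS (firstVertices π k) d) (hr : ¬ G.Reach (firstVertices π k) b d) :
    G.rot.face d = G.faceIn (firstVertices π k) d ∧ ¬ G.Reach Set.univ b d := by
  have h1 : ∀ l, k ≤ l → l ≤ Nat.card V →
      G.InS (firstVertices π l) d ∧
      G.faceIn (firstVertices π l) d = G.faceIn (firstVertices π k) d ∧
      ¬ G.Reach (firstVertices π l) b d := by
    intro l hl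
    induction l, hl using Nat.le_induction with
    | base => exact fun _ => ⟨hd, rfl, hr⟩
    | succ l hkl ih =>
      intro hln
      obtain ⟨i1, i2, i3⟩ := ih (by omega)
      obtain ⟨x, hx⟩ : ∃ x, (π x : ℕ) = l := ⟨π.symm ⟨l, hln⟩, by simp⟩
      subst hx
      rw [firstVertices_succ rfl]
      have hI := h.insertable (x := x) (by omega)
      exact ⟨i1.mono, (hI.faceIn_eq i1 i3).trans i2, hI.not_reach i1 i3⟩
  obtain ⟨-, h2, h3⟩ := h1 _ hkn le_rfl
  rw [firstVertices_card] at h2 h3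
  rw [faceIn_univ] at h2
  exact ⟨h2, h3⟩

/-- The clockwise order around `x` of the vertices that precede it. -/
theorem face_pred (h : G.Canon b π) (hx : 2 ≤ (π x : ℕ)) {l₁ l₂ : List V} {a c : V}
    (hl : G.preds b π x = l₁ ++ a :: c :: l₂) (hf : f.fst = c) (hfx : f.snd = x) :
    (G.rot.face f).snd = a ∧ ¬ G.Reach Set.univ b f := by
  obtain ⟨ep, eq, CA, CM, CA', hs⟩ := h.exists_contourStep hx
  rw [preds_eq hs, List.map_eq_append_iff] at hl
  obtain ⟨k1, k2, hk, rfl, hl⟩ := hl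
  rw [List.map_eq_cons_iff] at hl
  obtain ⟨e, k3, rfl, rfl, hl⟩ := hl
  rw [List.map_eq_cons_iff] at hl
  obtain ⟨e', k4, rfl, rfl, rfl⟩ := hl
  have h1 := hs.faceIn_mid hk hf hfx
  have he' : e' ∈ CM ++ [eq] := by
    cases k1 with
    | nil => rw [(List.cons.inj hk).2]; simp
    | cons a k1 => rw [(List.cons.inj hk).2]; simp
  have h2 := hs.not_reach_tail he' hf hfx
  have hfS : G.InS (insert x (firstVertices π (π x))) f :=
    ⟨Or.inr (hf ▸ (hs.contour.inS e' (hs.mem_contour (List.mem_cons_of_mem _ he'))).2), Or.inl hfx⟩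
  rw [← firstVertices_succ rfl] at h1 h2 hfS
  obtain ⟨h3, h4⟩ := h.corner_persists (by omega) (π x).2 hfS h2
  exact ⟨by rw [h3, h1], h4⟩

theorem edgeCount_succ_preds (h : G.Canon b π) (hx : 2 ≤ (π x : ℕ)) :
    G.edgeCount π (π x + 1) = G.edgeCount π (π x) + (G.preds b π x).length := by
  classical
  rw [edgeCount_succ rfl, ← List.toFinset_card_of_nodup (h.preds_nodup hx)]
  congr 1
  rw [← Set.ncard_coe_finset, ← Set.InjOn.ncard_image (f := fun d : G.graph.Dart => d.fst)]
  · congr 1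
    ext y
    simp only [Set.mem_image, Set.mem_ofPred_eq, List.coe_toFinset, h.mem_preds hx]
    constructor
    · rintro ⟨d, ⟨h1, rfl⟩, rfl⟩
      exact ⟨d.adj.symm, h1⟩
    · rintro ⟨h1, h2⟩
      exact ⟨⟨(y, x), h1.symm⟩, ⟨h2, rfl⟩, rfl⟩
  · rintro d ⟨-, hd⟩ e ⟨-, he⟩ hde
    exact dart_ext_iff.2 ⟨hde, hd.trans he.symm⟩

theorem edgeCount_two (h : G.Canon b π) : G.edgeCount π 2 = 1 := by
  unfold edgeCount
  rw [Set.ncard_eq_one]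
  refine ⟨b.symm, ?_⟩
  ext d
  simp only [Set.mem_ofPred_eq, Set.mem_singleton_iff, dart_ext_iff, Fin.lt_def]
  have h1 := h.ord.first
  have h2 := h.ord.second
  constructor
  · rintro ⟨h3, h4⟩
    exact ⟨π.injective (Fin.ext (show (π d.fst : ℕ) = π b.snd by omega)),
      π.injective (Fin.ext (show (π d.snd : ℕ) = π b.fst by omega))⟩
  · rintro ⟨h3, h4⟩
    rw [h3, h4]
    change (π b.snd : ℕ) < π b.fst ∧ (π b.fst : ℕ) < 2
    omega

/-- A vertex with `q` predecessors adds `q` edges and changes the length of the contour by `3 - q`.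
The resulting linear bound on the number of darts is what makes the running time linear in `n`. -/
theorem edgeCount_add_length (h : G.Canon b π) (hk : 2 ≤ k) (hkn : k ≤ Nat.card V) :
    G.edgeCount π k + (G.outerPath b (firstVertices π k)).length + 3 = 3 * k := by
  induction k, hk using Nat.le_induction with
  | base => rw [h.edgeCount_two, h.contour_two.outerPath_eq]; simp
  | succ k hk ih =>
    obtain ⟨x, hx⟩ : ∃ x, (π x : ℕ) = k := ⟨π.symm ⟨k, hkn⟩, by simp⟩
    subst hx
    obtain ⟨A, wp, M, wq, A', h1, h2, h3, -⟩ := h.outerPath_step hk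
    have h4 := ih (by omega)
    rw [h.edgeCount_succ_preds hk, h1, h3]
    rw [h2] at h4
    simp at h4 ⊢
    omega

theorem card_dart_le (h : G.Canon b π) : Nat.card G.graph.Dart ≤ 6 * Nat.card V := by
  have h1 := h.edgeCount_add_length (k := Nat.card V) (by have := h.card; omega) le_rfl
  rw [card_dart (π := π)]
  omega

/-- Every edge is on the outer face, or is followed by another edge with the same tail, or leads to
the vertex that covers its tail. -/
theorem edge_cases_at (h : G.Canon b π) (hk : 2 ≤ k) (hkn : k ≤ Nat.card V) {y t : V}
    (ht : (π t : ℕ) < k)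
    (hyt : G.graph.Adj y t) (hlt : π y < π t) :
    ([y, t] <:+: G.outerPath b (firstVertices π k) ∨
      [t, y] <:+: G.outerPath b (firstVertices π k)) ∨
    (∃ t', (G.graph.Adj y t' ∧ π y < π t') ∧ G.graph.Adj t t' ∧ π t < π t') ∨
    G.Covers b π t y := by
  induction k, hk using Nat.le_induction with
  | base =>
    left; left
    rw [h.contour_two.outerPath_eq]
    have h1 := h.ord.first
    have h2 := h.ord.second
    rw [Fin.lt_def] at hlt
    have h3 : y = b.snd := π.injective (Fin.ext (by omega))
    have h4 : t = b.fst := π.injective (Fin.ext (by omega))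
    rw [h3, h4]
    exact List.infix_refl _
  | succ k hk ih =>
    obtain ⟨x, hx⟩ : ∃ x, (π x : ℕ) = k := ⟨π.symm ⟨k, hkn⟩, by simp⟩
    subst hx
    obtain ⟨A, wp, M, wq, A', h1, h2, h3, -⟩ := h.outerPath_step hk
    rcases Nat.lt_succ_iff_lt_or_eq.1 ht with ht | ht
    -- A contour edge that disappears joins two consecutive neighbors of `x`.
    · have key : ∀ a c, (G.graph.Adj a c ∧ (π a : ℕ) < π x ∧ (π c : ℕ) < π x) →
          [a, c] <:+: G.outerPath b (firstVertices π (π x)) →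
          [a, c] <:+: G.outerPath b (firstVertices π (π x + 1)) ∨
          (G.graph.Adj a x ∧ G.graph.Adj c x) := by
        intro a c hac hinf
        rw [h2, List.cons_append] at hinf
        rw [h3]
        rcases pair_infix_split hinf with hinf | hinf
        · left
          exact hinf.trans ⟨[], x :: wq :: A', by simp⟩
        · rw [show wp :: (M ++ [wq] ++ A') = (wp :: M) ++ wq :: A' by simp] at hinf
          rcases pair_infix_split hinf with hinf | hinf
          · right
            have hm : ∀ z ∈ [a, c], G.graph.Adj z x := fun z hz => by
              have : z ∈ G.preds b π x := by rw [h1]; simpa using hinf.subset hz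
              exact ((h.mem_preds hk).1 this).1.symm
            exact ⟨hm a (by simp), hm c (by simp)⟩
          · left
            exact hinf.trans ⟨A ++ [wp, x], [], by simp⟩
      have hy : (π y : ℕ) < π x := lt_trans hlt ht
      have new : G.graph.Adj y x ∧ G.graph.Adj t x →
          ∃ t', (G.graph.Adj y t' ∧ π y < π t') ∧ G.graph.Adj t t' ∧ π t < π t' :=
        fun ⟨h5, h6⟩ => ⟨x, ⟨h5, hy⟩, h6, ht⟩
      rcases ih (by omega) ht with (hc | hc) | hc | hc
      · rcases key y t ⟨hyt, hy, ht⟩ hc with h5 | h5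
        · exact Or.inl (Or.inl h5)
        · exact Or.inr (Or.inl (new h5))
      · rcases key t y ⟨hyt.symm, ht, hy⟩ hc with h5 | h5
        · exact Or.inl (Or.inr h5)
        · exact Or.inr (Or.inl (new h5.symm))
      · exact Or.inr (Or.inl hc)
      · exact Or.inr (Or.inr hc)
    · have hxt : t = x := π.injective (Fin.ext ht)
      subst hxt
      have h5 : y ∈ G.preds b π t := (h.mem_preds hk).2 ⟨hyt.symm, hlt⟩
      rw [h1, List.mem_cons, List.mem_append, List.mem_singleton] at h5
      rw [h3]
      rcases h5 with rfl | h5 | rfl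
      · exact Or.inl (Or.inl ⟨A, wq :: A', by simp⟩)
      · obtain ⟨l1, l2, rfl⟩ := List.append_of_mem h5
        exact Or.inr (Or.inr ⟨wp :: l1, l2 ++ [wq], by rw [h1]; simp, by simp, by simp⟩)
      · exact Or.inl (Or.inr ⟨A ++ [wp], A', by simp⟩)

end Canon

end PlaneGraph

/-! ### Heights and total variation along paths with slopes `±1` -/

/-- The distance of two natural numbers. -/
def adist (a b : ℕ) : ℕ := (a - b) + (b - a)

/-- The height of the first vertex of a list, `0` if there is none. -/
def headHeight {V : Type*} (Y : V → ℕ) : List V → ℕ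
  | [] => 0
  | a :: _ => Y a

/-- The total variation of the heights along a list of vertices that ends at height `0`. -/
def heightSum {V : Type*} (Y : V → ℕ) : List V → ℕ
  | [] => 0
  | a :: l => adist (Y a) (headHeight Y l) + heightSum Y l

section HeightSum

variable {V : Type*} {X Y Y' : V → ℕ} {l : List V} {a : V}

theorem headHeight_cons : headHeight Y (a :: l) = Y a := rfl

theorem heightSum_cons :
    heightSum Y (a :: l) = adist (Y a) (headHeight Y l) + heightSum Y l := rfl

theorem headHeight_le_heightSum : headHeight Y l ≤ heightSum Y l := by
  induction l with
  | nil => simp [headHeight]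
  | cons c l ih => simp only [headHeight_cons, heightSum_cons, adist]; omega

/-- The variation is at least that of going from the first height to `Y a` and then down to `0`.
With the additional `2` in the height formula, a new vertex lies strictly above its predecessors. -/
theorem two_mul_le_heightSum (ha : a ∈ l) : 2 * Y a ≤ headHeight Y l + heightSum Y l := by
  induction l with
  | nil => simp at ha
  | cons c l ih =>
    have h1 := headHeight_le_heightSum (Y := Y) (l := l)
    simp only [headHeight_cons, heightSum_cons, adist]
    rcases List.mem_cons.1 ha with rfl | ha
    · omega
    · have := ih ha; omega

/-- An integer walk that starts and ends at `0` has even variation. Therefore the new heights are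
integers. -/
theorem even_headHeight_add_heightSum : (headHeight Y l + heightSum Y l) % 2 = 0 := by
  induction l with
  | nil => simp [headHeight, heightSum]
  | cons c l ih => simp only [headHeight_cons, heightSum_cons, adist]; omega

theorem headHeight_congr (h : ∀ a ∈ l, Y a = Y' a) : headHeight Y l = headHeight Y' l := by
  cases l with
  | nil => rfl
  | cons c l => exact h c (by simp)

theorem heightSum_congr (h : ∀ a ∈ l, Y a = Y' a) : heightSum Y l = heightSum Y' l := by
  induction l with
  | nil => rfl
  | cons c l ih =>
    simp only [heightSum]
    rw [h c (by simp), ih fun a ha => h a (by simp [ha]),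
      headHeight_congr fun a ha => h a (by simp [ha])]

variable (X Y) in
/-- Consecutive vertices of a path with slopes `±1`. -/
def GapChain (l : List V) : Prop :=
  l.IsChain fun a c => X c = X a + adist (Y a) (Y c)

/-- The term `Y q` on the left is the final descent to `0`, which `heightSum` includes. -/
theorem GapChain.last {q : V} (h : GapChain X Y (a :: (l ++ [q]))) :
    X q + Y q = X a + heightSum Y (a :: (l ++ [q])) := by
  induction l generalizing a with
  | nil =>
    simp only [GapChain, List.nil_append, List.isChain_cons_cons] at h
    simp only [heightSum, headHeight, List.nil_append]
    have h1 := h.1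
    unfold adist at *
    omega
  | cons c l ih =>
    simp only [GapChain, List.cons_append, List.isChain_cons_cons] at h
    have h1 := ih h.2
    rw [h1, h.1]
    simp only [heightSum, headHeight, List.cons_append]
    omega

theorem GapChain.shift {X' : V → ℕ} {c : ℕ} (h : GapChain X Y l)
    (hX : ∀ a ∈ l, X' a = X a + c) (hY : ∀ a ∈ l, Y' a = Y a) : GapChain X' Y' l := by
  induction l with
  | nil => exact List.isChain_nil
  | cons a l ih =>
    unfold GapChain at *
    rw [List.isChain_cons] at h ⊢
    refine ⟨fun y hy => ?_, ih h.2 (fun a ha => hX a (by simp [ha]))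
      fun a ha => hY a (by simp [ha])⟩
    have hyl : y ∈ l := List.mem_of_mem_head? hy
    rw [hX a (by simp), hX y (by simp [hyl]), hY a (by simp), hY y (by simp [hyl]), h.1 y hy]
    omega

end HeightSum

/-! ### The invariant of the drawing algorithm -/

namespace PlaneGraph

variable {V : Type*} {G : PlaneGraph V} {x y : V} {b : G.graph.Dart}
  {π : V ≃ Fin (Nat.card V)} {k : ℕ} {s : FPPState V} {X Y : V → ℕ}

variable (G) in
/-- The state of the algorithm when the first `k` vertices have been drawn, at the integer
coordinates `X` and `Y`. -/
structure Drawn (b : G.graph.Dart) (π : V ≃ Fin (Nat.card V)) (k : ℕ) (s : FPPState V)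
    (X Y : V → ℕ) : Prop where
  pos : ∀ y, (π y : ℕ) < k → s.pos y = ((X y : ℝ), (Y y : ℝ))
  gap : GapChain X Y (G.outerPath b (firstVertices π k))
  self : ∀ a ∈ G.outerPath b (firstVertices π k), a ∈ s.M a
  pair : (G.outerPath b (firstVertices π k)).Pairwise fun a c => c ∈ s.M a ∧ a ∉ s.M c
  sub : ∀ a ∈ G.outerPath b (firstVertices π k), ∀ y ∈ s.M a, (π y : ℕ) < k
  cov : ∀ y, (π y : ℕ) < k → y ∉ G.outerPath b (firstVertices π k) →
    ∃ x l₁ l₂, (π x : ℕ) < k ∧ 2 ≤ (π x : ℕ) ∧ G.preds b π x = l₁ ++ y :: l₂ ∧ l₁ ≠ [] ∧ l₂ ≠ [] ∧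
      X y + 1 + heightSum Y (y :: l₂) = X x + Y x ∧
      ∀ a ∈ G.outerPath b (firstVertices π k), y ∈ s.M a ↔ x ∈ s.M a
  height : ∀ x, (π x : ℕ) < k → 2 ≤ (π x : ℕ) →
    2 * Y x = 2 + headHeight Y (G.preds b π x) + heightSum Y (G.preds b π x)
  first : X b.snd = 0 ∧ Y b.snd = 0
  second : Y b.fst = 0
  le : ∀ y ∈ G.outerPath b (firstVertices π k), Y y ≤ X y
  bound : ∀ y, (π y : ℕ) < k → X y ≤ 2 * k ∧ Y y ≤ 2 * k

theorem takeWhile_append_of_neg {α : Type*} {P : α → Bool} {A R : List α} {p : α}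
    (hA : ∀ a ∈ A, P a = true) (hp : P p = false) : (A ++ p :: R).takeWhile P = A := by
  induction A with
  | nil => simp [hp]
  | cons a A ih =>
    rw [List.cons_append, List.takeWhile_cons, hA a (by simp), if_pos rfl,
      ih fun c hc => hA c (by simp [hc])]

namespace Canon

set_option linter.unusedSectionVars false

variable [Finite V]

-- Because the sets `M` are nested along the contour, the vertices up to `wp` stay, those strictly
-- between `wp` and `wq` move by `1`, and those from `wq` on move by `2`. A vertex that was covered
-- before moves together with the vertex that covers it.
set_option maxHeartbeats 1000000 in
theorem drawn_succ (h : G.Canon b π) (hx3 : 3 ≤ (π x : ℕ)) (hD : G.Drawn b π (π x) s X Y) :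
    ∃ X' Y', G.Drawn b π (π x + 1)
      (G.fppStep x (G.outerPath b (firstVertices π (π x))) s) X' Y' := by
  classical
  have hx : 2 ≤ (π x : ℕ) := by omega
  obtain ⟨A, wp, M, wq, A', hB, hL, hL', hA, hA'⟩ := h.outerPath_step hx
  obtain ⟨wp1, rest, hN⟩ : ∃ wp1 rest, M ++ [wq] = wp1 :: rest := by
    cases M with
    | nil => exact ⟨wq, [], rfl⟩
    | cons m M => exact ⟨m, M ++ [wq], rfl⟩
  have hadj : ∀ y ∈ wp :: (M ++ [wq]), G.graph.Adj x y ∧ π y < π x := fun y hy =>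
    (h.mem_preds hx).1 (hB ▸ hy)
  have hLS : ∀ y ∈ G.outerPath b (firstVertices π (π x)), (π y : ℕ) < π x := fun y hy =>
    h.mem_outerPath hx hy
  have hfil : (G.outerPath b (firstVertices π (π x))).filter (fun y => G.graph.Adj x y) =
      wp :: wp1 :: rest := by rw [← hN, ← hB]; rfl
  have htake : (G.outerPath b (firstVertices π (π x))).takeWhile (fun w => ¬ G.graph.Adj x w) =
      A := by
    rw [hL, List.cons_append]
    exact takeWhile_append_of_neg (by simpa using hA) (by simpa using (hadj wp (by simp)).1)
  have hlast : (wp1 :: rest).getLast (List.cons_ne_nil _ _) = wq := by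
    simp only [← hN]; simp
  -- positions of the contour vertices relative to the two shifts
  have hself := hD.self
  have hpair := hD.pair
  have hsub := hD.sub
  have hgap := hD.gap
  have hle := hD.le
  have hcov := hD.cov
  have hnd := h.outerPath_nodup hx (π x).2.le
  rw [hL] at hself hpair hsub hgap hle hcov hLS hnd
  have hwp1 : wp1 ∈ M ++ [wq] := by rw [hN]; simp
  have shA : ∀ a, a ∈ A ∨ a = wp → a ∉ s.M wp1 ∧ a ∉ s.M wq := by
    intro a ha
    have : ∀ c ∈ M ++ [wq], a ∉ s.M c := by
      intro c hc
      simp only [List.pairwise_append, List.pairwise_cons, List.cons_append, List.mem_append,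
        List.mem_cons] at hpair
      rcases ha with ha | rfl
      · exact (hpair.2.2 a ha c (by simp at hc ⊢; tauto)).2
      · exact (hpair.2.1.1 c (by simp at hc ⊢; tauto)).2
    exact ⟨this wp1 hwp1, this wq (by simp)⟩
  have shN : ∀ c ∈ M ++ [wq], c ∈ s.M wp1 := by
    intro c hc
    rw [hN] at hc hpair hself
    rcases List.mem_cons.1 hc with rfl | hc
    · exact hself c (by simp)
    · simp only [List.pairwise_append, List.pairwise_cons, List.cons_append] at hpair
      exact (hpair.2.1.2.1 c (by simp [hc])).1
  have shM : ∀ m ∈ M, ∀ a, a = wq ∨ a ∈ A' → m ∉ s.M a := by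
    intro m hm a ha
    simp only [List.pairwise_append, List.pairwise_cons, List.cons_append,
      List.append_assoc] at hpair
    exact (hpair.2.1.2.2.2 m hm a (by simpa using ha)).2
  have shA' : ∀ a ∈ A', a ∈ s.M wp1 ∧ a ∈ s.M wq := by
    intro a ha
    have : ∀ c ∈ M ++ [wq], a ∈ s.M c := by
      intro c hc
      simp only [List.pairwise_append, List.pairwise_cons, List.cons_append] at hpair
      exact (hpair.2.1.2.2.2 c hc a ha).1
    exact ⟨this wp1 hwp1, this wq (by simp)⟩
  have shAM : ∀ a, a ∈ A ∨ a = wp → ∀ m ∈ M, m ∈ s.M a := by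
    intro a ha m hm
    simp only [List.pairwise_append, List.pairwise_cons, List.cons_append] at hpair
    rcases ha with ha | rfl
    · exact (hpair.2.2 a ha m (by simp [hm])).1
    · exact (hpair.2.1.1 m (by simp [hm])).1
  have shq : wq ∈ s.M wq := hself wq (by simp)
  -- coordinates
  set sh : V → ℕ := fun y => (if y ∈ s.M wp1 then 1 else 0) + (if y ∈ s.M wq then 1 else 0) with hsh
  have sh0 : ∀ a, a ∈ A ∨ a = wp → sh a = 0 := fun a ha => by simp [hsh, shA a ha]
  have sh1 : ∀ m ∈ M, sh m = 1 := fun m hm => by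
    simp [hsh, shN m (by simp [hm]), shM m hm wq (Or.inl rfl)]
  have sh2 : ∀ a, a = wq ∨ a ∈ A' → sh a = 2 := by
    rintro a (rfl | ha)
    · simp [hsh, shN a (by simp), shq]
    · simp [hsh, shA' a ha]
  have hne : ∀ y, (π y : ℕ) < π x → y ≠ x := by rintro y hy rfl; omega
  -- The lines meet at height `((X wq + 2 + Y wq) - (X wp - Y wp)) / 2`, where `GapChain.last`
  -- expresses `X wq + Y wq` by the variation.
  set yx : ℕ := (2 + headHeight Y (wp :: (M ++ [wq])) + heightSum Y (wp :: (M ++ [wq]))) / 2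
    with hyx
  have hyx2 : 2 * yx = 2 + Y wp + heightSum Y (wp :: (M ++ [wq])) := by
    have := even_headHeight_add_heightSum (Y := Y) (l := wp :: (M ++ [wq]))
    simp only [headHeight] at *
    omega
  have hyxle : ∀ a ∈ wp :: (M ++ [wq]), Y a + 1 ≤ yx := by
    intro a ha
    have := two_mul_le_heightSum (Y := Y) ha
    simp only [headHeight] at this
    omega
  have hwpy := hyxle wp (by simp)
  have hwqy := hyxle wq (by simp)
  have hgapB : GapChain X Y (wp :: (M ++ [wq])) := by
    have h1 : GapChain X Y (A ++ (wp :: (M ++ [wq]) ++ A')) := hgap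
    unfold GapChain at *
    exact h1.right_of_append.left_of_append
  have hq := hgapB.last
  have hlewp : Y wp ≤ X wp := hle wp (by simp)
  set X' : V → ℕ := fun y => if y = x then X wp + (yx - Y wp) else X y + sh y with hX'
  set Y' : V → ℕ := fun y => if y = x then yx else Y y with hY'
  have hX'ne : ∀ y, y ≠ x → X' y = X y + sh y := fun y hy => by simp [hX', hy]
  have hY'ne : ∀ y, y ≠ x → Y' y = Y y := fun y hy => by simp [hY', hy]
  have hX'x : X' x = X wp + (yx - Y wp) := by simp [hX']
  have hY'x : Y' x = yx := by simp [hY']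
  have hmemL : ∀ a, a ∈ A ++ wp :: x :: wq :: A' ↔
      ((a ∈ A ∨ a = wp) ∨ a = x) ∨ (a = wq ∨ a ∈ A') := by
    intro a; simp only [List.mem_append, List.mem_cons]; tauto
  have hneA : ∀ a, a ∈ A ∨ a = wp → a ≠ x := fun a ha =>
    hne a (hLS a (by simp only [List.mem_append, List.mem_cons]; tauto))
  have hneA' : ∀ a, a = wq ∨ a ∈ A' → a ≠ x := fun a ha =>
    hne a (hLS a (by simp only [List.mem_append, List.mem_cons]; tauto))
  have hA'notA : ∀ a, a = wq ∨ a ∈ A' → ¬ (a ∈ A ∨ a = wp) := by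
    rintro a ha hc
    have h1 := sh0 a hc
    have h2 := sh2 a ha
    omega
  set s' := G.fppStep x (G.outerPath b (firstVertices π (π x))) s with hs'
  have hpos' : s'.pos = fun y => if y = x then
      slopeIntersection ((s.pos wp).1 + (if wp ∈ s.M wp1 then 1 else 0) +
        (if wp ∈ s.M wq then 1 else 0), (s.pos wp).2)
        ((s.pos wq).1 + (if wq ∈ s.M wp1 then 1 else 0) +
        (if wq ∈ s.M wq then 1 else 0), (s.pos wq).2)
      else ((s.pos y).1 + (if y ∈ s.M wp1 then 1 else 0) +
        (if y ∈ s.M wq then 1 else 0), (s.pos y).2) := by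
    rw [hs']; unfold fppStep; simp only [hfil, hlast]
  have hM' : s'.M = fun y => if y = x then insert x (s.M wp1)
        else if y ∈ A ∨ y = wp then insert x (s.M y) else s.M y := by
    rw [hs']; unfold fppStep; simp only [hfil, htake]
  clear_value s' X' Y' sh yx
  have hM'x : s'.M x = insert x (s.M wp1) := by rw [hM']; simp
  have hMleft : ∀ a, a ∈ A ∨ a = wp → s'.M a = insert x (s.M a) := fun a ha => by
    rw [hM']; simp only [if_neg (hneA a ha), if_pos ha]
  have hMright : ∀ a, a = wq ∨ a ∈ A' → s'.M a = s.M a := fun a ha => by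
    rw [hM']; simp only [if_neg (hneA' a ha), if_neg (hA'notA a ha)]
  have hxM : ∀ a, a ∈ A ++ (wp :: (M ++ [wq]) ++ A') → x ∉ s.M a := fun a ha hc =>
    lt_irrefl _ (hsub a ha x hc)
  have hcast : ∀ y, (s.pos y).1 = X y → (s.pos y).1 + (if y ∈ s.M wp1 then 1 else 0) +
      (if y ∈ s.M wq then 1 else 0) = ((X y + sh y : ℕ) : ℝ) := by
    intro y hy; rw [hy, hsh]; push_cast; ring
  refine ⟨X', Y', ?_, ?_, ?_, ?_, ?_, ?_, ?_, ?_, ?_, ?_, ?_⟩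
  · -- positions
    intro y hy
    rw [hpos']
    by_cases hyx' : y = x
    · subst hyx'
      have p1 := hD.pos wp (hadj wp (by simp)).2
      have p2 := hD.pos wq (hadj wq (by simp)).2
      simp only [if_true]
      rw [hcast wp (by rw [p1]), hcast wq (by rw [p2]), p1, p2, sh0 wp (Or.inr rfl),
        sh2 wq (Or.inl rfl), hX'x, hY'x]
      have e1 : (X wq : ℝ) + Y wq = X wp + heightSum Y (wp :: (M ++ [wq])) := by exact_mod_cast hq
      have e2 : (2 : ℝ) * yx = 2 + Y wp + heightSum Y (wp :: (M ++ [wq])) := by exact_mod_cast hyx2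
      unfold slopeIntersection
      push_cast [Nat.cast_sub (show Y wp ≤ yx by omega)]
      ext <;> simp only <;> linarith
    · have hy' : (π y : ℕ) < π x := by
        have : (π y : ℕ) ≠ π x := fun hc => hyx' (π.injective (Fin.ext hc))
        omega
      have p1 := hD.pos y hy'
      simp only [if_neg hyx']
      rw [hcast y (by rw [p1]), hX'ne y hyx', hY'ne y hyx', p1]
  · -- slopes
    rw [hL']
    unfold GapChain
    have h1 : GapChain X Y (A ++ [wp]) := by
      unfold GapChain at *
      rw [show A ++ (wp :: (M ++ [wq]) ++ A') = (A ++ [wp]) ++ (M ++ [wq] ++ A') by simp] at hgap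
      exact hgap.left_of_append
    have h2 : GapChain X Y (wq :: A') := by
      unfold GapChain at *
      rw [show A ++ (wp :: (M ++ [wq]) ++ A') = (A ++ wp :: M) ++ (wq :: A') by simp] at hgap
      exact hgap.right_of_append
    rw [List.isChain_split, List.isChain_cons_cons, List.isChain_cons_cons]
    refine ⟨h1.shift (c := 0) (fun a ha => ?_) (fun a ha => ?_), ?_, ?_,
      h2.shift (c := 2) (fun a ha => ?_) (fun a ha => ?_)⟩
    · have ha' : a ∈ A ∨ a = wp := by simpa using ha
      rw [hX'ne a (hneA a ha'), sh0 a ha']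
    · exact hY'ne a (hneA a (by simpa using ha))
    · rw [hX'x, hY'x, hX'ne wp (hneA wp (Or.inr rfl)), sh0 wp (Or.inr rfl),
        hY'ne wp (hneA wp (Or.inr rfl))]
      unfold adist; omega
    · rw [hX'x, hY'x, hX'ne wq (hneA' wq (Or.inl rfl)), sh2 wq (Or.inl rfl),
        hY'ne wq (hneA' wq (Or.inl rfl))]
      unfold adist; omega
    · have ha' : a = wq ∨ a ∈ A' := by simpa using ha
      rw [hX'ne a (hneA' a ha'), sh2 a ha']
    · exact hY'ne a (hneA' a (by simpa using ha))
  · -- each contour vertex is in its own set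
    intro a ha
    rw [hL', hmemL] at ha
    rcases ha with (ha | rfl) | ha
    · rw [hMleft a ha]
      exact Or.inr (hself a (by simp only [List.mem_append, List.mem_cons]; tauto))
    · rw [hM'x]; exact Or.inl rfl
    · rw [hMright a ha]
      exact hself a (by simp only [List.mem_append, List.mem_cons]; tauto)
  · -- the sets are nested
    -- Nestedness is inherited by the contour without the covered vertices `M`.
    have hp0 : ((A ++ [wp]) ++ (wq :: A')).Pairwise fun a c => c ∈ s.M a ∧ a ∉ s.M c := by
      refine List.Pairwise.sublist ?_ hpair
      rw [List.append_assoc, List.append_sublist_append_left, List.cons_append, List.cons_append,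
        List.nil_append, List.cons_sublist_cons]
      simp
    rw [List.pairwise_append] at hp0
    rw [hL', show A ++ wp :: x :: wq :: A' = (A ++ [wp]) ++ (x :: wq :: A') by simp,
      List.pairwise_append, List.pairwise_cons]
    have eA : ∀ a, a ∈ A ++ [wp] → s'.M a = insert x (s.M a) := fun a ha =>
      hMleft a (by simpa using ha)
    have eA' : ∀ a, a ∈ wq :: A' → s'.M a = s.M a := fun a ha => hMright a (by simpa using ha)
    have nA : ∀ a, a ∈ A ++ [wp] → a ≠ x := fun a ha => hneA a (by simpa using ha)
    have nA' : ∀ a, a ∈ wq :: A' → a ≠ x := fun a ha => hneA' a (by simpa using ha)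
    refine ⟨?_, ⟨?_, ?_⟩, ?_⟩
    · refine hp0.1.imp_of_mem fun {a c} ha hc hac => ?_
      rw [eA a ha, eA c hc]
      exact ⟨Or.inr hac.1, fun h1 => h1.elim (nA a ha) hac.2⟩
    · intro a ha
      rw [hM'x, eA' a ha]
      refine ⟨Or.inr ?_, hxM a ?_⟩
      · rcases List.mem_cons.1 ha with rfl | ha
        · exact shN a (by simp)
        · exact (shA' a ha).1
      · simp only [List.mem_append, List.mem_cons] at ha ⊢; tauto
    · refine hp0.2.1.imp_of_mem fun {a c} ha hc hac => ?_
      rwa [eA' a ha, eA' c hc]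
    · intro a ha c hc
      rw [eA a ha]
      rcases List.mem_cons.1 hc with rfl | hc
      · rw [hM'x]
        refine ⟨Or.inl rfl, fun h1 => h1.elim (nA a ha) (shA a (by simpa using ha)).1⟩
      · rw [eA' c hc]
        exact ⟨Or.inr (hp0.2.2 a ha c hc).1, (hp0.2.2 a ha c hc).2⟩
  · -- the sets consist of drawn vertices
    intro a ha y hy
    rw [hL', hmemL] at ha
    rcases ha with (ha | rfl) | ha
    · rw [hMleft a ha] at hy
      rcases hy with rfl | hy
      · omega
      · have := hsub a (by simp only [List.mem_append, List.mem_cons]; tauto) y hy; omega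
    · rw [hM'x] at hy
      rcases hy with rfl | hy
      · omega
      · have := hsub wp1 (by
          rw [hN]; simp) y hy; omega
    · rw [hMright a ha] at hy
      have := hsub a (by simp only [List.mem_append, List.mem_cons]; tauto) y hy; omega
  · -- covered vertices
    intro y hy hyL
    rw [hL', hmemL, not_or, not_or] at hyL
    have hyx' := hyL.1.2
    have hy' : (π y : ℕ) < π x := by
      have : (π y : ℕ) ≠ π x := fun hc => hyx' (π.injective (Fin.ext hc))
      omega
    -- Either `x` covers `y` now, or some `x₀` covered it before.
    by_cases hyM : y ∈ M
    · obtain ⟨l₁, l₂, rfl⟩ := List.append_of_mem hyM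
      refine ⟨x, wp :: l₁, l₂ ++ [wq], by omega, hx, by rw [hB]; simp, by simp, by simp, ?_, ?_⟩
      -- `x` is on the line of slope `-1` through the shifted `wq`, so its coordinates sum to the
      -- old `X wq + Y wq` plus `2`, while `y` has moved by `1`.
      · have hsuf : GapChain X Y (y :: (l₂ ++ [wq])) := by
          unfold GapChain at *
          rw [show wp :: (l₁ ++ y :: l₂ ++ [wq]) = (wp :: l₁) ++ (y :: (l₂ ++ [wq])) by simp]
            at hgapB
          exact hgapB.right_of_append
        have h1 := hsuf.last
        have h2 : heightSum Y' (y :: (l₂ ++ [wq])) = heightSum Y (y :: (l₂ ++ [wq])) := by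
          refine heightSum_congr fun a ha => hY'ne a (hne a (hadj a ?_).2)
          simp only [List.mem_append, List.mem_cons] at ha ⊢; tauto
        rw [h2, hX'x, hY'x, hX'ne y hyx', sh1 y hyM]
        omega
      · intro a ha
        rw [hL', hmemL] at ha
        rcases ha with (ha | rfl) | ha
        · rw [hMleft a ha]
          exact iff_of_true (Or.inr (shAM a ha y hyM)) (Or.inl rfl)
        · rw [hM'x]
          exact iff_of_true (Or.inr (shN y (List.mem_append_left _ hyM))) (Or.inl rfl)
        · rw [hMright a ha]
          exact iff_of_false (shM y hyM a ha)
            (hxM a (by simp only [List.mem_append, List.mem_cons]; tauto))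
    · obtain ⟨x₀, l₁, l₂, hx₀, hx₀2, hl, hl₁, hl₂, hXY, hMiff⟩ := hcov y hy' (by
        simp only [List.mem_append, List.mem_cons] at hyL ⊢; simp; tauto)
      have hx₀ne := hne x₀ hx₀
      refine ⟨x₀, l₁, l₂, by omega, hx₀2, hl, hl₁, hl₂, ?_, ?_⟩
      · have h2 : heightSum Y' (y :: l₂) = heightSum Y (y :: l₂) := by
          refine heightSum_congr fun a ha => hY'ne a (hne a ?_)
          have h3 : a ∈ G.preds b π x₀ := by rw [hl]; exact List.mem_append_right _ ha
          have h4 := ((h.mem_preds hx₀2).1 h3).2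
          rw [Fin.lt_def] at h4
          omega
        -- Each of the two shifted sets contains both of `y` and `x₀` or neither.
        have h3 : sh y = sh x₀ := by
          simp only [hsh, hMiff wp1 (by rw [hN]; simp), hMiff wq (by simp)]
        rw [h2, hX'ne y hyx', hX'ne x₀ hx₀ne, hY'ne x₀ hx₀ne, h3]
        omega
      · intro a ha
        rw [hL', hmemL] at ha
        have key : ∀ c, c ∈ A ++ (wp :: (M ++ [wq]) ++ A') →
            (y ∈ insert x (s.M c) ↔ x₀ ∈ insert x (s.M c)) := by
          intro c hc
          simp only [Set.mem_insert_iff, hyx', hx₀ne, false_or]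
          exact hMiff c hc
        rcases ha with (ha | rfl) | ha
        · rw [hMleft a ha]
          exact key a (by simp only [List.mem_append, List.mem_cons]; tauto)
        · rw [hM'x]
          exact key wp1 (by rw [hN]; simp)
        · rw [hMright a ha]
          exact hMiff a (by simp only [List.mem_append, List.mem_cons]; tauto)
  · -- heights
    intro x₀ hx₀ hx₀2
    have h1 : ∀ a ∈ G.preds b π x₀, Y' a = Y a := by
      intro a ha
      have h4 := ((h.mem_preds hx₀2).1 ha).2
      rw [Fin.lt_def] at h4
      exact hY'ne a (hne a (by omega))
    rw [headHeight_congr h1, heightSum_congr h1]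
    by_cases hxx : x₀ = x
    · subst hxx
      rw [hY'x, hB, hyx2]; rfl
    · rw [hY'ne x₀ hxx]
      have : (π x₀ : ℕ) ≠ π x := fun hc => hxx (π.injective (Fin.ext hc))
      exact hD.height x₀ (by omega) hx₀2
  · have h1 : b.snd ≠ x := hne _ (by rw [h.ord.first]; omega)
    have h2 : (π wp1 : ℕ) < π x := (hadj wp1 (by simp [hwp1])).2
    -- `u` is the first vertex of the contour, hence at or before `wp`, where nothing is shifted.
    obtain ⟨C, hC⟩ := h.exists_contour hx (π x).2.le
    obtain ⟨C', rfl⟩ := hC.exists_eq_cons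
    have h3 : A ++ (wp :: (M ++ [wq]) ++ A') = b.snd :: C'.map fun d => d.snd := by
      rw [← hL, hC.outerPath_eq]; rfl
    have h4 : b.snd ∈ A ∨ b.snd = wp := by
      cases A with
      | nil => exact Or.inr (List.cons.inj h3).1.symm
      | cons a A => exact Or.inl (by rw [← (List.cons.inj h3).1]; simp)
    rw [hX'ne _ h1, hY'ne _ h1, sh0 _ h4]
    exact hD.first
  · have h1 : b.fst ≠ x := hne _ (by rw [h.ord.second]; omega)
    rw [hY'ne _ h1]; exact hD.second
  · intro a ha
    rw [hL', hmemL] at ha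
    have key : ∀ c, c ≠ x → c ∈ A ++ (wp :: (M ++ [wq]) ++ A') → Y' c ≤ X' c := by
      intro c hc hcL
      rw [hY'ne c hc, hX'ne c hc]
      exact (hle c hcL).trans (Nat.le_add_right _ _)
    rcases ha with (ha | rfl) | ha
    · exact key a (hneA a ha) (by simp only [List.mem_append, List.mem_cons]; tauto)
    · rw [hX'x, hY'x]; omega
    · exact key a (hneA' a ha) (by simp only [List.mem_append, List.mem_cons]; tauto)
  · intro y hy
    by_cases hyx' : y = x
    · subst hyx'
      -- On the line of slope `-1` through the shifted `wq`, and above it, `x` has abscissa at most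
      -- `X wq + 1`; its height does not exceed its abscissa.
      have h1 := (hD.bound wq (hadj wq (by simp)).2).1
      rw [hX'x, hY'x]
      omega
    · have hy' : (π y : ℕ) < π x := by
        have : (π y : ℕ) ≠ π x := fun hc => hyx' (π.injective (Fin.ext hc))
        omega
      rw [hX'ne y hyx', hY'ne y hyx']
      have h1 := hD.bound y hy'
      have h2 : sh y ≤ 2 := by
        rw [hsh]; simp only; split_ifs <;> omega
      omega

theorem outerPath_three (h : G.Canon b π) {t : V} (ht : (π t : ℕ) = 2) :
    G.preds b π t = [b.snd, b.fst] ∧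
      G.outerPath b (firstVertices π 3) = [b.snd, t, b.fst] := by
  obtain ⟨A, wp, M, wq, A', hB, hL, hL', -⟩ := h.outerPath_step (x := t) (by omega)
  rw [ht] at hL hL'
  rw [h.contour_two.outerPath_eq] at hL
  have h1 := congrArg List.length hL
  simp at h1
  have h2 : A = [] := List.eq_nil_of_length_eq_zero (by omega)
  have h3 : M = [] := List.eq_nil_of_length_eq_zero (by omega)
  have h4 : A' = [] := List.eq_nil_of_length_eq_zero (by omega)
  subst h2 h3 h4
  simp only [List.map_cons, List.map_nil, List.nil_append, List.append_nil, List.cons.injEq,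
    and_true] at hL
  rw [hB, hL']
  simp only [List.nil_append]
  rw [← hL.1, ← hL.2]
  exact ⟨rfl, rfl⟩

theorem drawn_three (h : G.Canon b π) : ∃ X Y, G.Drawn b π 3 (fppInit π) X Y := by
  classical
  have h0 := h.ord.first
  have h1 := h.ord.second
  obtain ⟨t, ht⟩ : ∃ t, (π t : ℕ) = 2 := ⟨π.symm ⟨2, h.card⟩, by simp⟩
  obtain ⟨hp, hL⟩ := h.outerPath_three ht
  have hcases : ∀ y, (π y : ℕ) < 3 → y = b.snd ∨ y = b.fst ∨ y = t := by
    intro y hy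
    rcases (show (π y : ℕ) = 0 ∨ (π y : ℕ) = 1 ∨ (π y : ℕ) = 2 by omega) with h2 | h2 | h2
    · exact Or.inl (π.injective (Fin.ext (by omega)))
    · exact Or.inr (Or.inl (π.injective (Fin.ext (by omega))))
    · exact Or.inr (Or.inr (π.injective (Fin.ext (by omega))))
  refine ⟨fun y => if (π y : ℕ) = 1 then 2 else if (π y : ℕ) = 2 then 1 else 0,
    fun y => if (π y : ℕ) = 2 then 1 else 0, ?_, ?_, ?_, ?_, ?_, ?_, ?_, ?_, ?_, ?_, ?_⟩
  · intro y hy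
    rcases hcases y hy with rfl | rfl | rfl <;> simp [fppInit, h0, h1, ht]
  · rw [hL]; simp [GapChain, h0, h1, ht, adist]
  · rw [hL]; simp [fppInit, h0, h1, ht]
  · rw [hL]; simp [fppInit, h0, h1, ht]
  · rw [hL]
    simp only [List.mem_cons, List.not_mem_nil, or_false]
    rintro a (rfl | rfl | rfl) y hy <;> simp [fppInit, h0, h1, ht] at hy <;> omega
  · intro y hy hyL
    rw [hL] at hyL
    have := hcases y hy
    simp at hyL; tauto
  · intro x hx hx2
    have hxt : x = t := π.injective (Fin.ext (by omega))
    subst hxt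
    rw [hp]; simp [headHeight, heightSum, adist, h0, h1, ht]
  · simp [h0]
  · simp [h1]
  · rw [hL]; simp [h0, h1, ht]
  · intro y hy
    split_ifs <;> simp

theorem exists_drawn (h : G.Canon b π) (j : ℕ) (hj : 3 + j ≤ Nat.card V) :
    ∃ X Y, G.Drawn b π (3 + j) (G.fppState b π j) X Y := by
  induction j with
  | zero => exact h.drawn_three
  | succ j ih =>
    obtain ⟨X, Y, hD⟩ := ih (by omega)
    have hlt : 3 + j < Nat.card V := by omega
    have h1 : (π (π.symm ⟨3 + j, hlt⟩) : ℕ) = 3 + j := by simp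
    have h2 := h.drawn_succ (x := π.symm ⟨3 + j, hlt⟩) (s := G.fppState b π j) (X := X) (Y := Y)
      (by omega) (by rw [h1]; exact hD)
    rw [h1] at h2
    rw [fppState, dif_pos hlt]
    exact h2

theorem exists_drawing (h : G.Canon b π) :
    ∃ X Y, G.Drawn b π (Nat.card V) (G.fppState b π (Nat.card V - 3)) X Y := by
  have h1 := h.card
  have h2 := h.exists_drawn (Nat.card V - 3) (by omega)
  rwa [show 3 + (Nat.card V - 3) = Nat.card V by omega] at h2

end Canon

end PlaneGraph

/-! ### Drawing and orientation determine each other -/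

namespace PlaneGraph

variable {V : Type*} {G : PlaneGraph V} {x y : V} {b f : G.graph.Dart}
  {π τ : V ≃ Fin (Nat.card V)} {k : ℕ}

theorem eq_of_isChain_of_right_unique {α : Type*} {r : α → α → Prop}
    (hr : ∀ a c c', r a c → r a c' → c = c') {a : α} {l l' : List α}
    (h : (a :: l).IsChain r) (h' : (a :: l').IsChain r) (hl : l.length = l'.length) : l = l' := by
  induction l generalizing a l' with
  | nil => exact (List.eq_nil_of_length_eq_zero hl.symm).symm
  | cons c l ih =>
    cases l' with
    | nil => simp at hl
    | cons c' l' =>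
      rw [List.isChain_cons_cons] at h h'
      obtain rfl := hr a c c' h.1 h'.1
      rw [ih h.2 h'.2 (by simpa using hl)]

/-- A chain of a right-unique relation is determined by its first element. The first element of `l`
is also the first one of `l'`, as anywhere else it would have an `r`-predecessor there, against
`hd`. -/
theorem eq_of_isChain_of_mem_iff {α : Type*} {r : α → α → Prop}
    (hr : ∀ a c c', r a c → r a c' → c = c') {l l' : List α} (hn : l.Nodup) (hn' : l'.Nodup)
    (h : l.IsChain r) (h' : l'.IsChain r) (hl : ∀ a, a ∈ l ↔ a ∈ l')
    (hd : ∀ a ∈ l, ∀ c ∈ l.head?, ¬ r a c) : l = l' := by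
  have hlen : l.length = l'.length := ((List.perm_ext_iff_of_nodup hn hn').2 hl).length_eq
  cases l with
  | nil => exact (List.eq_nil_of_length_eq_zero hlen.symm).symm
  | cons a l =>
    obtain ⟨l1, l2, h1⟩ := List.append_of_mem ((hl a).1 (by simp))
    rcases List.eq_nil_or_concat l1 with rfl | ⟨l3, c, rfl⟩
    · rw [List.nil_append] at h1
      subst h1
      rw [eq_of_isChain_of_right_unique hr h h' (by simpa using hlen)]
    · exfalso
      rw [List.concat_eq_append, List.append_assoc, List.cons_append, List.nil_append] at h1
      rw [h1, List.isChain_split, List.isChain_cons_cons] at h'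
      exact hd c ((hl c).2 (by rw [h1]; simp)) a (by simp) h'.2.1

theorem append_cons_right_cancel {α : Type*} {l₁ l₂ k₁ k₂ : List α} {a : α}
    (h : l₁ ++ a :: l₂ = k₁ ++ a :: k₂) (hn : (l₁ ++ a :: l₂).Nodup) : l₂ = k₂ := by
  induction l₁ generalizing k₁ with
  | nil =>
    cases k₁ with
    | nil => simpa using h
    | cons c k₁ =>
      simp only [List.nil_append, List.cons_append, List.cons.injEq] at h
      obtain ⟨rfl, rfl⟩ := h
      simp at hn
  | cons c l₁ ih =>
    cases k₁ with
    | nil =>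
      simp only [List.nil_append, List.cons_append, List.cons.injEq] at h
      obtain ⟨rfl, rfl⟩ := h
      simp at hn
    | cons c' k₁ =>
      simp only [List.cons_append, List.cons.injEq] at h
      exact ih h.2 (List.nodup_cons.1 hn).2

namespace Canon

set_option linter.unusedSectionVars false

variable [Finite V]

theorem eq_first_or_second (h : G.Canon b π) (hx : ¬ 2 ≤ (π x : ℕ)) : x = b.snd ∨ x = b.fst :=
  h.mem_two_iff.1 (by rw [mem_firstVertices]; omega)

theorem two_le_iff (h : G.Canon b π) : 2 ≤ (π x : ℕ) ↔ x ≠ b.snd ∧ x ≠ b.fst := by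
  have := h.mem_two_iff (y := x)
  rw [mem_firstVertices] at this
  rw [← not_or, ← this]; omega

/-- `x` is adjacent to `a` and `c`, and `a` follows `c` in the clockwise order around `x`, inside the
outer boundary. -/
def CornerAt (G : PlaneGraph V) (b : G.graph.Dart) (x a c : V) : Prop :=
  ∃ f : G.graph.Dart, f.fst = c ∧ f.snd = x ∧ (G.rot.face f).snd = a ∧ ¬ G.Reach Set.univ b f

theorem fst_face (f : G.graph.Dart) : (G.rot.face f).fst = f.snd := G.rot.fst_cw f.symm

theorem cornerAt_right_unique (a c c' : V) (h : CornerAt G b x a c) (h' : CornerAt G b x a c') :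
    c = c' := by
  obtain ⟨f, rfl, hf, ha, -⟩ := h
  obtain ⟨g, rfl, hg, ha', -⟩ := h'
  have h1 : G.rot.face f = G.rot.face g :=
    dart_ext_iff.2 ⟨by rw [fst_face, fst_face, hf, hg], ha.trans ha'.symm⟩
  rw [G.rot.face.injective h1]

theorem cornerAt_preds (h : G.Canon b π) (hx : 2 ≤ (π x : ℕ)) {l₁ l₂ : List V} {a c : V}
    (hl : G.preds b π x = l₁ ++ a :: c :: l₂) : CornerAt G b x a c := by
  have hc : c ∈ G.preds b π x := by rw [hl]; simp
  have hadj := ((h.mem_preds hx).1 hc).1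
  obtain ⟨h1, h2⟩ := h.face_pred hx (f := ⟨(c, x), hadj.symm⟩) hl rfl rfl
  exact ⟨_, rfl, rfl, h1, h2⟩

theorem isChain_preds (h : G.Canon b π) (hx : 2 ≤ (π x : ℕ)) :
    (G.preds b π x).IsChain (CornerAt G b x) := by
  rw [List.isChain_iff_forall_rel_of_append_cons_cons]
  intro a c l₁ l₂ hl
  exact h.cornerAt_preds hx hl

/-- A vertex that has left the contour is covered by a later neighbor. -/
theorem exists_out (h : G.Canon b π) (hy : y ∉ G.outerPath b Set.univ) :
    ∃ t, G.graph.Adj y t ∧ π y < π t := by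
  obtain ⟨X, Y, hD⟩ := h.exists_drawing
  obtain ⟨x, l₁, l₂, -, hx2, hl, -⟩ := hD.cov y (π y).2 (by rwa [firstVertices_card])
  have := (h.mem_preds hx2).1 (show y ∈ G.preds b π x by rw [hl]; simp)
  exact ⟨x, this.1.symm, this.2⟩

theorem exists_contour_univ (h : G.Canon b π) : ∃ C, G.Contour b Set.univ C := by
  have := h.exists_contour (k := Nat.card V) (by have := h.card; omega) le_rfl
  rwa [firstVertices_card] at this

/-- If the clockwise successor of the first predecessor `wp` of `x` is a predecessor of `x`, then
all neighbors of `x` precede it. -/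
theorem face_first (h : G.Canon b π) (hx : 2 ≤ (π x : ℕ)) {wp : V} {N : List V}
    (hB : G.preds b π x = wp :: N) (hf : f.fst = wp) (hfx : f.snd = x)
    (hm : (G.rot.face f).snd ∈ G.preds b π x) (d : G.graph.Dart) (hd : d.fst = x) :
    d.snd ∈ G.preds b π x := by
  -- One clockwise turn leads from predecessors to predecessors: by `face_pred` from all but `wp`,
  -- and by `hm` from `wp`. Since the rotation at `x` is one cycle, there are no other neighbors.
  have hcl : ∀ e : G.graph.Dart, e.fst = x → e.snd ∈ G.preds b π x →
      (G.rot.cw e).snd ∈ G.preds b π x := by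
    intro e he hes
    by_cases hwp : e.snd = wp
    · have : e = f.symm := dart_ext_iff.2 ⟨he.trans hfx.symm, hwp.trans hf.symm⟩
      rw [this]; exact hm
    · have hes' := hes
      rw [hB] at hes'
      obtain ⟨l1, l2, hl⟩ := List.append_of_mem ((List.mem_cons.1 hes').resolve_left hwp)
      rw [hl] at hB
      rcases List.eq_nil_or_concat l1 with rfl | ⟨l3, a, rfl⟩
      · have h1 := (h.face_pred hx (f := e.symm) (l₁ := []) hB rfl he).1
        have h2 : (G.rot.cw e).snd = wp := h1
        rw [h2, hB]; simp
      · have h1 := (h.face_pred hx (f := e.symm) (l₁ := wp :: l3) (a := a) (l₂ := l2)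
          (by rw [hB]; simp) rfl he).1
        have h2 : (G.rot.cw e).snd = a := h1
        rw [h2, hB]; simp
  obtain ⟨j, hj⟩ := exists_cw_pow (d := f.symm) (d' := d) (hfx.trans hd.symm)
  have hall : ∀ i, ((G.rot.cw ^ i) f.symm).snd ∈ G.preds b π x := by
    intro i
    induction i with
    | zero => simp only [pow_zero, Equiv.Perm.one_apply]; rw [hB]; exact List.mem_cons.2 (Or.inl hf)
    | succ i ih =>
      rw [pow_succ', Equiv.Perm.mul_apply]
      exact hcl _ ((fst_cw_pow _ _).trans hfx) ih
  exact hj ▸ hall (j + 1)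

/-- Without a later neighbor `x` is on the final contour, so one of its corners is outer. By
`face_pred` the corners at all predecessors but the first are inner. -/
theorem reach_first_of_no_out (h : G.Canon b π) (hx : 2 ≤ (π x : ℕ)) {wp : V} {N : List V}
    (hB : G.preds b π x = wp :: N) (hf : f.fst = wp) (hfx : f.snd = x)
    (hall : ∀ d : G.graph.Dart, d.fst = x → d.snd ∈ G.preds b π x) : G.Reach Set.univ b f := by
  obtain ⟨C, hC⟩ := h.exists_contour_univ
  have hxL : x ∈ G.outerPath b Set.univ := by
    by_contra hxL
    obtain ⟨t, ht, hlt⟩ := h.exists_out hxL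
    exact absurd ((h.mem_preds hx).1 (hall ⟨(x, t), ht⟩ rfl)).2 (lt_asymm hlt)
  rw [hC.outerPath_eq] at hxL
  obtain ⟨d, hd, hdx⟩ := List.mem_map.1 hxL
  have hR := hC.mem_iff.1 hd
  have hdm := hall d.symm hdx
  change d.fst ∈ _ at hdm
  by_cases hwp : d.fst = wp
  · rwa [show f = d from dart_ext_iff.2 ⟨hf.trans hwp.symm, hfx.trans hdx.symm⟩]
  · exfalso
    rw [hB] at hdm
    obtain ⟨l1, l2, hl⟩ := List.append_of_mem ((List.mem_cons.1 hdm).resolve_left hwp)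
    rw [hl] at hB
    rcases List.eq_nil_or_concat l1 with rfl | ⟨l3, a, rfl⟩
    · exact (h.face_pred hx (f := d) (l₁ := []) hB rfl hdx).2 hR
    · exact (h.face_pred hx (f := d) (l₁ := wp :: l3) (a := a) (l₂ := l2)
          (by rw [hB]; simp) rfl hdx).2 hR

/-- In-neighbors and rotation do not depend on the ordering, so only the place where the cyclic
order is cut is in question. An inner corner between `wp` and a predecessor clockwise after it would
force all neighbors of `x` to precede it (`face_first`), and then this very corner would be outer.
-/
theorem preds_eq_of_orientation_eq (h : G.Canon b π) (h' : G.Canon b τ)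
    (hD : G.orientation π = G.orientation τ) (hx : 2 ≤ (π x : ℕ)) :
    G.preds b π x = G.preds b τ x := by
  have hx' : 2 ≤ (τ x : ℕ) := h'.two_le_iff.2 (h.two_le_iff.1 hx)
  apply eq_of_isChain_of_mem_iff cornerAt_right_unique (h.preds_nodup hx) (h'.preds_nodup hx')
    (h.isChain_preds hx) (h'.isChain_preds hx')
  · intro a
    rw [h.mem_preds hx, h'.mem_preds hx']
    have h1 : (G.orientation π).Adj a x ↔ (G.orientation τ).Adj a x := by rw [hD]
    simpa [orientation, G.graph.adj_comm] using h1
  · rintro a ha c hc ⟨f, hf, hfx, hfa, hR⟩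
    cases hB : G.preds b π x with
    | nil => rw [hB] at hc; simp at hc
    | cons wp N =>
      rw [hB] at hc
      simp only [List.head?_cons, Option.mem_some_iff] at hc
      subst hc
      exact hR (h.reach_first_of_no_out hx hB hf hfx
        (h.face_first hx hB hf hfx (hfa ▸ ha)))

/-- Only the inserted vertex ever enters the contour. -/
theorem notMem_outerPath_mono (h : G.Canon b π) (hk : 2 ≤ k) {l : ℕ} (hkl : k ≤ l)
    (hl : l ≤ Nat.card V) (hy : (π y : ℕ) < k) (hyk : y ∉ G.outerPath b (firstVertices π k)) :
    y ∉ G.outerPath b (firstVertices π l) := by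
  induction l, hkl using Nat.le_induction with
  | base => exact hyk
  | succ l hkl ih =>
    obtain ⟨x, hx⟩ : ∃ x, (π x : ℕ) = l := ⟨π.symm ⟨l, hl⟩, by simp⟩
    subst hx
    obtain ⟨A, wp, M, wq, A', hB, hL, hL', -⟩ := h.outerPath_step (x := x) (by omega)
    have h1 := ih (by omega)
    have h2 : y ≠ x := by rintro rfl; omega
    rw [hL] at h1
    rw [hL']
    simp only [List.mem_append, List.mem_cons] at h1 ⊢
    tauto

theorem notMem_outerPath_of_covers (h : G.Canon b π) (hx : 2 ≤ (π x : ℕ))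
    (hc : G.Covers b π x y) : y ∉ G.outerPath b (firstVertices π (π x + 1)) := by
  obtain ⟨l₁, l₂, hl, hl₁, hl₂⟩ := hc
  obtain ⟨A, wp, M, wq, A', hB, hL, hL', -⟩ := h.outerPath_step hx
  have hyx : y ≠ x := by
    have := ((h.mem_preds hx).1 (show y ∈ G.preds b π x by rw [hl]; simp)).2
    rintro rfl; exact lt_irrefl _ this
  have hyM : y ∈ M := by
    rw [hB] at hl
    cases l₁ with
    | nil => simp at hl₁
    | cons a l₁ =>
      have h1 := (List.cons.inj hl).2
      rcases List.eq_nil_or_concat l₂ with rfl | ⟨l₃, c, rfl⟩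
      · simp at hl₂
      · have h2 : M = l₁ ++ y :: l₃ := by
          apply List.append_inj_left' (t₁ := [wq]) (t₂ := [c]) _ rfl
          rw [h1]; simp
        rw [h2]; simp
  have hnd := h.outerPath_nodup hx (π x).2.le
  rw [hL] at hnd
  rw [hL']
  simp only [List.nodup_append, List.mem_append, List.nodup_cons, List.cons_append,
    List.mem_cons] at hnd ⊢
  grind

/-- Predecessors are taken from the contour, and a covered vertex has left it for good. So the
covering vertex is the last out-neighbor, hence unique. -/
theorem le_of_covers (h : G.Canon b π) (hx : 2 ≤ (π x : ℕ)) (hc : G.Covers b π x y) {t : V}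
    (hyt : G.graph.Adj y t) (hlt : π y < π t) : π t ≤ π x := by
  by_contra! hcon
  have h1 := h.notMem_outerPath_of_covers hx hc
  rw [Fin.lt_def] at hcon
  obtain ⟨l₁, l₂, hl, -⟩ := hc
  have h2 := ((h.mem_preds hx).1 (show y ∈ G.preds b π x by rw [hl]; simp)).2
  rw [Fin.lt_def] at h2
  have h3 := h.notMem_outerPath_mono (k := π x + 1) (l := π t) (by omega) hcon (π t).2.le
    (by omega) h1
  have h4 : y ∈ G.preds b π t := (h.mem_preds (by omega)).2 ⟨hyt.symm, hlt⟩
  unfold preds at h4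
  exact h3 (List.mem_filter.1 h4).1

theorem gapChain_eq {X X' Y : V → ℕ} {a : V} {l : List V} (hX : GapChain X Y (a :: l))
    (hX' : GapChain X' Y (a :: l)) (ha : X a = X' a) : ∀ c ∈ a :: l, X c = X' c := by
  induction l generalizing a with
  | nil => intro c hc; simp at hc; rw [hc, ha]
  | cons c l ih =>
    unfold GapChain at *
    rw [List.isChain_cons_cons] at hX hX'
    intro e he
    rcases List.mem_cons.1 he with rfl | he
    · exact ha
    · exact ih hX.2 hX'.2 (by rw [hX.1, hX'.1, ha]) e he

theorem outerPath_eq_cons (h : G.Canon b π) : ∃ l, G.outerPath b Set.univ = b.snd :: l := by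
  obtain ⟨C, hC⟩ := h.exists_contour_univ
  obtain ⟨C', rfl⟩ := hC.exists_eq_cons
  exact ⟨_, hC.outerPath_eq⟩

theorem lt_height {X Y : V → ℕ} {s : FPPState V}
    (hD : G.Drawn b π (Nat.card V) s X Y) (hx : 2 ≤ (π x : ℕ)) (hy : y ∈ G.preds b π x) :
    Y y < Y x := by
  have h1 := hD.height x (π x).2 hx
  have h2 := two_mul_le_heightSum (Y := Y) hy
  omega

/-- The drawing depends only on the orientation. -/
theorem fppDrawing_eq (h : G.Canon b π) (h' : G.Canon b τ)
    (hO : G.orientation π = G.orientation τ) : G.fppDrawing b π = G.fppDrawing b τ := by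
  obtain ⟨X, Y, hD⟩ := h.exists_drawing
  obtain ⟨X', Y', hD'⟩ := h'.exists_drawing
  -- The height formula refers to predecessors only, hence induction along `π`.
  have hY : ∀ m, ∀ x, (π x : ℕ) = m → Y x = Y' x := by
    intro m
    induction m using Nat.strong_induction_on with
    | _ m ih =>
      rintro x rfl
      by_cases hx : 2 ≤ (π x : ℕ)
      · have h1 := hD.height x (π x).2 hx
        have h2 := hD'.height x (τ x).2 (h'.two_le_iff.2 (h.two_le_iff.1 hx))
        rw [← h.preds_eq_of_orientation_eq h' hO hx] at h2
        have h3 : ∀ a ∈ G.preds b π x, Y a = Y' a := fun a ha =>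
          ih _ ((h.mem_preds hx).1 ha).2 a rfl
        rw [headHeight_congr h3, heightSum_congr h3] at h1
        omega
      · rcases h.eq_first_or_second hx with rfl | rfl
        · rw [hD.first.2, hD'.first.2]
        · rw [hD.second, hD'.second]
  have hYY : Y' = Y := by funext x; exact (hY _ x rfl).symm
  subst hYY
  -- Slopes `±1` determine the final contour from its heights and the abscissa `0` of `u`.
  have hL : ∀ c ∈ G.outerPath b Set.univ, X c = X' c := by
    obtain ⟨l, hl⟩ := h.outerPath_eq_cons
    have h1 := hD.gap
    have h2 := hD'.gap
    rw [firstVertices_card, hl] at h1 h2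
    rw [hl]
    exact gapChain_eq h1 h2 (by rw [hD.first.1, hD'.first.1])
  -- A covered vertex is placed relative to its covering vertex, which comes later: induction from
  -- the end of `π`.
  have hX : ∀ m, ∀ y, Nat.card V - (π y : ℕ) = m → X y = X' y := by
    intro m
    induction m using Nat.strong_induction_on with
    | _ m ih =>
      rintro y rfl
      by_cases hy : y ∈ G.outerPath b Set.univ
      · exact hL y hy
      · obtain ⟨x, l₁, l₂, -, hx2, hl, hl₁, hl₂, hXY, -⟩ :=
          hD.cov y (π y).2 (by rwa [firstVertices_card])
        obtain ⟨x', k₁, k₂, -, hx2', hk, hk₁, hk₂, hXY', -⟩ :=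
          hD'.cov y (τ y).2 (by rwa [firstVertices_card])
        have hx2'' : 2 ≤ (π x' : ℕ) := h.two_le_iff.2 (h'.two_le_iff.1 hx2')
        rw [← h.preds_eq_of_orientation_eq h' hO hx2''] at hk
        have m1 := (h.mem_preds hx2).1 (show y ∈ G.preds b π x by rw [hl]; simp)
        have m2 := (h.mem_preds hx2'').1 (show y ∈ G.preds b π x' by rw [hk]; simp)
        -- As the predecessor lists agree, `x'` covers `y` with respect to `π` too, and both are the
        -- last out-neighbor of `y`.
        have hxx : x = x' := π.injective (le_antisymm
          (h.le_of_covers hx2'' ⟨k₁, k₂, hk, hk₁, hk₂⟩ m1.1.symm m1.2)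
          (h.le_of_covers hx2 ⟨l₁, l₂, hl, hl₁, hl₂⟩ m2.1.symm m2.2))
        subst hxx
        have hll : l₂ = k₂ := append_cons_right_cancel (hl.symm.trans hk) (hl ▸ h.preds_nodup hx2)
        subst hll
        have h1 := m1.2
        have h2 := (π x).2
        rw [Fin.lt_def] at h1
        have h3 := ih (Nat.card V - (π x : ℕ)) (by omega) x rfl
        omega
  funext y
  unfold fppDrawing
  rw [hD.pos y (π y).2, hD'.pos y (τ y).2, hX _ y rfl]

/-- The orientation is determined by the drawing. -/
theorem orientation_eq (h : G.Canon b π) (h' : G.Canon b τ)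
    (hdr : G.fppDrawing b π = G.fppDrawing b τ) : G.orientation π = G.orientation τ := by
  -- Edges rise strictly, with the horizontal base edge `u → v` as the only exception.
  have key : ∀ {π : V ≃ Fin (Nat.card V)}, G.Canon b π → ∀ a c, G.graph.Adj a c →
      (π a < π c ↔ (G.fppDrawing b π a).2 < (G.fppDrawing b π c).2 ∨ (a = b.snd ∧ c = b.fst)) := by
    intro π h a c hac
    obtain ⟨X, Y, hD⟩ := h.exists_drawing
    unfold fppDrawing
    rw [hD.pos a (π a).2, hD.pos c (π c).2]
    simp only [Nat.cast_lt]
    have up : ∀ a c, G.graph.Adj a c → π a < π c → Y a < Y c ∨ (a = b.snd ∧ c = b.fst) := by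
      intro a c hac hlt
      by_cases hc : 2 ≤ (π c : ℕ)
      · exact Or.inl (lt_height hD hc ((h.mem_preds hc).2 ⟨hac.symm, hlt⟩))
      · right
        have h0 := h.ord.first
        have h1 := h.ord.second
        rw [Fin.lt_def] at hlt
        exact ⟨π.injective (Fin.ext (by omega)), π.injective (Fin.ext (by omega))⟩
    constructor
    · exact up a c hac
    · rintro (h1 | ⟨rfl, rfl⟩)
      · by_contra hlt
        have h2 : π c < π a := lt_of_le_of_ne (not_lt.1 hlt) fun h3 => hac.ne (π.injective h3.symm)
        rcases up c a hac.symm h2 with h3 | ⟨rfl, rfl⟩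
        · omega
        · rw [hD.first.2, hD.second] at h1; omega
      · rw [Fin.lt_def, h.ord.first, h.ord.second]; exact Nat.one_pos
  unfold orientation
  congr 1
  funext a c
  apply propext
  refine and_congr_right fun hac => ?_
  rw [key h a c hac, key h' a c hac, hdr]

end Canon

end PlaneGraph

/-! ### A description of the drawing by walks around the vertices -/

/-- The total variation of the first `j` values of a sequence, which is extended by `0` on the
left. -/
def walkSum (g : ℕ → ℕ) : ℕ → ℕ
  | 0 => 0
  | j + 1 => walkSum g j + adist (g j) (match j with | 0 => 0 | i + 1 => g i)

/-- The value before the `j`-th value of a sequence, `0` if there is none. -/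
def walkPrev (g : ℕ → ℕ) : ℕ → ℕ
  | 0 => 0
  | j + 1 => g j

theorem walkSum_succ (g : ℕ → ℕ) (j : ℕ) :
    walkSum g (j + 1) = walkSum g j + adist (g j) (walkPrev g j) := by
  cases j <;> rfl

namespace PlaneGraph

variable {V : Type*} {G : PlaneGraph V} {x y : V} {b : G.graph.Dart}
  {π : V ≃ Fin (Nat.card V)}

open Classical in
/-- The heights of the in-neighbors of the tail of `d`, in clockwise order starting with `d`;
out-neighbors are given height `0`. -/
noncomputable def walkHeights (G : PlaneGraph V) (D : Digraph V) (Y : V → ℕ) (d : G.graph.Dart)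
    (i : ℕ) : ℕ :=
  if D.Adj ((G.rot.cw ^ i) d).snd d.fst then Y ((G.rot.cw ^ i) d).snd else 0

/-- The number of darts at the tail of `d`. -/
noncomputable def period (G : PlaneGraph V) (d : G.graph.Dart) : ℕ :=
  Function.minimalPeriod G.rot.cw d

/-- A description of the drawing `Γ` by the orientation `D`, independent of an ordering: the heights
are determined by the walks around the vertices, which start at the darts `st x`, and the horizontal
positions by the vertices `par w` that cover the vertices `w`. -/
structure WalkSpec (G : PlaneGraph V) (b : G.graph.Dart) (z : V) (D : Digraph V)
    (Γ : V → ℝ × ℝ) (X Y : V → ℕ) (st : V → G.graph.Dart) (par : V → V) (rk : V → ℕ) : Prop where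
  drawing : ∀ x, Γ x = ((X x : ℝ), (Y x : ℝ))
  adj : ∀ {a c}, D.Adj a c → G.graph.Adj a c
  total : ∀ {a c}, G.graph.Adj a c → D.Adj a c ∨ D.Adj c a
  rk_lt : ∀ {a c}, D.Adj a c → rk a < rk c
  source : ∀ x, (∀ y, ¬ D.Adj y x) ↔ x = b.snd
  Y_first : Y b.snd = 0
  Y_second : Y b.fst = 0
  X_first : X b.snd = 0
  X_last : X z = Y z
  X_second : X b.fst = Y z + Y z
  st_unique : ∀ d : G.graph.Dart, D.Adj d.fst d.snd → ¬ D.Adj (G.rot.cw d).fst (G.rot.cw d).snd →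
    G.rot.cw d = st d.fst
  st_exists : ∀ x, x ≠ b.snd → x ≠ z → ∃ d : G.graph.Dart, d.fst = x ∧ D.Adj d.fst d.snd ∧
    ¬ D.Adj (G.rot.cw d).fst (G.rot.cw d).snd
  st_last : st z = G.rot.face (G.rot.face b)
  last : z = (G.rot.face b).snd
  height : ∀ x, x ≠ b.snd → x ≠ b.fst →
    walkSum (G.walkHeights D Y (st x)) (G.period (st x)) +
      walkPrev (G.walkHeights D Y (st x)) (G.period (st x)) + 2 = 2 * Y x
  par_adj : ∀ w, w ≠ b.snd → w ≠ b.fst → w ≠ z → D.Adj w (par w)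
  par_max : ∀ w, w ≠ b.snd → w ≠ b.fst → w ≠ z → ∀ t, D.Adj w t → t ≠ par w →
    ∃ t', D.Adj w t' ∧ D.Adj t t'
  cover : ∀ w, w ≠ b.snd → w ≠ b.fst → w ≠ z → par w ≠ b.snd → ∃ i < G.period (st (par w)),
    ((G.rot.cw ^ i) (st (par w))).snd = w ∧
    X w + 1 + walkSum (G.walkHeights D Y (st (par w))) (i + 1) = X (par w) + Y (par w)
  X_le : ∀ x, X x ≤ 2 * Nat.card V
  Y_le : ∀ x, Y x ≤ 2 * Nat.card V
  walk_le : ∀ d : G.graph.Dart, (d.fst ≠ b.snd → d = st d.fst) → ∀ j ≤ G.period d,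
    walkSum (G.walkHeights D Y d) j + walkPrev (G.walkHeights D Y d) j ≤ 6 * Nat.card V

theorem walkSum_eq_zero {g : ℕ → ℕ} (hg : ∀ i, g i = 0) (j : ℕ) :
    walkSum g j = 0 ∧ walkPrev g j = 0 := by
  induction j with
  | zero => exact ⟨rfl, rfl⟩
  | succ j ih =>
    rw [walkSum_succ]
    exact ⟨by rw [ih.1, ih.2, hg]; rfl, hg j⟩

theorem heightSum_append_le {Y : V → ℕ} (l₁ l₂ : List V) :
    heightSum Y l₂ ≤ heightSum Y (l₁ ++ l₂) := by
  induction l₁ with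
  | nil => exact le_rfl
  | cons a l₁ ih => rw [List.cons_append, heightSum_cons]; omega

namespace Canon

set_option linter.unusedSectionVars false

variable [Finite V] {z : V}

theorem period_pos (d : G.graph.Dart) : 0 < G.period d := by
  have : Finite G.graph.Dart := finite_dart
  exact Function.minimalPeriod_pos_of_mem_periodicPts (G.rot.cw.injective.mem_periodicPts d)

theorem cw_pow_period (d : G.graph.Dart) : (G.rot.cw ^ (G.period d)) d = d := by
  rw [← Equiv.Perm.iterate_eq_pow]
  exact Function.iterate_minimalPeriod

theorem cw_pow_inj {d : G.graph.Dart} {i j : ℕ} (hi : i < G.period d) (hj : j < G.period d)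
    (h : (G.rot.cw ^ i) d = (G.rot.cw ^ j) d) : i = j := by
  rw [← Equiv.Perm.iterate_eq_pow, ← Equiv.Perm.iterate_eq_pow] at h
  exact Function.iterate_injOn_Iio_minimalPeriod (f := G.rot.cw) hi hj h

/-- The walk around `x` that starts with the dart to the last predecessor. -/
theorem walk_suffix (h : G.Canon b π) (hx : 2 ≤ (π x : ℕ)) {d : G.graph.Dart} (hd : d.fst = x)
    (hlast : (G.preds b π x).getLast? = some d.snd) (Y : V → ℕ) (l₁ l₂ : List V)
    (hl : G.preds b π x = l₁ ++ l₂) :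
    walkSum (G.walkHeights (G.orientation π) Y d) l₂.length = heightSum Y l₂ ∧
    walkPrev (G.walkHeights (G.orientation π) Y d) l₂.length = headHeight Y l₂ ∧
    ∀ a l₃, l₂ = a :: l₃ → ((G.rot.cw ^ l₃.length) d).snd = a := by
  -- Clockwise around `x` the predecessors appear from the last to the first, so after each step the
  -- walk has read a suffix of `preds`.
  induction l₂ generalizing l₁ with
  | nil => exact ⟨rfl, rfl, by simp⟩
  | cons a l₂ ih =>
    obtain ⟨i1, i2, i3⟩ := ih (l₁ ++ [a]) (by rw [hl]; simp)
    have h1 : ((G.rot.cw ^ l₂.length) d).snd = a := by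
      cases l₂ with
      | nil => rw [hl] at hlast; simpa using hlast.symm
      | cons c l₃ =>
        have h2 := i3 c l₃ rfl
        rw [List.length_cons, pow_succ', Equiv.Perm.mul_apply]
        exact (h.face_pred hx (f := ((G.rot.cw ^ l₃.length) d).symm) hl h2
          ((fst_cw_pow _ _).trans hd)).1
    have h2 : G.walkHeights (G.orientation π) Y d l₂.length = Y a := by
      unfold walkHeights
      rw [h1, hd, if_pos]
      have := (h.mem_preds hx).1 (show a ∈ G.preds b π x by rw [hl]; simp)
      exact ⟨this.1.symm, this.2⟩
    refine ⟨?_, ?_, ?_⟩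
    · rw [List.length_cons, walkSum_succ, i1, i2, h2, heightSum_cons, Nat.add_comm]
    · exact h2
    · intro a' l₃ he
      obtain ⟨rfl, rfl⟩ := List.cons.inj he
      exact h1

/-- Otherwise the walk would come back to its first dart while it still reads distinct predecessors.
-/
theorem length_le_period (h : G.Canon b π) (hx : 2 ≤ (π x : ℕ)) {d : G.graph.Dart}
    (hd : d.fst = x) (hlast : (G.preds b π x).getLast? = some d.snd) :
    (G.preds b π x).length ≤ G.period d := by
  by_contra! hlt
  have hpos := period_pos d
  set l₂ := (G.preds b π x).drop ((G.preds b π x).length - (G.period d + 1)) with hl₂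
  have hl := (List.take_append_drop ((G.preds b π x).length - (G.period d + 1))
    (G.preds b π x)).symm
  rw [← hl₂] at hl
  have hlen : l₂.length = G.period d + 1 := by rw [hl₂, List.length_drop]; omega
  obtain ⟨-, -, h3⟩ := h.walk_suffix hx hd hlast (fun _ => 0) _ l₂ hl
  have hnd : l₂.Nodup := (h.preds_nodup hx).sublist (List.drop_sublist _ _)
  cases hc : l₂ with
  | nil => simp [hc] at hlen
  | cons a l₃ =>
    rw [hc] at hlen hnd
    have h4 := h3 a l₃ hc
    rw [show l₃.length = G.period d by simpa using hlen, cw_pow_period] at h4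
    rw [hl, hc] at hlast
    rcases List.eq_nil_or_concat l₃ with rfl | ⟨l₄, c, rfl⟩
    · simp at hlen; omega
    · rw [List.concat_eq_append, ← List.cons_append, ← List.append_assoc,
        List.getLast?_append] at hlast
      simp only [List.getLast?_singleton, Option.some_or, Option.some.injEq] at hlast
      rw [List.nodup_cons] at hnd
      exact hnd.1 (by rw [← h4, ← hlast]; simp)

/-- Out-neighbors count as height `0`. The first of them moves the last height from `walkPrev` into
`walkSum`, and the others change nothing, so the sum of the two is constant once all predecessors
are read. -/
theorem walk_total (h : G.Canon b π) (hx : 2 ≤ (π x : ℕ)) {d : G.graph.Dart} (hd : d.fst = x)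
    (hlast : (G.preds b π x).getLast? = some d.snd) (Y : V → ℕ) {j : ℕ}
    (hj : (G.preds b π x).length ≤ j) (hjp : j ≤ G.period d) :
    walkSum (G.walkHeights (G.orientation π) Y d) j +
      walkPrev (G.walkHeights (G.orientation π) Y d) j =
      heightSum Y (G.preds b π x) + headHeight Y (G.preds b π x) := by
  induction j, hj using Nat.le_induction with
  | base =>
    obtain ⟨h1, h2, -⟩ := h.walk_suffix hx hd hlast Y [] (G.preds b π x) rfl
    rw [h1, h2]
  | succ j hj ih =>
    -- A predecessor found at step `j` would have been read before, at another step of the same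
    -- period.
    have h0 : G.walkHeights (G.orientation π) Y d j = 0 := by
      unfold walkHeights
      rw [if_neg]
      rintro ⟨h1, h2⟩
      rw [hd] at h1 h2
      obtain ⟨l₁, l₂, hl⟩ := List.append_of_mem ((h.mem_preds hx).2 ⟨h1.symm, h2⟩)
      obtain ⟨-, -, h3⟩ := h.walk_suffix hx hd hlast Y l₁ _ hl
      have h4 := h3 _ l₂ rfl
      have h5 : l₂.length < (G.preds b π x).length := by rw [hl]; simp; omega
      have h6 : (G.rot.cw ^ l₂.length) d = (G.rot.cw ^ j) d :=
        dart_ext_iff.2 ⟨by rw [fst_cw_pow, fst_cw_pow], h4⟩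
      have := cw_pow_inj (by omega) (by omega) h6
      omega
    have h1 : walkPrev (G.walkHeights (G.orientation π) Y d) (j + 1) = 0 := h0
    rw [walkSum_succ, h1, h0, ← ih (by omega)]
    unfold adist; omega

/-- Together with `walk_total`, this bounds the numbers that occur during a walk, as the word size
demands. -/
theorem walk_le_of_lt (h : G.Canon b π) (hx : 2 ≤ (π x : ℕ)) {d : G.graph.Dart} (hd : d.fst = x)
    (hlast : (G.preds b π x).getLast? = some d.snd) (Y : V → ℕ) {j : ℕ}
    (hj : j ≤ (G.preds b π x).length) (M : ℕ) (hM : ∀ a, Y a ≤ M) :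
    walkSum (G.walkHeights (G.orientation π) Y d) j +
      walkPrev (G.walkHeights (G.orientation π) Y d) j ≤
      heightSum Y (G.preds b π x) + M := by
  set l₂ := (G.preds b π x).drop ((G.preds b π x).length - j) with hl₂
  have hl := (List.take_append_drop ((G.preds b π x).length - j) (G.preds b π x)).symm
  rw [← hl₂] at hl
  have hlen : l₂.length = j := by rw [hl₂, List.length_drop]; omega
  obtain ⟨h1, h2, -⟩ := h.walk_suffix hx hd hlast Y _ l₂ hl
  rw [hlen] at h1 h2
  rw [h1, h2]
  have h3 := heightSum_append_le (Y := Y)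
    (List.take ((G.preds b π x).length - j) (G.preds b π x)) l₂
  rw [← hl] at h3
  have h4 : headHeight Y l₂ ≤ M := by
    cases l₂ with
    | nil => exact Nat.zero_le _
    | cons a l => exact hM a
  omega

/-- The outer face is the triangle through the base dart `b` and `z`, and `z` is the last vertex. -/
structure Outer (G : PlaneGraph V) (b : G.graph.Dart) (π : V ≃ Fin (Nat.card V)) (z : V) : Prop
    where
  canon : G.Canon b π
  last : (π z : ℕ) + 1 = Nat.card V
  head_first : (G.rot.face b).snd = z
  head_second : (G.rot.face (G.rot.face b)).snd = b.fst
  face_closed : G.rot.face (G.rot.face (G.rot.face b)) = b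

namespace Outer

theorem ne_first (ho : Outer G b π z) : z ≠ b.snd := by
  have h1 := ho.canon.ord.first
  have h2 := ho.canon.card
  have h3 := ho.last
  rintro rfl; omega

theorem ne_second (ho : Outer G b π z) : z ≠ b.fst := by
  have h1 := ho.canon.ord.second
  have h2 := ho.canon.card
  have h3 := ho.last
  rintro rfl; omega

theorem le_last (ho : Outer G b π z) (x : V) : π x ≤ π z := by
  have h3 := ho.last
  have h4 := (π x).2
  rw [Fin.le_def]; omega

theorem outerPath_univ (ho : Outer G b π z) :
    G.outerPath b Set.univ = [b.snd, z, b.fst] := by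
  rw [outerPath_eq_map (C := [b, G.rot.face b, G.rot.face (G.rot.face b)]) rfl]
  · simp [ho.head_first, ho.head_second]
  · rw [faceIn_univ]
    simp [ho.face_closed]
  · apply List.Nodup.of_map fun d : G.graph.Dart => d.snd
    simp [ho.head_first, ho.head_second, ho.ne_first.symm, ho.ne_second, b.adj.ne']

theorem reach_cases (ho : Outer G b π z) {d : G.graph.Dart} (hd : G.Reach Set.univ b d) :
    d = b ∨ d = G.rot.face b ∨ d = G.rot.face (G.rot.face b) := by
  obtain ⟨n, rfl⟩ := hd
  rw [faceIn_univ]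
  induction n with
  | zero => exact Or.inl rfl
  | succ n ih =>
    rw [Function.iterate_succ_apply']
    rcases ih with h | h | h <;> rw [h]
    · exact Or.inr (Or.inl rfl)
    · exact Or.inr (Or.inr rfl)
    · exact Or.inl ho.face_closed

theorem exists_out (ho : Outer G b π z) (hx : x ≠ z) : ∃ t, G.graph.Adj x t ∧ π x < π t := by
  have h0 : G.graph.Adj b.snd z := by
    have := (G.rot.face b).adj
    rwa [ho.head_first, fst_face] at this
  have h1 : G.graph.Adj z b.fst := by
    have := (G.rot.face (G.rot.face b)).adj
    rwa [ho.head_second, fst_face, ho.head_first] at this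
  have hlt : π x < π z := lt_of_le_of_ne (ho.le_last x) fun h => hx (π.injective h)
  by_cases hu : x = b.snd
  · subst hu; exact ⟨z, h0, hlt⟩
  · by_cases hv : x = b.fst
    · subst hv; exact ⟨z, h1.symm, hlt⟩
    · exact ho.canon.exists_out (by rw [ho.outerPath_univ]; simp [*])

/-- The dart with which the walk around `x` starts. -/
theorem exists_start (ho : Outer G b π z) (hx : x ≠ b.snd) :
    ∃ d₀ : G.graph.Dart, d₀.fst = x ∧
      (2 ≤ (π x : ℕ) → (G.preds b π x).getLast? = some d₀.snd) ∧
      (∀ d : G.graph.Dart, d.fst = x → π d.fst < π d.snd →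
        ¬ π (G.rot.cw d).fst < π (G.rot.cw d).snd → G.rot.cw d = d₀) ∧
      (x ≠ z → ∃ d : G.graph.Dart, d.fst = x ∧ π d.fst < π d.snd ∧
        ¬ π (G.rot.cw d).fst < π (G.rot.cw d).snd) ∧
      (x = z → d₀ = G.rot.face (G.rot.face b)) := by
  have h := ho.canon
  have hin : ∀ d : G.graph.Dart, ¬ π d.fst < π d.snd → π d.snd < π d.fst := fun d hd =>
    lt_of_le_of_ne (not_lt.1 hd) fun h => d.adj.ne (π.injective h.symm)
  by_cases hx2 : 2 ≤ (π x : ℕ)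
  · obtain ⟨A, wp, M, wq, A', hB, -⟩ := h.outerPath_step hx2
    have hnd := h.preds_nodup hx2
    have hwq := (h.mem_preds hx2).1 (show wq ∈ G.preds b π x by rw [hB]; simp)
    have hwp := (h.mem_preds hx2).1 (show wp ∈ G.preds b π x by rw [hB]; simp)
    -- a predecessor which is not the last one follows another predecessor
    have hnext : ∀ d : G.graph.Dart, d.fst = x → (G.rot.cw d).snd ∈ G.preds b π x →
        (G.rot.cw d).snd ≠ wq → d.snd ∈ G.preds b π x ∧ d.snd ≠ wp := by
      intro d hd hm hne
      have hm' := hm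
      rw [hB, ← List.cons_append] at hm'
      rcases eq_last_or_exists_next hm' with h1 | ⟨l₁, c, l₂, hl⟩
      · exact absurd h1 hne
      · have hl' : G.preds b π x = l₁ ++ (G.rot.cw d).snd :: c :: l₂ := by rw [hB, ← hl]; simp
        have hc : c ∈ G.preds b π x := by rw [hl']; simp
        have h2 := (h.face_pred hx2 (f := ⟨(c, x), ((h.mem_preds hx2).1 hc).1.symm⟩) hl' rfl rfl).1
        have h3 : G.rot.cw (⟨(x, c), ((h.mem_preds hx2).1 hc).1⟩ : G.graph.Dart) = G.rot.cw d :=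
          dart_ext_iff.2 ⟨by rw [G.rot.fst_cw, G.rot.fst_cw, hd], h2⟩
        have h4 := G.rot.cw.injective h3
        have h5 : d.snd = c := by rw [← h4]
        rw [h5]
        refine ⟨hc, ?_⟩
        rintro rfl
        rw [hl'] at hnd
        rw [hB] at hl'
        cases l₁ with
        | nil =>
          have := (List.cons.inj hl').1
          rw [← this] at hnd
          simp at hnd
        | cons a l₁ =>
          have := (List.cons.inj hl').1
          rw [← this] at hnd
          simp at hnd
    refine ⟨⟨(x, wq), hwq.1⟩, rfl, fun _ => ?_, ?_, ?_, ?_⟩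
    · rw [hB, ← List.cons_append, List.getLast?_append]; rfl
    · intro d hd hout hnin
      have hm : (G.rot.cw d).snd ∈ G.preds b π x := by
        have := hin _ hnin
        rw [G.rot.fst_cw, hd] at this
        refine (h.mem_preds hx2).2 ⟨?_, this⟩
        have h6 := (G.rot.cw d).adj
        rwa [G.rot.fst_cw, hd] at h6
      refine dart_ext_iff.2 ⟨(G.rot.fst_cw d).trans hd, ?_⟩
      by_contra hne
      have := ((h.mem_preds hx2).1 (hnext d hd hm hne).1).2
      rw [hd] at hout
      exact lt_asymm hout this
    · intro hxz
      obtain ⟨t, ht, hlt⟩ := ho.exists_out hxz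
      obtain ⟨d, hd⟩ := G.rot.cw.surjective (⟨(x, wq), hwq.1⟩ : G.graph.Dart)
      have hdx : d.fst = x := by rw [← G.rot.fst_cw, hd]
      refine ⟨d, hdx, ?_, ?_⟩
      -- The dart before `x → wq` leads to an out-neighbor. If it led to `wp`, all neighbors would
      -- precede `x` by `face_first`; if it led to another predecessor, `face_pred` would make `wq`
      -- occur twice in `preds`.
      · by_contra hnin
        have hdm : d.snd ∈ G.preds b π x := by
          have h5 := hin d hnin
          have h6 := d.adj
          rw [hdx] at h5 h6
          exact (h.mem_preds hx2).2 ⟨h6, h5⟩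
        by_cases hdw : d.snd = wp
        · have h7 := h.face_first hx2 hB (f := d.symm) hdw hdx (by
            change (G.rot.cw d).snd ∈ _
            rw [hd, hB]; simp) ⟨(x, t), ht⟩ rfl
          exact lt_asymm hlt ((h.mem_preds hx2).1 h7).2
        · have hdm' := hdm
          rw [hB] at hdm'
          obtain ⟨l₁, l₂, hl⟩ := List.append_of_mem ((List.mem_cons.1 hdm').resolve_left hdw)
          have key : ∀ l₃ a, G.preds b π x = l₃ ++ a :: d.snd :: l₂ → False := by
            intro l₃ a hl₃
            have h8 := (h.face_pred hx2 (f := d.symm) hl₃ rfl hdx).1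
            have h9 : (G.rot.cw d).snd = a := h8
            rw [hd] at h9
            change wq = a at h9
            subst h9
            rw [hl₃] at hnd
            rw [hB] at hl₃
            have h10 : (wp :: (M ++ [wq])).getLast? = some wq := by
              rw [← List.cons_append, List.getLast?_append]; rfl
            rw [hl₃] at h10
            have h11 : wq ∈ d.snd :: l₂ := by
              rw [show l₃ ++ wq :: d.snd :: l₂ = (l₃ ++ [wq]) ++ (d.snd :: l₂) by simp,
                List.getLast?_append] at h10
              have : (d.snd :: l₂).getLast? = some wq := by
                cases hq : (d.snd :: l₂).getLast? with
                | none => simp at hq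
                | some q => rw [hq] at h10; simpa using h10
              exact List.mem_of_getLast? this
            rw [List.nodup_append, List.nodup_cons] at hnd
            exact hnd.2.1.1 h11
          rcases List.eq_nil_or_concat l₁ with rfl | ⟨l₃, a, rfl⟩
          · exact key [] wp (by rw [hB, hl]; simp)
          · exact key (wp :: l₃) a (by rw [hB, hl]; simp)
      · rw [hd]; exact lt_asymm hwq.2
    -- All neighbors of `z` precede it, so the corner at its first predecessor `wp` is the outer
    -- one, and `wp = u`. The dart clockwise after `z → u` is `face (face b)`; by `hnext` it can
    -- only lead to `wq`.
    · rintro rfl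
      have hall : ∀ d : G.graph.Dart, d.fst = x → d.snd ∈ G.preds b π x := by
        intro d hd
        have h6 := d.adj
        rw [hd] at h6
        exact (h.mem_preds hx2).2 ⟨h6, lt_of_le_of_ne (ho.le_last _) fun h7 =>
          h6.ne (π.injective h7.symm)⟩
      have hR := h.reach_first_of_no_out hx2 hB (f := ⟨(wp, x), hwp.1.symm⟩) rfl rfl hall
      have hwpu : wp = b.snd := by
        rcases ho.reach_cases hR with h1 | h1 | h1
        · have : x = b.snd := congrArg (fun d : G.graph.Dart => d.snd) h1
          exact absurd this hx
        · have : wp = (G.rot.face b).fst := congrArg (fun d : G.graph.Dart => d.fst) h1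
          rw [this, fst_face]
        · have : x = (G.rot.face (G.rot.face b)).snd := congrArg (fun d : G.graph.Dart => d.snd) h1
          exact absurd (this.trans ho.head_second) ho.ne_second
      have hff : (G.rot.face (G.rot.face b)).fst = x := (fst_face _).trans ho.head_first
      refine (dart_ext_iff.2 ⟨hff, ?_⟩).symm
      by_contra hne
      have h8 := (hnext (G.rot.face b).symm ho.head_first
        (hall (G.rot.face (G.rot.face b)) hff) hne).2
      change (G.rot.face b).fst ≠ wp at h8
      rw [fst_face] at h8
      exact h8 hwpu.symm
  -- The only in-neighbor of `v` is `u`, so the walk around `v` starts with `b`.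
  · have hxv : x = b.fst := (h.eq_first_or_second hx2).resolve_left hx
    subst hxv
    have hone : ∀ d : G.graph.Dart, d.fst = b.fst → ¬ π d.fst < π d.snd → d = b := by
      intro d hd hn
      have h5 := hin d hn
      rw [hd, Fin.lt_def, h.ord.second] at h5
      refine dart_ext_iff.2 ⟨hd, π.injective (Fin.ext ?_)⟩
      rw [h.ord.first]; omega
    refine ⟨b, rfl, fun h2 => absurd h2 hx2, ?_, ?_, ?_⟩
    · intro d hd _ hn
      exact hone _ ((G.rot.fst_cw d).trans hd) hn
    · intro hxz
      obtain ⟨t, ht, hlt⟩ := ho.exists_out hxz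
      obtain ⟨d, hd⟩ := G.rot.cw.surjective b
      have hdx : d.fst = b.fst := by rw [← G.rot.fst_cw, hd]
      refine ⟨d, hdx, ?_, ?_⟩
      · by_contra hn
        have h6 := hone d hdx hn
        subst h6
        obtain ⟨j, hj⟩ := exists_cw_pow (d := d) (d' := ⟨(d.fst, t), ht⟩) rfl
        have h7 : ∀ i, (G.rot.cw ^ i) d = d := by
          intro i
          induction i with
          | zero => rfl
          | succ i ih => rw [pow_succ', Equiv.Perm.mul_apply, ih, hd]
        rw [h7] at hj
        have h8 : d.snd = t := congrArg (fun d : G.graph.Dart => d.snd) hj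
        rw [← h8, Fin.lt_def, h.ord.first] at hlt
        omega
      · rw [hd, Fin.lt_def, h.ord.first]; omega
    · intro hbz; exact absurd hbz.symm ho.ne_second

/-- This separates geometry from computation: besides the bound on the number of darts, the
verification of the program uses only `WalkSpec`. -/
theorem exists_walkSpec (ho : Outer G b π z) :
    ∃ X Y st par rk, G.WalkSpec b z (G.orientation π) (G.fppDrawing b π) X Y st par rk := by
  classical
  have h := ho.canon
  obtain ⟨X, Y, hD⟩ := h.exists_drawing
  have hst : ∀ x, ∃ d₀ : G.graph.Dart, x ≠ b.snd → d₀.fst = x ∧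
      (2 ≤ (π x : ℕ) → (G.preds b π x).getLast? = some d₀.snd) ∧
      (∀ d : G.graph.Dart, d.fst = x → π d.fst < π d.snd →
        ¬ π (G.rot.cw d).fst < π (G.rot.cw d).snd → G.rot.cw d = d₀) ∧
      (x ≠ z → ∃ d : G.graph.Dart, d.fst = x ∧ π d.fst < π d.snd ∧
        ¬ π (G.rot.cw d).fst < π (G.rot.cw d).snd) ∧
      (x = z → d₀ = G.rot.face (G.rot.face b)) := by
    intro x
    -- `u` has no in-neighbors, so its walk may start anywhere and `b` is a dummy.
    by_cases hx : x = b.snd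
    · exact ⟨b, fun h => absurd hx h⟩
    · obtain ⟨d, hd⟩ := ho.exists_start hx
      exact ⟨d, fun _ => hd⟩
  choose st hst using hst
  have hcov : ∀ w, ∃ x, w ≠ b.snd → w ≠ b.fst → w ≠ z → ∃ l₁ l₂, 2 ≤ (π x : ℕ) ∧
      G.preds b π x = l₁ ++ w :: l₂ ∧ l₁ ≠ [] ∧ l₂ ≠ [] ∧
      X w + 1 + heightSum Y (w :: l₂) = X x + Y x := by
    intro w
    by_cases hw : w ∈ G.outerPath b Set.univ
    · refine ⟨w, fun h1 h2 h3 => ?_⟩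
      rw [ho.outerPath_univ] at hw
      simp [h1, h2, h3] at hw
    · obtain ⟨x, l₁, l₂, -, hx2, hl, hl₁, hl₂, hXY, -⟩ :=
        hD.cov w (π w).2 (by rwa [firstVertices_card])
      exact ⟨x, fun _ _ _ => ⟨l₁, l₂, hx2, hl, hl₁, hl₂, hXY⟩⟩
  choose par hpar using hcov
  have hgap := hD.gap
  rw [firstVertices_card, ho.outerPath_univ] at hgap
  simp only [GapChain, List.isChain_cons_cons, hD.first, hD.second] at hgap
  have hX_last : X z = Y z := by rw [hgap.1]; simp [adist]
  have hadj : ∀ d : G.graph.Dart, (G.orientation π).Adj d.fst d.snd ↔ π d.fst < π d.snd :=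
    fun d => and_iff_right d.adj
  have hsource : ∀ y, ¬ (G.orientation π).Adj y b.snd := by
    rintro y ⟨-, h1⟩
    rw [Fin.lt_def, h.ord.first] at h1
    omega
  refine ⟨X, Y, st, par, fun x => π x, ⟨fun x => hD.pos x (π x).2, fun h => h.1, ?_, fun h => h.2,
    ?_, hD.first.2, hD.second, hD.first.1, hX_last, ?_, ?_, ?_, ?_,
    ho.head_first.symm, ?_, ?_, ?_, ?_, fun x => (hD.bound x (π x).2).1,
    fun x => (hD.bound x (π x).2).2, ?_⟩⟩
  · intro a c hac
    rcases lt_or_gt_of_ne (fun h1 => hac.ne (π.injective h1) : π a ≠ π c) with h1 | h1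
    · exact Or.inl ⟨hac, h1⟩
    · exact Or.inr ⟨hac.symm, h1⟩
  · intro x
    constructor
    · intro hx
      by_contra hxu
      by_cases hx2 : 2 ≤ (π x : ℕ)
      · obtain ⟨y, hy, hxy⟩ := h.exists_adj hx2
        exact hx y ⟨hxy.symm, hy⟩
      · have := (h.eq_first_or_second hx2).resolve_left hxu
        subst this
        refine hx b.snd ⟨b.adj.symm, ?_⟩
        rw [Fin.lt_def, h.ord.first, h.ord.second]; exact Nat.one_pos
    · rintro rfl; exact hsource
  · rw [hgap.2.1, hX_last]; simp [adist]
  · intro d h1 h2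
    rw [hadj] at h1 h2
    have hne : d.fst ≠ b.snd := by
      intro hdu
      apply h2
      rw [G.rot.fst_cw, hdu]
      have h3 := (G.rot.cw d).adj.ne
      rw [G.rot.fst_cw, hdu] at h3
      rw [Fin.lt_def, h.ord.first]
      by_contra h4
      exact h3 (π.injective (Fin.ext (by rw [h.ord.first]; omega)))
    exact (hst _ hne).2.2.1 d rfl h1 h2
  · intro x hxu hxz
    obtain ⟨d, h1, h2, h3⟩ := (hst x hxu).2.2.2.1 hxz
    exact ⟨d, h1, (hadj d).2 h2, fun h4 => h3 ((hadj _).1 h4)⟩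
  · exact (hst z ho.ne_first).2.2.2.2 rfl
  · intro x hxu hxv
    have hx2 := h.two_le_iff.2 ⟨hxu, hxv⟩
    have hs := hst x hxu
    have h1 := h.walk_total hx2 hs.1 (hs.2.1 hx2) Y
      (h.length_le_period hx2 hs.1 (hs.2.1 hx2)) le_rfl
    have h2 := hD.height x (π x).2 hx2
    omega
  · intro w h1 h2 h3
    obtain ⟨l₁, l₂, hx2, hl, -⟩ := hpar w h1 h2 h3
    have := (h.mem_preds hx2).1 (show w ∈ G.preds b π (par w) by rw [hl]; simp)
    exact ⟨this.1.symm, this.2⟩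
  · intro w h1 h2 h3 t ht hne
    obtain ⟨l₁, l₂, hx2, hl, hl₁, hl₂, -⟩ := hpar w h1 h2 h3
    have hm := (h.mem_preds hx2).1 (show w ∈ G.preds b π (par w) by rw [hl]; simp)
    have hw : w ∉ G.outerPath b Set.univ := by rw [ho.outerPath_univ]; simp [h1, h2, h3]
    -- `w` has left the contour. So either another out-neighbor of `w` follows `t`, or `t` covers
    -- `w` and therefore is `par w`.
    rcases h.edge_cases_at (k := Nat.card V) (by have := h.card; omega) le_rfl (π t).2 ht.1 ht.2
      with (hc | hc) | ⟨t', hc⟩ | hc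
    · rw [firstVertices_card] at hc
      exact absurd (hc.subset (by simp)) hw
    · rw [firstVertices_card] at hc
      exact absurd (hc.subset (by simp)) hw
    · exact ⟨t', hc⟩
    · exfalso
      have ht2 : 2 ≤ (π t : ℕ) := by
        have h4 := ht.2
        have h5 := h.two_le_iff.2 ⟨h1, h2⟩
        rw [Fin.lt_def] at h4
        omega
      exact hne (π.injective (le_antisymm
        (h.le_of_covers hx2 ⟨l₁, l₂, hl, hl₁, hl₂⟩ ht.1 ht.2)
        (h.le_of_covers ht2 hc hm.1.symm hm.2)))
  · intro w h1 h2 h3 h4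
    obtain ⟨l₁, l₂, hx2, hl, hl₁, hl₂, hXY⟩ := hpar w h1 h2 h3
    have hs := hst (par w) h4
    obtain ⟨h5, h6, h7⟩ := h.walk_suffix hx2 hs.1 (hs.2.1 hx2) Y l₁ (w :: l₂) hl
    have h8 := h.length_le_period hx2 hs.1 (hs.2.1 hx2)
    refine ⟨l₂.length, ?_, h7 w l₂ rfl, ?_⟩
    · rw [hl] at h8; simp at h8; omega
    · rw [← hXY, ← h5]; rfl
  · intro d hd j hj
    by_cases hdu : d.fst = b.snd
    · have h0 : ∀ i, G.walkHeights (G.orientation π) Y d i = 0 := by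
        intro i
        unfold walkHeights
        rw [if_neg]
        rw [hdu]; exact hsource _
      obtain ⟨h1, h2⟩ := walkSum_eq_zero h0 j
      rw [h1, h2]; omega
    -- By the height formula the variation is at most `2 Y ≤ 4 n`, and a single height adds at most
    -- `2 n`.
    · by_cases hx2 : 2 ≤ (π d.fst : ℕ)
      · have hs := hst d.fst hdu
        rw [← hd hdu] at hs
        have hYle := fun a => (hD.bound a (π a).2).2
        have h2 := hD.height d.fst (π d.fst).2 hx2
        have h3 := hYle d.fst
        rcases le_total j (G.preds b π d.fst).length with hjl | hjl
        · have h1 := h.walk_le_of_lt hx2 rfl (hs.2.1 hx2) Y hjl _ hYle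
          omega
        · have h1 := h.walk_total hx2 rfl (hs.2.1 hx2) Y hjl hj
          omega
      · have hv := (h.eq_first_or_second hx2).resolve_left hdu
        have h0 : ∀ i, G.walkHeights (G.orientation π) Y d i = 0 := by
          intro i
          unfold walkHeights
          split_ifs with h1
          · have h2 := h1.2
            rw [Fin.lt_def, hv, h.ord.second] at h2
            have h3 : ((G.rot.cw ^ i) d).snd = b.snd :=
              π.injective (Fin.ext (by rw [h.ord.first]; omega))
            rw [h3, hD.first.2]
          · rfl
        obtain ⟨h1, h2⟩ := walkSum_eq_zero h0 j
        rw [h1, h2]; omega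

end Outer

end Canon

end PlaneGraph

/-! ### Verification of programs -/

namespace RAMProg

variable {w : ℕ} {s : RAMState} {T : ℕ} {Q Q' : RAMState → ℕ → Prop} {p q : RAMProg}

/-- Started in `s` with `T` time units available, `p` halts in a state that satisfies `Q` together
with the number of time units that are left. -/
def WP (w : ℕ) (p : RAMProg) (Q : RAMState → ℕ → Prop) (s : RAMState) (T : ℕ) : Prop :=
  ∃ t s' T', p.Exec w s t s' ∧ t + T' ≤ T ∧ Q s' T'

theorem wp_instr {i : RAMInstr} (hv : i.value s < w) (hT : 1 ≤ T)
    (hQ : Q (i.write s (i.value s)) (T - 1)) : WP w (.instr i) Q s T :=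
  ⟨1, _, T - 1, .instr i s hv, by omega, hQ⟩

theorem wp_seq (h : WP w p (fun s' T' => WP w q Q s' T') s T) : WP w (.seq p q) Q s T := by
  obtain ⟨t, s', T', h1, h2, t', s'', T'', h3, h4, h5⟩ := h
  exact ⟨t + t', s'', T'', .seq h1 h3, by omega, h5⟩

theorem WP.mono (h : WP w p Q s T) (hQ : ∀ s' T', Q s' T' → Q' s' T') : WP w p Q' s T := by
  obtain ⟨t, s', T', h1, h2, h3⟩ := h
  exact ⟨t, s', T', h1, h2, hQ _ _ h3⟩

theorem wp_ite {a b : ℕ} (hT : 1 ≤ T) (hp : s.reg a < s.reg b → WP w p Q s (T - 1))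
    (hq : ¬ s.reg a < s.reg b → WP w q Q s (T - 1)) : WP w (.ite a b p q) Q s T := by
  by_cases h : s.reg a < s.reg b
  · obtain ⟨t, s', T', h1, h2, h3⟩ := hp h
    exact ⟨t + 1, s', T', .ite_true h h1, by omega, h3⟩
  · obtain ⟨t, s', T', h1, h2, h3⟩ := hq h
    exact ⟨t + 1, s', T', .ite_false h h1, by omega, h3⟩

/-- The invariant of a loop includes the available time, which decreases. -/
theorem wp_loop {a b : ℕ} (I : RAMState → ℕ → Prop) (hI : I s T)
    (hstep : ∀ s T, I s T → 1 ≤ T ∧ (s.reg a < s.reg b → WP w p I s (T - 1)) ∧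
      (¬ s.reg a < s.reg b → Q s (T - 1))) : WP w (.loop a b p) Q s T := by
  induction T using Nat.strong_induction_on generalizing s with
  | _ T ih =>
    obtain ⟨hT, h1, h2⟩ := hstep s T hI
    by_cases h : s.reg a < s.reg b
    · obtain ⟨t, s', T', e1, e2, e3⟩ := h1 h
      obtain ⟨t', s'', T'', e4, e5, e6⟩ := ih T' (by omega) e3
      exact ⟨t + t' + 1, s'', T'', .loop_true h e1 e4, by omega, e6⟩
    · exact ⟨1, s, T - 1, .loop_false h, by omega, h2 h⟩

end RAMProg

/-! ### Arrays in the memory and rules for programs that use them -/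

namespace RAMLayout

/-- The first address of the array `a`. The arrays `0`, …, `4` have `m` entries, one for each dart,
and the arrays `5`, …, `11` have `n` entries, one for each vertex. -/
def base (n m a : ℕ) : ℕ := if a < 5 then 3 + a * m else 3 + 5 * m + (a - 5) * n

/-- The number of entries of the array `a`. -/
def size (n m a : ℕ) : ℕ := if a < 5 then m else n

/-- The registers below `40` hold `ρ`, the arrays hold `μ`, and the registers `50`, …, `61` hold the
addresses of the arrays. -/
structure Rep (n m w : ℕ) (s : RAMState) (ρ : ℕ → ℕ) (μ : ℕ → ℕ → ℕ) : Prop where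
  reg : ∀ r < 40, s.reg r = ρ r
  regBase : ∀ a < 12, s.reg (50 + a) = base n m a
  mem : ∀ a < 12, ∀ i < size n m a, s.mem (base n m a + i) = μ a i
  reg_lt : ∀ r, ρ r < w
  mem_lt : ∀ a i, μ a i < w
  addr_lt : ∀ a < 12, base n m a + size n m a ≤ w

/-- Changing one entry of an array. -/
def upd (μ : ℕ → ℕ → ℕ) (a i v : ℕ) : ℕ → ℕ → ℕ :=
  fun a' i' => if a' = a ∧ i' = i then v else μ a' i'

theorem upd_same (μ : ℕ → ℕ → ℕ) (a i v : ℕ) : upd μ a i v a i = v := by simp [upd]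

theorem upd_array_ne (μ : ℕ → ℕ → ℕ) {a a' : ℕ} (i v : ℕ) (h : a' ≠ a) :
    upd μ a i v a' = μ a' := by funext j; simp [upd, h]

theorem upd_index_ne (μ : ℕ → ℕ → ℕ) (a : ℕ) {i i' : ℕ} (v : ℕ) (h : i' ≠ i) :
    upd μ a i v a i' = μ a i' := by simp [upd, h]

theorem base_disjoint {n m a a' i i' : ℕ} (hi : i < size n m a) (hne : a < a') :
    base n m a + i < base n m a' + i' := by
  unfold base size at *
  split_ifs at * with h1 h2
  · have := Nat.mul_le_mul_right m (show a + 1 ≤ a' by omega)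
    rw [Nat.add_mul] at this
    omega
  · have := Nat.mul_le_mul_right m (show a + 1 ≤ 5 by omega)
    rw [Nat.add_mul] at this
    omega
  · omega
  · have := Nat.mul_le_mul_right n (show (a - 5) + 1 ≤ a' - 5 by omega)
    rw [Nat.add_mul] at this
    omega

theorem base_inj {n m a a' i i' : ℕ} (hi : i < size n m a) (hi' : i' < size n m a')
    (h : base n m a + i = base n m a' + i') : a = a' ∧ i = i' := by
  rcases lt_trichotomy a a' with h1 | h1 | h1
  · have := base_disjoint (i' := i') hi h1; omega
  · subst h1; exact ⟨rfl, by omega⟩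
  · have := base_disjoint (i' := i) hi' h1; omega

open RAMProg

/-- `reg r := array a [reg i]` -/
def ld (r a i : ℕ) : RAMProg :=
  .seq (.instr (.add 49 (50 + a) i)) (.instr (.load r 49))

/-- `array a [reg i] := reg r` -/
def sto (a i r : ℕ) : RAMProg :=
  .seq (.instr (.add 49 (50 + a) i)) (.instr (.store 49 r))

variable {n m w T : ℕ} {ρ : ℕ → ℕ} {μ : ℕ → ℕ → ℕ} {Q : (ℕ → ℕ) → (ℕ → ℕ → ℕ) → ℕ → Prop}
  {p q : RAMProg}

variable (n m w) in
/-- The analogue of `RAMProg.WP` for registers and arrays. -/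
def AWP (p : RAMProg) (Q : (ℕ → ℕ) → (ℕ → ℕ → ℕ) → ℕ → Prop) (ρ : ℕ → ℕ) (μ : ℕ → ℕ → ℕ) (T : ℕ) :
    Prop :=
  ∀ s, Rep n m w s ρ μ → WP w p (fun s' T' => ∃ ρ' μ', Rep n m w s' ρ' μ' ∧ Q ρ' μ' T') s T

theorem Rep.update {s : RAMState} (h : Rep n m w s ρ μ) {r v : ℕ} (hr : r < 40) (hv : v < w) :
    Rep n m w { s with reg := Function.update s.reg r v } (Function.update ρ r v) μ := by
  refine ⟨fun r' hr' => ?_, fun a ha => ?_, h.mem, fun r' => ?_, h.mem_lt, h.addr_lt⟩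
  · by_cases hrr : r' = r
    · subst hrr; simp
    · simp [hrr, h.reg r' hr']
  · have : 50 + a ≠ r := by omega
    simp [this, h.regBase a ha]
  · by_cases hrr : r' = r
    · subst hrr; simpa
    · simpa [hrr] using h.reg_lt r'

/-- Register `49`, which holds computed addresses, is outside the ranges described by `Rep`. -/
theorem Rep.update_tmp {s : RAMState} (h : Rep n m w s ρ μ) (v : ℕ) :
    Rep n m w { s with reg := Function.update s.reg 49 v } ρ μ := by
  refine ⟨fun r' hr' => ?_, fun a ha => ?_, h.mem, h.reg_lt, h.mem_lt, h.addr_lt⟩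
  · have : r' ≠ 49 := by omega
    simp [this, h.reg r' hr']
  · have : 50 + a ≠ 49 := by omega
    simp [this, h.regBase a ha]

theorem Rep.store {s : RAMState} (h : Rep n m w s ρ μ) {a i v : ℕ} (ha : a < 12)
    (hi : i < size n m a) (hv : v < w) :
    Rep n m w { s with mem := Function.update s.mem (base n m a + i) v } ρ (upd μ a i v) := by
  refine ⟨h.reg, h.regBase, fun a' ha' i' hi' => ?_, h.reg_lt, fun a' i' => ?_, h.addr_lt⟩
  · by_cases hc : a' = a ∧ i' = i
    · obtain ⟨rfl, rfl⟩ := hc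
      simp [upd]
    · have : base n m a' + i' ≠ base n m a + i := fun h1 => hc (base_inj hi' hi h1)
      simp [this, upd, hc, h.mem a' ha' i' hi']
  · unfold upd
    split_ifs
    · exact hv
    · exact h.mem_lt a' i'

theorem awp_seq (h : AWP n m w p (fun ρ' μ' T' => AWP n m w q Q ρ' μ' T') ρ μ T) :
    AWP n m w (.seq p q) Q ρ μ T := fun s hs =>
  wp_seq ((h s hs).mono fun _ _ ⟨_, _, h1, h2⟩ => h2 _ h1)

theorem awp_const {r c : ℕ} (hc : c < w) (hT : 1 ≤ T)
    (hQ : Q (Function.update ρ r c) μ (T - 1)) (hr : r < 40 := by norm_num) :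
    AWP n m w (.instr (.const r c)) Q ρ μ T := fun _ hs =>
  wp_instr hc hT ⟨_, _, hs.update hr hc, hQ⟩

/-- The value `v` is an argument with an equation, so that the caller chooses the form in which the
new contents are recorded. -/
theorem awp_move {r a : ℕ} (v : ℕ) (hv : ρ a = v) (hT : 1 ≤ T)
    (hQ : Q (Function.update ρ r v) μ (T - 1)) (hr : r < 40 := by norm_num)
    (ha : a < 40 := by norm_num) : AWP n m w (.instr (.move r a)) Q ρ μ T := fun s hs => by
  have h1 : RAMInstr.value s (.move r a) = v := by rw [← hv]; exact hs.reg a ha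
  have h2 : v < w := hv ▸ hs.reg_lt a
  refine wp_instr (h1.trans_lt h2) hT ⟨_, _, ?_, hQ⟩
  rw [h1]; exact hs.update hr h2

theorem awp_add {r a b : ℕ} (v : ℕ) (hv : ρ a + ρ b = v) (hvw : v < w) (hT : 1 ≤ T)
    (hQ : Q (Function.update ρ r v) μ (T - 1)) (hr : r < 40 := by norm_num)
    (ha : a < 40 := by norm_num) (hb : b < 40 := by norm_num) :
    AWP n m w (.instr (.add r a b)) Q ρ μ T := fun s hs => by
  have h1 : RAMInstr.value s (.add r a b) = v := by
    rw [← hv, ← hs.reg a ha, ← hs.reg b hb]; rfl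
  refine wp_instr (h1.trans_lt hvw) hT ⟨_, _, ?_, hQ⟩
  rw [h1]; exact hs.update hr hvw

theorem awp_sub {r a b : ℕ} (v : ℕ) (hv : ρ a - ρ b = v) (hT : 1 ≤ T)
    (hQ : Q (Function.update ρ r v) μ (T - 1)) (hr : r < 40 := by norm_num)
    (ha : a < 40 := by norm_num) (hb : b < 40 := by norm_num) :
    AWP n m w (.instr (.sub r a b)) Q ρ μ T := fun s hs => by
  have h1 : RAMInstr.value s (.sub r a b) = v := by
    rw [← hv, ← hs.reg a ha, ← hs.reg b hb]; rfl
  have h2 : v < w := by have := hs.reg_lt a; omega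
  refine wp_instr (h1.trans_lt h2) hT ⟨_, _, ?_, hQ⟩
  rw [h1]; exact hs.update hr h2

theorem awp_half {r a : ℕ} (v : ℕ) (hv : ρ a / 2 = v) (hT : 1 ≤ T)
    (hQ : Q (Function.update ρ r v) μ (T - 1)) (hr : r < 40 := by norm_num)
    (ha : a < 40 := by norm_num) : AWP n m w (.instr (.half r a)) Q ρ μ T := fun s hs => by
  have h1 : RAMInstr.value s (.half r a) = v := by rw [← hv, ← hs.reg a ha]; rfl
  have h2 : v < w := by have := hs.reg_lt a; omega
  refine wp_instr (h1.trans_lt h2) hT ⟨_, _, ?_, hQ⟩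
  rw [h1]; exact hs.update hr h2

theorem awp_ld {r a i : ℕ} (j v : ℕ) (hj : ρ i = j) (hjs : j < size n m a) (hv : μ a j = v)
    (hT : 2 ≤ T) (hQ : Q (Function.update ρ r v) μ (T - 2)) (hr : r < 40 := by norm_num)
    (ha : a < 12 := by norm_num) (hi : i < 40 := by norm_num) :
    AWP n m w (ld r a i) Q ρ μ T := fun s hs => by
  have h0 : RAMInstr.value s (.add 49 (50 + a) i) = base n m a + j := by
    rw [← hj, ← hs.reg i hi, ← hs.regBase a ha]; rfl
  have h1 := hs.addr_lt a ha
  refine wp_seq (wp_instr (by rw [h0]; omega) (by omega) ?_)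
  rw [h0]
  have hs1 := hs.update_tmp (base n m a + j)
  have h2 : RAMInstr.value { s with reg := Function.update s.reg 49 (base n m a + j) }
      (.load r 49) = v := by
    rw [← hv, ← hs.mem a ha j hjs]; simp [RAMInstr.value]
  refine wp_instr (s := { s with reg := Function.update s.reg 49 (base n m a + j) })
    (h2.trans_lt (hv ▸ hs.mem_lt a j)) (by omega) ⟨_, _, ?_, hQ⟩
  rw [h2]; exact hs1.update hr (hv ▸ hs.mem_lt a j)

theorem awp_sto {r a i : ℕ} (j v : ℕ) (hj : ρ i = j) (hjs : j < size n m a) (hv : ρ r = v)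
    (hT : 2 ≤ T) (hQ : Q ρ (upd μ a j v) (T - 2)) (hr : r < 40 := by norm_num)
    (ha : a < 12 := by norm_num) (hi : i < 40 := by norm_num) :
    AWP n m w (sto a i r) Q ρ μ T := fun s hs => by
  have h0 : RAMInstr.value s (.add 49 (50 + a) i) = base n m a + j := by
    rw [← hj, ← hs.reg i hi, ← hs.regBase a ha]; rfl
  have h1 := hs.addr_lt a ha
  refine wp_seq (wp_instr (by rw [h0]; omega) (by omega) ?_)
  rw [h0]
  have hs1 := hs.update_tmp (base n m a + j)
  have h2 : RAMInstr.value { s with reg := Function.update s.reg 49 (base n m a + j) }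
      (.store 49 r) = v := by
    have : r ≠ 49 := by omega
    rw [← hv, ← hs.reg r hr]; simp [RAMInstr.value, this]
  refine wp_instr (s := { s with reg := Function.update s.reg 49 (base n m a + j) })
    (h2.trans_lt (hv ▸ hs.reg_lt r)) (by omega) ⟨_, _, ?_, hQ⟩
  rw [h2]
  have h3 := hs1.store ha hjs (hv ▸ hs.reg_lt r : v < w)
  simpa [RAMInstr.write] using h3

theorem awp_ite {a b : ℕ} (hT : 1 ≤ T) (hp : ρ a < ρ b → AWP n m w p Q ρ μ (T - 1))
    (hq : ¬ ρ a < ρ b → AWP n m w q Q ρ μ (T - 1)) (ha : a < 40 := by norm_num)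
    (hb : b < 40 := by norm_num) : AWP n m w (.ite a b p q) Q ρ μ T := fun s hs =>
  wp_ite hT (fun h => hp (by rwa [hs.reg a ha, hs.reg b hb] at h) s hs)
    (fun h => hq (by rwa [hs.reg a ha, hs.reg b hb] at h) s hs)

theorem awp_loop {a b : ℕ} (I : (ℕ → ℕ) → (ℕ → ℕ → ℕ) → ℕ → Prop) (hI : I ρ μ T)
    (hstep : ∀ ρ μ T, I ρ μ T → 1 ≤ T ∧ (ρ a < ρ b → AWP n m w p I ρ μ (T - 1)) ∧
      (¬ ρ a < ρ b → Q ρ μ (T - 1))) (ha : a < 40 := by norm_num)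
    (hb : b < 40 := by norm_num) : AWP n m w (.loop a b p) Q ρ μ T := fun s hs => by
  refine wp_loop (fun s' T' => ∃ ρ' μ', Rep n m w s' ρ' μ' ∧ I ρ' μ' T') ⟨ρ, μ, hs, hI⟩ ?_
  rintro s' T' ⟨ρ', μ', h1, h2⟩
  obtain ⟨h3, h4, h5⟩ := hstep ρ' μ' T' h2
  rw [h1.reg a ha, h1.reg b hb]
  exact ⟨h3, fun h => h4 h s' h1, fun h => ⟨ρ', μ', h1, h5 h⟩⟩

theorem AWP.mono {Q' : (ℕ → ℕ) → (ℕ → ℕ → ℕ) → ℕ → Prop} (h : AWP n m w p Q ρ μ T)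
    (hQ : ∀ ρ' μ' T', Q ρ' μ' T' → Q' ρ' μ' T') : AWP n m w p Q' ρ μ T := fun s hs =>
  (h s hs).mono fun _ _ ⟨ρ', μ', h1, h2⟩ => ⟨ρ', μ', h1, hQ _ _ _ h2⟩

end RAMLayout

/-! ### The program and its preparatory pass -/

namespace RAMLayout

set_option linter.unusedSectionVars false

open RAMProg

local infixr:67 ";;" => RAMProg.seq

variable {V : Type*} {G : PlaneGraph V} {b : G.graph.Dart} {z : V} {D : Digraph V}
  {Γ : V → ℝ × ℝ} {X Y : V → ℕ} {st : V → G.graph.Dart} {par : V → V} {rk : V → ℕ}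
  {N : GraphNumbering G.graph} {ρ : ℕ → ℕ} {μ : ℕ → ℕ → ℕ} {w T : ℕ}

/-! ### The program -/

/-- Find the vertices `u`, `v`, `z` and the dart from `z` to `v`. -/
def findOuter : RAMProg :=
  -- Registers `0`, …, `4` hold `0`, `1`, `n`, the number of darts, and the base dart. The arrays
  -- are: `0` tail, `1` head, `2` twin, `3` clockwise next dart, `4` direction bit, `5` start of the
  -- walk, `6` in-degree, `7` queue, `8` height, `9` covering vertex, `10` offset to it, `11`
  -- abscissa.
  ld 5 1 4 ;; ld 6 0 4 ;; ld 9 2 4 ;; ld 9 3 9 ;; ld 7 1 9 ;; ld 9 2 9 ;; ld 8 3 9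

/-- Process one dart: count it, if it is directed to its head, and find the start of a walk. -/
def countDart : RAMProg :=
  ld 10 4 9 ;;
  -- As register `0` holds `0`, `ite 0 a` asks whether register `a` is positive. The instruction
  -- `const 13 0` only fills a branch that has nothing to do.
  .ite 0 10
    (ld 11 1 9 ;; ld 12 6 11 ;; .instr (.add 12 12 1) ;; sto 6 11 12 ;; ld 11 3 9 ;; ld 12 4 11 ;;
      .ite 0 12 (.instr (.const 13 0)) (ld 13 0 9 ;; sto 5 13 11))
    (.instr (.const 13 0)) ;;
  .instr (.add 9 9 1)

/-- Compute the in-degrees and the starts of the walks, and initialize the queue. -/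
def prepare : RAMProg :=
  .instr (.const 9 0) ;; .loop 9 3 countDart ;; sto 5 7 8 ;; .instr (.const 9 0) ;; sto 7 9 5 ;;
  .instr (.move 10 1)

/-- Remove a dart, which is directed to its head if register 19 is positive, from the in-degree of
its head. -/
def relax : RAMProg :=
  .ite 0 19
    (ld 20 6 17 ;; .instr (.sub 20 20 1) ;; sto 6 17 20 ;;
      .ite 0 20 (.instr (.const 21 0)) (sto 7 10 17 ;; .instr (.add 10 10 1)))
    (.instr (.const 21 0))

/-- One step of a walk around a vertex. -/
def walkStep : RAMProg :=
  -- Truncated subtraction in both directions gives a distance. Arrays `9` and `10` are written for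
  -- all neighbors without a test; the entries made by the covering vertex are the last ones and
  -- survive. Register `16` becomes `0` when the walk is back at its first dart.
  ld 17 1 13 ;; ld 18 8 17 ;; .instr (.sub 19 18 15) ;; .instr (.sub 20 15 18) ;;
  .instr (.add 19 19 20) ;; .instr (.add 14 14 19) ;; .instr (.move 15 18) ;; sto 9 17 11 ;;
  sto 10 17 14 ;; ld 19 4 13 ;; relax ;; ld 13 3 13 ;;
  .instr (.sub 19 13 12) ;; .instr (.sub 20 12 13) ;; .instr (.add 16 19 20)

/-- Process the next vertex of the queue. -/
def visit : RAMProg :=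
  -- Register `14` starts at `1`, which is the `+ 1` in the equation for covered vertices; a second
  -- `1` completes the `+ 2` of the height formula. The heights of `u` and `v` do not obey the
  -- formula and are reset to `0`.
  ld 11 7 9 ;; ld 12 5 11 ;; .instr (.move 13 12) ;; .instr (.move 14 1) ;;
  .instr (.const 15 0) ;; .instr (.move 16 1) ;; .loop 0 16 walkStep ;;
  .instr (.add 14 14 15) ;; .instr (.add 14 14 1) ;; .instr (.half 14 14) ;; sto 8 11 14 ;;
  sto 8 5 0 ;; sto 8 6 0 ;; .instr (.add 9 9 1)

/-- Set the horizontal positions of `z`, `u` and `v`. -/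
def placeOuter : RAMProg :=
  ld 13 8 7 ;; sto 11 7 13 ;; sto 11 5 0 ;; .instr (.add 13 13 13) ;; sto 11 6 13

/-- Set the horizontal position of the previous vertex of the queue. -/
def place : RAMProg :=
  -- For `u`, `v` and `z` the value stored here is meaningless; `placeOuter` corrects it at once.
  .instr (.sub 9 9 1) ;; ld 11 7 9 ;; ld 12 9 11 ;; ld 13 11 12 ;; ld 14 8 12 ;;
  .instr (.add 13 13 14) ;; ld 14 10 11 ;; .instr (.sub 13 13 14) ;; sto 11 11 13 ;; placeOuter

/-- Compute the drawing. -/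
def draw : RAMProg :=
  findOuter ;; prepare ;; .loop 9 10 visit ;; placeOuter ;; .instr (.move 9 2) ;; .loop 0 9 place

/-! ### The input -/

/-- The registers that are not changed by the main part of the program. -/
structure Regs (G : PlaneGraph V) (b : G.graph.Dart) (z : V) (N : GraphNumbering G.graph)
    (ρ : ℕ → ℕ) : Prop where
  zero : ρ 0 = 0
  one : ρ 1 = 1
  card : ρ 2 = Nat.card V
  dart : ρ 3 = Nat.card G.graph.Dart
  base : ρ 4 = N.dart b
  first : ρ 5 = N.vtx b.snd
  second : ρ 6 = N.vtx b.fst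
  last : ρ 7 = N.vtx z
  start : ρ 8 = N.dart (G.rot.face (G.rot.face b))

theorem Regs.update (h : Regs G b z N ρ) (r v : ℕ) (hr : 9 ≤ r) :
    Regs G b z N (Function.update ρ r v) := by
  constructor <;> rw [Function.update_of_ne (by omega)]
  exacts [h.zero, h.one, h.card, h.dart, h.base, h.first, h.second, h.last, h.start]

open Classical in
/-- The arrays that are not changed by the program. -/
structure Static (G : PlaneGraph V) (D : Digraph V) (N : GraphNumbering G.graph)
    (μ : ℕ → ℕ → ℕ) : Prop where
  tail : ∀ d, μ 0 (N.dart d) = N.vtx d.fst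
  head : ∀ d, μ 1 (N.dart d) = N.vtx d.snd
  twin : ∀ d, μ 2 (N.dart d) = N.dart d.symm
  next : ∀ d, μ 3 (N.dart d) = N.dart (G.rot.cw d)
  bit : ∀ d, μ 4 (N.dart d) = if D.Adj d.fst d.snd then 1 else 0

theorem Static.upd (h : Static G D N μ) {a : ℕ} (i v : ℕ) (ha : 5 ≤ a) :
    Static G D N (upd μ a i v) := by
  constructor <;> intro d <;> rw [upd_array_ne _ _ _ (by omega)]
  exacts [h.tail d, h.head d, h.twin d, h.next d, h.bit d]

theorem vtx_lt_size (N : GraphNumbering G.graph) (x : V) {a : ℕ} (ha : 5 ≤ a) :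
    (N.vtx x : ℕ) < size (Nat.card V) (Nat.card G.graph.Dart) a := by
  rw [size, if_neg (by omega)]; exact (N.vtx x).2

theorem dart_lt_size (N : GraphNumbering G.graph) (d : G.graph.Dart) {a : ℕ} (ha : a < 5) :
    (N.dart d : ℕ) < size (Nat.card V) (Nat.card G.graph.Dart) a := by
  rw [size, if_pos ha]; exact (N.dart d).2

theorem vtx_ne {x y : V} (h : x ≠ y) : (N.vtx x : ℕ) ≠ N.vtx y := fun h1 =>
  h (N.vtx.injective (Fin.ext h1))

/-- The in-degrees, counting only the darts in `A`. -/
def InDegrees (D : Digraph V) (N : GraphNumbering G.graph) (A : Set G.graph.Dart)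
    (μ : ℕ → ℕ → ℕ) : Prop :=
  ∀ y, μ 6 (N.vtx y) = {d : G.graph.Dart | D.Adj d.fst d.snd ∧ d.snd = y ∧ d ∈ A}.ncard

/-- The arrays after `k` darts have been processed by `countDart`. -/
structure Counted (G : PlaneGraph V) (D : Digraph V) (N : GraphNumbering G.graph)
    (st : V → G.graph.Dart) (k : ℕ) (μ : ℕ → ℕ → ℕ) : Prop where
  static : Static G D N μ
  inDegrees : InDegrees D N {d | (N.dart d : ℕ) < k} μ
  start : ∀ x, ∃ d₀ : G.graph.Dart, d₀.fst = x ∧ μ 5 (N.vtx x) = N.dart d₀ ∧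
    ((∃ d : G.graph.Dart, d.fst = x ∧ D.Adj d.fst d.snd ∧
      ¬ D.Adj (G.rot.cw d).fst (G.rot.cw d).snd ∧ (N.dart d : ℕ) < k) → d₀ = st x)
  zero : ∀ a, 7 ≤ a → a < 12 → ∀ i < Nat.card V, μ a i = 0

theorem awp_findOuter {Q : (ℕ → ℕ) → (ℕ → ℕ → ℕ) → ℕ → Prop} (hμ : Static G D N μ)
    (hz : z = (G.rot.face b).snd) (h0 : ρ 0 = 0) (h1 : ρ 1 = 1) (h2 : ρ 2 = Nat.card V)
    (h3 : ρ 3 = Nat.card G.graph.Dart) (h4 : ρ 4 = N.dart b) (hT : 14 ≤ T)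
    (hQ : ∀ ρ', Regs G b z N ρ' → Q ρ' μ (T - 14)) :
    AWP (Nat.card V) (Nat.card G.graph.Dart) w findOuter Q ρ μ T := by
  have hface : ∀ d, G.rot.cw d.symm = G.rot.face d := fun d => rfl
  refine awp_seq (awp_ld (N.dart b) (N.vtx b.snd) (by simp [h4]) (dart_lt_size N _ (by norm_num))
    (hμ.head b) (by omega) ?_)
  refine awp_seq (awp_ld (N.dart b) (N.vtx b.fst) (by simp [h4]) (dart_lt_size N _ (by norm_num))
    (hμ.tail b) (by omega) ?_)
  refine awp_seq (awp_ld (N.dart b) (N.dart b.symm) (by simp [h4])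
    (dart_lt_size N _ (by norm_num)) (hμ.twin b) (by omega) ?_)
  refine awp_seq (awp_ld (N.dart b.symm) (N.dart (G.rot.face b)) (by simp)
    (dart_lt_size N _ (by norm_num)) (by rw [hμ.next, hface]) (by omega) ?_)
  refine awp_seq (awp_ld (N.dart (G.rot.face b)) (N.vtx z) (by simp)
    (dart_lt_size N _ (by norm_num)) (by rw [hμ.head, hz]) (by omega) ?_)
  refine awp_seq (awp_ld (N.dart (G.rot.face b)) (N.dart (G.rot.face b).symm) (by simp)
    (dart_lt_size N _ (by norm_num)) (hμ.twin _) (by omega) ?_)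
  refine awp_ld (N.dart (G.rot.face b).symm) (N.dart (G.rot.face (G.rot.face b))) (by simp)
    (dart_lt_size N _ (by norm_num)) (by rw [hμ.next, hface]) (by omega) ?_
  have h5 := hQ (Function.update (Function.update (Function.update (Function.update
    (Function.update (Function.update (Function.update ρ 5 (N.vtx b.snd)) 6 (N.vtx b.fst))
    9 (N.dart b.symm)) 9 (N.dart (G.rot.face b))) 7 (N.vtx z)) 9 (N.dart (G.rot.face b).symm)) 8
    (N.dart (G.rot.face (G.rot.face b)))) (by constructor <;> simp [*])
  have h6 : T - 2 - 2 - 2 - 2 - 2 - 2 - 2 = T - 14 := by omega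
  rw [h6]
  exact h5

variable [Finite V]

theorem ncard_insert_dart {P : G.graph.Dart → Prop} {A : Set G.graph.Dart} {d : G.graph.Dart}
    (hd : d ∉ A) (hP : P d) :
    {e | P e ∧ e ∈ insert d A}.ncard = {e | P e ∧ e ∈ A}.ncard + 1 := by
  have : Finite G.graph.Dart := PlaneGraph.finite_dart
  rw [← Set.ncard_insert_of_notMem (a := d) (fun h => hd h.2) (Set.toFinite _)]
  congr 1
  ext e
  simp only [Set.mem_ofPred_eq, Set.mem_insert_iff]
  constructor
  · rintro ⟨h1, rfl | h2⟩
    · exact Or.inl rfl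
    · exact Or.inr ⟨h1, h2⟩
  · rintro (rfl | ⟨h1, h2⟩)
    · exact ⟨hP, Or.inl rfl⟩
    · exact ⟨h1, Or.inr h2⟩

theorem ncard_insert_dart_of_not {P : G.graph.Dart → Prop} {A : Set G.graph.Dart}
    {d : G.graph.Dart} (hP : ¬ P d) :
    {e | P e ∧ e ∈ insert d A}.ncard = {e | P e ∧ e ∈ A}.ncard := by
  congr 1
  ext e
  simp only [Set.mem_ofPred_eq, Set.mem_insert_iff]
  constructor
  · rintro ⟨h1, rfl | h2⟩
    · exact absurd h1 hP
    · exact ⟨h1, h2⟩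
  · rintro ⟨h1, h2⟩
    exact ⟨h1, Or.inr h2⟩

theorem InDegrees.extend {A : Set G.graph.Dart} {d : G.graph.Dart} (h : InDegrees D N A μ)
    (hd : d ∉ A) (hD : D.Adj d.fst d.snd) :
    InDegrees D N (insert d A) (upd μ 6 (N.vtx d.snd) (μ 6 (N.vtx d.snd) + 1)) := by
  intro y
  by_cases hy : y = d.snd
  · subst hy
    rw [upd_same, h]
    have := ncard_insert_dart (P := fun e : G.graph.Dart => D.Adj e.fst e.snd ∧ e.snd = d.snd) hd
      ⟨hD, rfl⟩
    simp only [and_assoc] at this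
    rw [this]
  · rw [upd_index_ne _ _ _ (vtx_ne hy), h]
    have := ncard_insert_dart_of_not (d := d) (A := A)
      (P := fun e : G.graph.Dart => D.Adj e.fst e.snd ∧ e.snd = y) (fun h => hy h.2.symm)
    simp only [and_assoc] at this
    rw [this]

theorem InDegrees.extend_of_not {A : Set G.graph.Dart} {d : G.graph.Dart} (h : InDegrees D N A μ)
    (hD : ¬ D.Adj d.fst d.snd) : InDegrees D N (insert d A) μ := by
  intro y
  rw [h]
  have := ncard_insert_dart_of_not (d := d) (A := A)
    (P := fun e : G.graph.Dart => D.Adj e.fst e.snd ∧ e.snd = y) (fun h => hD h.1)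
  simp only [and_assoc] at this
  rw [this]

theorem dart_lt_succ {k : ℕ} {d : G.graph.Dart} (hd : (N.dart d : ℕ) = k) :
    {e | (N.dart e : ℕ) < k + 1} = insert d {e | (N.dart e : ℕ) < k} := by
  ext e
  simp only [Set.mem_ofPred_eq, Set.mem_insert_iff]
  constructor
  · intro h
    by_cases he : (N.dart e : ℕ) = k
    · exact Or.inl (N.dart.injective (Fin.ext (he.trans hd.symm)))
    · exact Or.inr (by omega)
  · rintro (rfl | h) <;> omega

/-- By `st_unique`, every change from an outgoing to an incoming dart around a vertex yields the
right start, in whatever order the darts are numbered. -/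
theorem awp_countDart (hW : G.WalkSpec b z D Γ X Y st par rk) {d : G.graph.Dart}
    (hρ : Regs G b z N ρ) (hμ : Counted G D N st (N.dart d) μ) (h9 : ρ 9 = N.dart d)
    (hw : 10 * Nat.card V ≤ w) (hm : Nat.card G.graph.Dart ≤ 6 * Nat.card V) (hT : 20 ≤ T) :
    AWP (Nat.card V) (Nat.card G.graph.Dart) w countDart
      (fun ρ' μ' T' => Regs G b z N ρ' ∧ Counted G D N st (N.dart d + 1) μ' ∧
        ρ' 9 = N.dart d + 1 ∧ T ≤ T' + 20) ρ μ T := by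
  classical
  have : Finite G.graph.Dart := PlaneGraph.finite_dart
  have hcardV : 0 < Nat.card V := by
    have := (N.vtx b.fst).2; omega
  have hdlt : (N.dart d : ℕ) < Nat.card G.graph.Dart := (N.dart d).2
  have hnot : d ∉ {e | (N.dart e : ℕ) < N.dart d} := fun h => lt_irrefl (N.dart d : ℕ) h
  refine awp_seq (awp_ld (N.dart d) _ h9 (dart_lt_size N _ (by norm_num)) (hμ.static.bit d)
    (by omega) ?_)
  refine awp_seq (AWP.mono (Q := fun ρ' μ' T' => Regs G b z N ρ' ∧
    Counted G D N st (N.dart d + 1) μ' ∧ ρ' 9 = N.dart d ∧ T ≤ T' + 19) ?_ ?_)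
  · refine awp_ite (by omega) (fun hb => ?_) (fun hb => ?_)
    · have hbit : D.Adj d.fst d.snd := by
        by_contra hn; simp [hρ.zero, hn] at hb
      have hdeg : μ 6 (N.vtx d.snd) + 1 < w := by
        rw [hμ.inDegrees d.snd]
        have h1 : {e : G.graph.Dart | D.Adj e.fst e.snd ∧ e.snd = d.snd ∧
            e ∈ {e : G.graph.Dart | (N.dart e : ℕ) < N.dart d}}.ncard ≤ Nat.card G.graph.Dart := by
          exact (Set.ncard_le_ncard (Set.subset_univ _) (Set.toFinite _)).trans_eq
            (Set.ncard_univ _)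
        omega
      refine awp_seq (awp_ld (N.dart d) (N.vtx d.snd) (by simp [h9])
        (dart_lt_size N _ (by norm_num)) (hμ.static.head d) (by omega) ?_)
      refine awp_seq (awp_ld (N.vtx d.snd) _ (by simp) (vtx_lt_size N _ (by norm_num)) rfl
        (by omega) ?_)
      refine awp_seq (awp_add (μ 6 (N.vtx d.snd) + 1) (by simp [hρ.one]) hdeg (by omega) ?_)
      refine awp_seq (awp_sto (N.vtx d.snd) (μ 6 (N.vtx d.snd) + 1) (by simp)
        (vtx_lt_size N _ (by norm_num)) (by simp) (by omega) ?_)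
      have hst1 := hμ.static.upd (a := 6) (N.vtx d.snd) (μ 6 (N.vtx d.snd) + 1) (by norm_num)
      refine awp_seq (awp_ld (N.dart d) (N.dart (G.rot.cw d)) (by simp [h9])
        (dart_lt_size N _ (by norm_num)) (hst1.next d) (by omega) ?_)
      refine awp_seq (awp_ld (N.dart (G.rot.cw d)) _ (by simp)
        (dart_lt_size N _ (by norm_num)) (hst1.bit _) (by omega) ?_)
      have hin : InDegrees D N {e | (N.dart e : ℕ) < N.dart d + 1}
          (upd μ 6 (N.vtx d.snd) (μ 6 (N.vtx d.snd) + 1)) := by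
        rw [dart_lt_succ rfl]
        exact hμ.inDegrees.extend hnot hbit
      refine awp_ite (by omega) (fun hb2 => ?_) (fun hb2 => ?_)
      · have hbit2 : D.Adj (G.rot.cw d).fst (G.rot.cw d).snd := by
          by_contra hn; simp [hρ.zero, hn] at hb2
        refine awp_const (by omega) (by omega) ⟨?_, ⟨hst1, hin, fun x => ?_,
          fun a ha ha' i hi => ?_⟩,
          by simp [h9], by omega⟩
        · exact ((((((hρ.update _ _ (by norm_num)).update _ _ (by norm_num)).update _ _
            (by norm_num)).update _ _ (by norm_num)).update _ _ (by norm_num)).update _ _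
            (by norm_num)).update _ _ (by norm_num)
        · obtain ⟨d₀, h1, h2, h3⟩ := hμ.start x
          refine ⟨d₀, h1, by rw [upd_array_ne _ _ _ (by norm_num), h2], ?_⟩
          rintro ⟨e, he1, he2, he3, he4⟩
          by_cases hed : e = d
          · subst hed; exact absurd hbit2 he3
          · refine h3 ⟨e, he1, he2, he3, ?_⟩
            have : (N.dart e : ℕ) ≠ N.dart d := fun h4 => hed (N.dart.injective (Fin.ext h4))
            omega
        · rw [upd_array_ne _ _ _ (by omega)]; exact hμ.zero a ha ha' i hi
      · have hbit2 : ¬ D.Adj (G.rot.cw d).fst (G.rot.cw d).snd := by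
          intro hn; simp [hρ.zero, hn] at hb2
        refine awp_seq (awp_ld (N.dart d) (N.vtx d.fst) (by simp [h9])
          (dart_lt_size N _ (by norm_num)) (hst1.tail d) (by omega) ?_)
        refine awp_sto (N.vtx d.fst) (N.dart (G.rot.cw d)) (by simp)
          (vtx_lt_size N _ (by norm_num)) (by simp) (by omega)
          ⟨?_, ⟨hst1.upd _ _ (by norm_num), fun y => ?_, fun x => ?_, fun a ha ha' i hi => ?_⟩,
          by simp [h9], by omega⟩
        · exact ((((((hρ.update _ _ (by norm_num)).update _ _ (by norm_num)).update _ _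
            (by norm_num)).update _ _ (by norm_num)).update _ _ (by norm_num)).update _ _
            (by norm_num)).update _ _ (by norm_num)
        · rw [upd_array_ne _ _ _ (by norm_num)]; exact hin y
        · by_cases hx : x = d.fst
          · subst hx
            exact ⟨G.rot.cw d, G.rot.fst_cw d, upd_same _ _ _ _,
              fun _ => hW.st_unique d hbit hbit2⟩
          · obtain ⟨d₀, h1, h2, h3⟩ := hμ.start x
            refine ⟨d₀, h1, by rw [upd_index_ne _ _ _ (vtx_ne hx),
              upd_array_ne _ _ _ (by norm_num), h2], ?_⟩
            rintro ⟨e, he1, he2, he3, he4⟩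
            refine h3 ⟨e, he1, he2, he3, ?_⟩
            have : (N.dart e : ℕ) ≠ N.dart d := fun h4 => by
              rw [N.dart.injective (Fin.ext h4)] at he1
              exact hx he1.symm
            omega
        · rw [upd_array_ne _ _ _ (by omega), upd_array_ne _ _ _ (by omega)]
          exact hμ.zero a ha ha' i hi
    · have hbit : ¬ D.Adj d.fst d.snd := by
        intro hn; simp [hρ.zero, hn] at hb
      refine awp_const (by omega) (by omega) ⟨?_, ⟨hμ.static, ?_, fun x => ?_, hμ.zero⟩,
        by simp [h9], by omega⟩
      · exact (hρ.update _ _ (by norm_num)).update _ _ (by norm_num)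
      · rw [dart_lt_succ rfl]; exact hμ.inDegrees.extend_of_not hbit
      · obtain ⟨d₀, h1, h2, h3⟩ := hμ.start x
        refine ⟨d₀, h1, h2, ?_⟩
        rintro ⟨e, he1, he2, he3, he4⟩
        by_cases hed : e = d
        · subst hed; exact absurd he2 hbit
        · refine h3 ⟨e, he1, he2, he3, ?_⟩
          have : (N.dart e : ℕ) ≠ N.dart d := fun h4 => hed (N.dart.injective (Fin.ext h4))
          omega
  · rintro ρ' μ' T' ⟨h1, h2, h3, h4⟩
    exact awp_add (N.dart d + 1) (by simp [h3, h1.one]) (by omega) (by omega)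
      ⟨h1.update _ _ (by norm_num), h2, by simp, by omega⟩

/-- The arrays when the queue has been initialized. -/
structure Prepared (G : PlaneGraph V) (b : G.graph.Dart) (D : Digraph V)
    (N : GraphNumbering G.graph) (st : V → G.graph.Dart) (μ : ℕ → ℕ → ℕ) : Prop where
  static : Static G D N μ
  inDegrees : InDegrees D N Set.univ μ
  start : ∀ x, ∃ d₀ : G.graph.Dart, d₀.fst = x ∧ μ 5 (N.vtx x) = N.dart d₀ ∧
    (x ≠ b.snd → d₀ = st x)
  queue : μ 7 0 = N.vtx b.snd
  zero : ∀ a, 8 ≤ a → a < 12 → ∀ i < Nat.card V, μ a i = 0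

/-- At `z` no outgoing dart announces the start, so it is stored separately from register `8`. Each
dart costs `20` units and one loop test. -/
theorem awp_prepare (hW : G.WalkSpec b z D Γ X Y st par rk) (hρ : Regs G b z N ρ)
    (hμ : Counted G D N st 0 μ) (hw : 10 * Nat.card V ≤ w)
    (hm : Nat.card G.graph.Dart ≤ 6 * Nat.card V) (hT : 21 * Nat.card G.graph.Dart + 8 ≤ T) :
    AWP (Nat.card V) (Nat.card G.graph.Dart) w prepare
      (fun ρ' μ' T' => Regs G b z N ρ' ∧ Prepared G b D N st μ' ∧ ρ' 9 = 0 ∧ ρ' 10 = 1 ∧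
        T ≤ T' + 21 * Nat.card G.graph.Dart + 8) ρ μ T := by
  have hcardV : 0 < Nat.card V := by
    have := (N.vtx b.fst).2; omega
  refine awp_seq (awp_const (by omega) (by omega) ?_)
  refine awp_seq (awp_loop (fun ρ' μ' T' => Regs G b z N ρ' ∧ Counted G D N st (ρ' 9) μ' ∧
    ρ' 9 ≤ Nat.card G.graph.Dart ∧ T ≤ T' + 1 + 21 * ρ' 9) ?_ ?_)
  · exact ⟨hρ.update _ _ (by norm_num), by simpa using hμ, by simp, by simp; omega⟩
  · rintro ρ' μ' T' ⟨h1, h2, h3, h4⟩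
    refine ⟨by omega, fun hlt => ?_, fun hge => ?_⟩
    · rw [h1.dart] at hlt
      obtain ⟨d, hd⟩ : ∃ d, (N.dart d : ℕ) = ρ' 9 := ⟨N.dart.symm ⟨ρ' 9, hlt⟩, by simp⟩
      have := awp_countDart (T := T' - 1) hW h1 (hd ▸ h2) hd.symm hw hm (by omega)
      refine this.mono ?_
      rintro ρ'' μ'' T'' ⟨e1, e2, e3, e4⟩
      exact ⟨e1, by rw [e3]; exact e2, by omega, by omega⟩
    · rw [h1.dart] at hge
      have h9 : ρ' 9 = Nat.card G.graph.Dart := by omega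
      rw [h9] at h2
      refine awp_seq (awp_sto (N.vtx z) (N.dart (G.rot.face (G.rot.face b))) h1.last
        (vtx_lt_size N _ (by norm_num)) h1.start (by omega) ?_)
      refine awp_seq (awp_const (by omega) (by omega) ?_)
      refine awp_seq (awp_sto 0 (N.vtx b.snd) (by simp) (by simpa [size] using hcardV)
        (by simp [h1.first]) (by omega) ?_)
      refine awp_move 1 (by simp [h1.one]) (by omega)
        ⟨(h1.update _ _ (by norm_num)).update _ _ (by norm_num), ⟨?_, fun y => ?_, fun x => ?_, ?_,
        fun a ha ha' i hi => ?_⟩, by simp, by simp, by omega⟩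
      · exact (h2.static.upd _ _ (by norm_num)).upd _ _ (by norm_num)
      · rw [upd_array_ne _ _ _ (by norm_num), upd_array_ne _ _ _ (by norm_num)]
        have h5 := h2.inDegrees
        rw [show {d | (N.dart d : ℕ) < Nat.card G.graph.Dart} = Set.univ by
          ext d; simp] at h5
        exact h5 y
      · rw [upd_array_ne _ _ _ (by norm_num)]
        by_cases hx : x = z
        · subst hx
          refine ⟨_, ?_, upd_same _ _ _ _, fun _ => hW.st_last.symm⟩
          rw [PlaneGraph.Canon.fst_face, ← hW.last]
        · obtain ⟨d₀, e1, e2, e3⟩ := h2.start x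
          refine ⟨d₀, e1, by rw [upd_index_ne _ _ _ (vtx_ne hx), e2], fun hxu => e3 ?_⟩
          obtain ⟨d, f1, f2, f3⟩ := hW.st_exists x hxu hx
          exact ⟨d, f1, f2, f3, (N.dart d).2⟩
      · exact upd_same _ _ _ _
      · rw [upd_array_ne _ _ _ (by omega), upd_array_ne _ _ _ (by omega)]
        exact h2.zero a (by omega) ha' i hi

end RAMLayout

/-! ### Topological sorting by in-degrees -/

namespace RAMLayout

set_option linter.unusedSectionVars false

open RAMProg

variable {V : Type*} {G : PlaneGraph V} {b : G.graph.Dart} {z : V} {D : Digraph V}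
  {Γ : V → ℝ × ℝ} {X Y : V → ℕ} {st : V → G.graph.Dart} {par : V → V} {rk : V → ℕ}
  {N : GraphNumbering G.graph} {ρ ρ' : ℕ → ℕ} {μ μ' : ℕ → ℕ → ℕ} {w T : ℕ}

/-! ### The queue -/

theorem Regs.congr (h : Regs G b z N ρ) (he : ∀ r < 9, ρ' r = ρ r) : Regs G b z N ρ' := by
  constructor <;> rw [he _ (by norm_num)]
  exacts [h.zero, h.one, h.card, h.dart, h.base, h.first, h.second, h.last, h.start]

theorem Static.congr (h : Static G D N μ) (he : ∀ a < 5, μ' a = μ a) : Static G D N μ' := by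
  constructor <;> intro d <;> rw [he _ (by norm_num)]
  exacts [h.tail d, h.head d, h.twin d, h.next d, h.bit d]

/-- When the darts in `R` have been removed, the queue contains the vertices without in-neighbors,
in the order `Q`. -/
structure Queue (G : PlaneGraph V) (D : Digraph V) (N : GraphNumbering G.graph)
    (R : Set G.graph.Dart) (Q : List V) (μ : ℕ → ℕ → ℕ) : Prop where
  nodup : Q.Nodup
  mem : ∀ y, y ∈ Q ↔ ∀ d : G.graph.Dart, D.Adj d.fst d.snd → d.snd = y → d ∈ R
  tail : ∀ d ∈ R, d.fst ∈ Q
  closed : ∀ L y, L ++ [y] <+: Q → ∀ d : G.graph.Dart, D.Adj d.fst d.snd → d.snd = y → d.fst ∈ L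
  entry : ∀ L y, L ++ [y] <+: Q → μ 7 L.length = N.vtx y
  inDegrees : InDegrees D N Rᶜ μ

theorem length_le_card [Finite V] {Q : List V} (hQ : Q.Nodup) : Q.length ≤ Nat.card V := by
  have := Fintype.ofFinite V
  rw [Nat.card_eq_fintype_card]
  exact hQ.length_le_card

variable [Finite V] {R : Set G.graph.Dart} {Q L : List V} {d : G.graph.Dart}

theorem insert_compl (hd : d ∉ R) : insert d (insert d R)ᶜ = Rᶜ := by
  ext e
  simp only [Set.mem_insert_iff, Set.mem_compl_iff]
  constructor
  · rintro (rfl | h)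
    · exact hd
    · tauto
  · intro h; tauto

theorem Queue.congr (h : Queue G D N R Q μ) (h6 : μ' 6 = μ 6) (h7 : μ' 7 = μ 7) :
    Queue G D N R Q μ' :=
  ⟨h.nodup, h.mem, h.tail, h.closed, by rw [h7]; exact h.entry,
    fun y => by rw [h6]; exact h.inDegrees y⟩

theorem Queue.skip (h : Queue G D N R Q μ) (hd : d ∉ R) (hD : ¬ D.Adj d.fst d.snd)
    (ht : d.fst ∈ Q) : Queue G D N (insert d R) Q μ := by
  refine ⟨h.nodup, fun y => ?_, ?_, h.closed, h.entry, fun y => ?_⟩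
  · rw [h.mem]
    refine forall_congr' fun e => forall_congr' fun he => forall_congr' fun _ => ?_
    rw [Set.mem_insert_iff, or_iff_right]
    rintro rfl
    exact hD he
  · rintro e (rfl | he)
    · exact ht
    · exact h.tail e he
  · have h1 := ncard_insert_dart_of_not (d := d) (A := (insert d R)ᶜ)
      (P := fun e : G.graph.Dart => D.Adj e.fst e.snd ∧ e.snd = y) (fun h => hD h.1)
    rw [insert_compl hd] at h1
    simp only [and_assoc] at h1
    rw [h.inDegrees, h1]

theorem Queue.inDegrees_remove (h : Queue G D N R Q μ) (hd : d ∉ R) (hD : D.Adj d.fst d.snd) :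
    InDegrees D N (insert d R)ᶜ (upd μ 6 (N.vtx d.snd) (μ 6 (N.vtx d.snd) - 1)) := by
  intro y
  by_cases hy : y = d.snd
  · subst hy
    have h1 := ncard_insert_dart (d := d) (A := (insert d R)ᶜ)
      (P := fun e : G.graph.Dart => D.Adj e.fst e.snd ∧ e.snd = d.snd) (by simp) ⟨hD, rfl⟩
    rw [insert_compl hd] at h1
    simp only [and_assoc] at h1
    rw [upd_same, h.inDegrees, h1, Nat.add_sub_cancel]
  · have h1 := ncard_insert_dart_of_not (d := d) (A := (insert d R)ᶜ)
      (P := fun e : G.graph.Dart => D.Adj e.fst e.snd ∧ e.snd = y) (fun h => hy h.2.symm)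
    rw [insert_compl hd] at h1
    simp only [and_assoc] at h1
    rw [upd_index_ne _ _ _ (vtx_ne hy), h.inDegrees, h1]

/-- A positive remaining in-degree exhibits an in-dart of the head that has not been removed, so no
vertex joins the queue. -/
theorem Queue.remove (h : Queue G D N R Q μ) (hd : d ∉ R) (hD : D.Adj d.fst d.snd)
    (ht : d.fst ∈ Q) (hpos : 0 < μ 6 (N.vtx d.snd) - 1) :
    Queue G D N (insert d R) Q (upd μ 6 (N.vtx d.snd) (μ 6 (N.vtx d.snd) - 1)) := by
  have : Finite G.graph.Dart := PlaneGraph.finite_dart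
  have hdeg := h.inDegrees_remove hd hD
  refine ⟨h.nodup, fun y => ?_, ?_, h.closed, ?_, hdeg⟩
  · rw [h.mem]
    refine ⟨fun h1 e he hey => Or.inr (h1 e he hey), fun h1 e he hey => ?_⟩
    rcases h1 e he hey with rfl | h2
    · exfalso
      have h3 := hdeg e.snd
      rw [upd_same] at h3
      rw [h3, Set.ncard_pos (Set.toFinite _)] at hpos
      obtain ⟨f, h4, h5, h6⟩ := hpos
      exact h6 (h1 f h4 (h5.trans hey))
    · exact h2
  · rintro e (rfl | he)
    · exact ht
    · exact h.tail e he
  · rw [upd_array_ne _ _ _ (by norm_num)]; exact h.entry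

/-- The last in-dart of its head is removed, so all in-neighbors of the head are in the queue before
it. The length bound holds because the extended queue has no repetitions. -/
theorem Queue.push (h : Queue G D N R Q μ) (hd : d ∉ R) (hD : D.Adj d.fst d.snd)
    (ht : d.fst ∈ Q) (hzero : μ 6 (N.vtx d.snd) - 1 = 0) :
    Q.length < Nat.card V ∧
    Queue G D N (insert d R) (Q ++ [d.snd])
      (upd (upd μ 6 (N.vtx d.snd) (μ 6 (N.vtx d.snd) - 1)) 7 Q.length (N.vtx d.snd)) := by
  have : Finite G.graph.Dart := PlaneGraph.finite_dart
  have hdeg := h.inDegrees_remove hd hD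
  have hnot : d.snd ∉ Q := fun h1 => hd ((h.mem _).1 h1 d hD rfl)
  have hall : ∀ e : G.graph.Dart, D.Adj e.fst e.snd → e.snd = d.snd → e ∈ insert d R := by
    intro e he hed
    by_contra hn
    have h3 := hdeg d.snd
    rw [upd_same, hzero, eq_comm, Set.ncard_eq_zero (Set.toFinite _)] at h3
    have : e ∈ {e : G.graph.Dart | D.Adj e.fst e.snd ∧ e.snd = d.snd ∧ e ∈ (insert d R)ᶜ} :=
      ⟨he, hed, hn⟩
    rw [h3] at this
    exact this
  have hnd : (Q ++ [d.snd]).Nodup := by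
    rw [List.nodup_append]
    exact ⟨h.nodup, List.nodup_singleton _, fun a ha c hc => by
      rw [List.mem_singleton] at hc; rintro rfl; exact hnot (hc ▸ ha)⟩
  have htail : ∀ e ∈ insert d R, e.fst ∈ Q := by
    rintro e (rfl | he)
    · exact ht
    · exact h.tail e he
  refine ⟨?_, hnd, fun y => ?_, fun e he => List.mem_append_left _ (htail e he), ?_, ?_, ?_⟩
  · have := length_le_card hnd
    simpa using this
  · rw [List.mem_append, List.mem_singleton]
    constructor
    · rintro (h1 | rfl)
      · exact fun e he hey => Or.inr ((h.mem _).1 h1 e he hey)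
      · exact hall
    · intro h1
      by_cases hy : y = d.snd
      · exact Or.inr hy
      · refine Or.inl ((h.mem _).2 fun e he hey => ?_)
        rcases h1 e he hey with rfl | h2
        · exact absurd hey.symm hy
        · exact h2
  · intro L y hL e he hey
    rw [List.prefix_concat_iff] at hL
    rcases hL with hL | hL
    · obtain ⟨rfl, h2⟩ := List.append_inj' hL rfl
      rw [List.singleton_inj] at h2
      exact htail e (hall e he (hey.trans h2))
    · exact h.closed L y hL e he hey
  · intro L y hL
    rw [List.prefix_concat_iff] at hL
    rcases hL with hL | hL
    · obtain ⟨rfl, h2⟩ := List.append_inj' hL rfl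
      rw [List.singleton_inj] at h2
      rw [upd_same, h2]
    · have h1 := hL.length_le
      rw [List.length_append, List.length_singleton] at h1
      rw [upd_index_ne _ _ _ (by omega), upd_array_ne _ _ _ (by norm_num), h.entry L y hL]
  · intro y
    rw [upd_array_ne _ _ _ (by norm_num)]
    exact hdeg y

theorem awp_relax (hρ : Regs G b z N ρ) (hμ : Queue G D N R Q μ) (hd : d ∉ R) (ht : d.fst ∈ Q)
    (h19 : 0 < ρ 19 ↔ D.Adj d.fst d.snd) (h17 : ρ 17 = N.vtx d.snd) (h10 : ρ 10 = Q.length)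
    (hw : 20 * Nat.card V ≤ w) (hT : 10 ≤ T) :
    AWP (Nat.card V) (Nat.card G.graph.Dart) w relax
      (fun ρ' μ' T' => ∃ Q', Q <+: Q' ∧ Queue G D N (insert d R) Q' μ' ∧ ρ' 10 = Q'.length ∧
        (∀ r < 19, r ≠ 10 → ρ' r = ρ r) ∧ (∀ a, a ≠ 6 → a ≠ 7 → μ' a = μ a) ∧ T ≤ T' + 10)
      ρ μ T := by
  have hcard : 0 < Nat.card V := by have := (N.vtx z).2; omega
  refine awp_ite (by omega) (fun hb => ?_) (fun hb => ?_)
  · have hD : D.Adj d.fst d.snd := h19.1 (by rwa [hρ.zero] at hb)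
    refine awp_seq (awp_ld (N.vtx d.snd) _ h17 (vtx_lt_size N _ (by norm_num)) rfl (by omega) ?_)
    refine awp_seq (awp_sub (μ 6 (N.vtx d.snd) - 1) (by simp [hρ.one]) (by omega) ?_)
    refine awp_seq (awp_sto (N.vtx d.snd) (μ 6 (N.vtx d.snd) - 1) (by simp [h17])
      (vtx_lt_size N _ (by norm_num)) (by simp) (by omega) ?_)
    refine awp_ite (by omega) (fun hb2 => ?_) (fun hb2 => ?_)
    · refine awp_const (by omega) (by omega) ⟨Q, List.prefix_rfl, hμ.remove hd hD ht ?_, ?_, ?_, ?_,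
        by omega⟩
      · simpa [hρ.zero] using hb2
      · simpa using h10
      · intro r hr _
        rw [Function.update_of_ne (by omega), Function.update_of_ne (by omega),
          Function.update_of_ne (by omega)]
      · intro a h6 h7
        rw [upd_array_ne _ _ _ h6]
    · have hzero : μ 6 (N.vtx d.snd) - 1 = 0 := by
        simp [hρ.zero] at hb2; omega
      obtain ⟨hlt, hq⟩ := hμ.push hd hD ht hzero
      refine awp_seq (awp_sto Q.length (N.vtx d.snd) (by simp [h10]) (by simpa [size] using hlt)
        (by simp [h17]) (by omega) ?_)
      refine awp_add (Q.length + 1) (by simp [h10, hρ.one]) (by omega) (by omega)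
        ⟨Q ++ [d.snd], List.prefix_append _ _, hq, by simp, ?_, ?_, by omega⟩
      · intro r hr h10
        rw [Function.update_of_ne (by omega), Function.update_of_ne (by omega),
          Function.update_of_ne (by omega)]
      · intro a h6 h7
        rw [upd_array_ne _ _ _ h7, upd_array_ne _ _ _ h6]
  · have hD : ¬ D.Adj d.fst d.snd := fun h => hb (by rw [hρ.zero]; exact h19.2 h)
    refine awp_const (by omega) (by omega) ⟨Q, List.prefix_rfl, hμ.skip hd hD ht, ?_, ?_,
      fun _ _ _ => rfl, by omega⟩
    · simpa using h10
    · intro r hr _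
      rw [Function.update_of_ne (by omega)]

end RAMLayout

/-! ### Walking around one vertex -/

namespace RAMLayout

set_option linter.unusedSectionVars false

open RAMProg

variable {V : Type*} {G : PlaneGraph V} {b : G.graph.Dart} {z : V} {D : Digraph V}
  {Γ : V → ℝ × ℝ} {X Y : V → ℕ} {st : V → G.graph.Dart} {par : V → V} {rk : V → ℕ}
  {N : GraphNumbering G.graph} {ρ ρ' : ℕ → ℕ} {μ μ' : ℕ → ℕ → ℕ} {w T : ℕ}

/-! ### The walks -/

/-- The arrays other than the queue and the in-degrees, when the vertices in `L` have been
visited. -/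
structure Frame (G : PlaneGraph V) (b : G.graph.Dart) (z : V) (D : Digraph V)
    (X Y : V → ℕ) (st : V → G.graph.Dart) (par : V → V) (N : GraphNumbering G.graph)
    (L : List V) (μ : ℕ → ℕ → ℕ) : Prop where
  static : Static G D N μ
  start : ∀ x, ∃ d₀ : G.graph.Dart, d₀.fst = x ∧ μ 5 (N.vtx x) = N.dart d₀ ∧
    (x ≠ b.snd → d₀ = st x)
  height : ∀ y ∈ L, μ 8 (N.vtx y) = Y y
  unvisited : ∀ y, y ∉ L → μ 8 (N.vtx y) = 0
  cover : ∀ y, y ≠ b.snd → y ≠ b.fst → y ≠ z → par y ∈ L →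
    μ 9 (N.vtx y) = N.vtx (par y) ∧ X y + μ 10 (N.vtx y) = X (par y) + Y (par y)
  par_lt : ∀ y, μ 9 (N.vtx y) < Nat.card V
  zero : ∀ i < Nat.card V, μ 11 i = 0

theorem Frame.congr {L : List V} (h : Frame G b z D X Y st par N L μ)
    (he : ∀ a, a ≠ 6 → a ≠ 7 → μ' a = μ a) : Frame G b z D X Y st par N L μ' := by
  refine ⟨h.static.congr fun a ha => he a (by omega) (by omega), ?_, ?_, ?_, ?_, ?_, ?_⟩
  · rw [he 5 (by norm_num) (by norm_num)]; exact h.start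
  · rw [he 8 (by norm_num) (by norm_num)]; exact h.height
  · rw [he 8 (by norm_num) (by norm_num)]; exact h.unvisited
  · rw [he 9 (by norm_num) (by norm_num), he 10 (by norm_num) (by norm_num)]; exact h.cover
  · rw [he 9 (by norm_num) (by norm_num)]; exact h.par_lt
  · rw [he 11 (by norm_num) (by norm_num)]; exact h.zero

/-- The darts at vertices in `L` and the first `j` darts of the walk that starts with `d₀`. -/
def removed (L : List V) (d₀ : G.graph.Dart) (j : ℕ) : Set G.graph.Dart :=
  {d | d.fst ∈ L ∨ ∃ i < j, d = (G.rot.cw ^ i) d₀}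

theorem removed_zero (L : List V) (d₀ : G.graph.Dart) : removed L d₀ 0 = {d | d.fst ∈ L} := by
  ext d; simp [removed]

theorem removed_succ (L : List V) (d₀ : G.graph.Dart) (j : ℕ) :
    removed L d₀ (j + 1) = insert ((G.rot.cw ^ j) d₀) (removed L d₀ j) := by
  ext d
  simp only [removed, Set.mem_ofPred_eq, Set.mem_insert_iff]
  constructor
  · rintro (h | ⟨i, hi, h⟩)
    · exact Or.inr (Or.inl h)
    · rcases Nat.lt_succ_iff_lt_or_eq.1 hi with h1 | rfl
      · exact Or.inr (Or.inr ⟨i, h1, h⟩)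
      · exact Or.inl h
  · rintro (h | h | ⟨i, hi, h⟩)
    · exact Or.inr ⟨j, by omega, h⟩
    · exact Or.inl h
    · exact Or.inr ⟨i, by omega, h⟩

variable [Finite V] {Q L : List V} {d d₀ : G.graph.Dart} {x : V} {j : ℕ}

theorem removed_period (L : List V) (d₀ : G.graph.Dart) :
    removed L d₀ (G.period d₀) = {d | d.fst ∈ L ++ [d₀.fst]} := by
  ext d
  simp only [removed, Set.mem_ofPred_eq, List.mem_append, List.mem_singleton]
  refine or_congr Iff.rfl ⟨?_, fun h => ?_⟩
  · rintro ⟨i, -, rfl⟩; exact PlaneGraph.fst_cw_pow _ _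
  · obtain ⟨i, hi⟩ := PlaneGraph.exists_cw_pow h.symm
    refine ⟨(i + 1) % G.period d₀, Nat.mod_lt _ (PlaneGraph.Canon.period_pos d₀), ?_⟩
    rw [← hi, ← Equiv.Perm.iterate_eq_pow, ← Equiv.Perm.iterate_eq_pow]
    exact (Function.iterate_mod_minimalPeriod_eq).symm

theorem notMem_removed (hx : d₀.fst ∉ L) (hj : j < G.period d₀) :
    (G.rot.cw ^ j) d₀ ∉ removed L d₀ j := by
  rintro (h | ⟨i, hi, h⟩)
  · rw [PlaneGraph.fst_cw_pow] at h; exact hx h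
  · have := PlaneGraph.Canon.cw_pow_inj hj (hi.trans hj) h
    omega

/-- The state when `j` steps of the walk have been made. -/
structure Walking (G : PlaneGraph V) (b : G.graph.Dart) (z : V) (D : Digraph V)
    (X Y : V → ℕ) (st : V → G.graph.Dart) (par : V → V) (N : GraphNumbering G.graph)
    (L : List V) (d₀ : G.graph.Dart) (j : ℕ) (Q : List V) (ρ : ℕ → ℕ) (μ : ℕ → ℕ → ℕ) :
    Prop where
  regs : Regs G b z N ρ
  le : j ≤ G.period d₀
  r9 : ρ 9 = L.length
  r10 : ρ 10 = Q.length
  r11 : ρ 11 = N.vtx d₀.fst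
  r12 : ρ 12 = N.dart d₀
  r13 : ρ 13 = N.dart ((G.rot.cw ^ j) d₀)
  r14 : ρ 14 = 1 + walkSum (G.walkHeights D Y d₀) j
  r15 : ρ 15 = walkPrev (G.walkHeights D Y d₀) j
  r16 : 0 < ρ 16 ↔ j < G.period d₀
  pre : L ++ [d₀.fst] <+: Q
  queue : Queue G D N (removed L d₀ j) Q μ
  frame : Frame G b z D X Y st par N L μ
  written : ∀ i < j, μ 9 (N.vtx ((G.rot.cw ^ i) d₀).snd) = N.vtx d₀.fst ∧
    μ 10 (N.vtx ((G.rot.cw ^ i) d₀).snd) = 1 + walkSum (G.walkHeights D Y d₀) (i + 1)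

/-- Among the out-neighbors of `y` that can be reached from `t`, one of maximal rank must be `par
y`, since `par_max` would otherwise lead to a higher one. -/
theorem reflTransGen_par (hW : G.WalkSpec b z D Γ X Y st par rk) {y t : V} (h1 : y ≠ b.snd)
    (h2 : y ≠ b.fst) (h3 : y ≠ z) (ht : D.Adj y t) : Relation.ReflTransGen D.Adj t (par y) := by
  obtain ⟨t', ⟨h4, h5⟩, h6⟩ := Set.exists_max_image
    {t' | D.Adj y t' ∧ Relation.ReflTransGen D.Adj t t'} rk (Set.toFinite _) ⟨t, ht, .refl⟩
  by_cases he : t' = par y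
  · exact he ▸ h5
  · obtain ⟨t'', h7, h8⟩ := hW.par_max y h1 h2 h3 t' h4 he
    have := h6 t'' ⟨h7, h5.tail h8⟩
    have := hW.rk_lt h8
    omega

theorem Queue.mem_of_adj {R : Set G.graph.Dart} (h : Queue G D N R Q μ)
    (hW : G.WalkSpec b z D Γ X Y st par rk) (hL : L <+: Q) {a c : V} (hc : c ∈ L)
    (hac : D.Adj a c) : a ∈ L := by
  obtain ⟨L₁, L₂, rfl⟩ := List.append_of_mem hc
  have h1 : L₁ ++ [c] <+: Q := by
    refine List.IsPrefix.trans ⟨L₂, by simp⟩ hL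
  exact List.mem_append_left _ (h.closed L₁ c h1 ⟨(a, c), hW.adj hac⟩ hac rfl)

theorem Queue.mem_of_reflTransGen {R : Set G.graph.Dart} (h : Queue G D N R Q μ)
    (hW : G.WalkSpec b z D Γ X Y st par rk) (hL : L <+: Q) {a c : V} (hc : c ∈ L)
    (hac : Relation.ReflTransGen D.Adj a c) : a ∈ L := by
  induction hac using Relation.ReflTransGen.head_induction_on with
  | refl => exact hc
  | head h1 _ ih => exact h.mem_of_adj hW hL ih h1

theorem Walking.notMem (h : Walking G b z D X Y st par N L d₀ j Q ρ μ) : d₀.fst ∉ L := by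
  have := h.pre.sublist.nodup h.queue.nodup
  rw [List.nodup_append] at this
  exact fun h1 => this.2.2 _ h1 _ (List.mem_singleton_self _) rfl

theorem Walking.prefix_queue (h : Walking G b z D X Y st par N L d₀ j Q ρ μ) : L <+: Q :=
  (List.prefix_append _ _).trans h.pre

/-- The vertex that is visited is a neighbor of no vertex whose covering vertex has been visited. -/
theorem Walking.par_notMem (h : Walking G b z D X Y st par N L d₀ j Q ρ μ)
    (hW : G.WalkSpec b z D Γ X Y st par rk) {y : V} (h1 : y ≠ b.snd) (h2 : y ≠ b.fst)
    (h3 : y ≠ z) (hadj : G.graph.Adj d₀.fst y) : par y ∉ L := by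
  intro hp
  refine h.notMem (h.queue.mem_of_reflTransGen hW h.prefix_queue hp ?_)
  -- A directed path leads from the current vertex to `par y`: through `y` if it is an in-neighbor
  -- of `y`, by `reflTransGen_par` if it is an out-neighbor. Prefixes of the queue are closed under
  -- such paths.
  rcases hW.total hadj with h4 | h4
  · exact .head h4 (.single (hW.par_adj y h1 h2 h3))
  · exact reflTransGen_par hW h1 h2 h3 h4

theorem Walking.adj (d₀ : G.graph.Dart) (j : ℕ) :
    G.graph.Adj d₀.fst ((G.rot.cw ^ j) d₀).snd := by
  have := ((G.rot.cw ^ j) d₀).adj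
  rwa [PlaneGraph.fst_cw_pow] at this

/-- The heights that are read during the walk. -/
theorem Walking.height (h : Walking G b z D X Y st par N L d₀ j Q ρ μ)
    (hW : G.WalkSpec b z D Γ X Y st par rk) (i : ℕ) :
    μ 8 (N.vtx ((G.rot.cw ^ i) d₀).snd) = G.walkHeights D Y d₀ i := by
  unfold PlaneGraph.walkHeights
  -- Of the neighbors of the current vertex, exactly the in-neighbors have been visited, so the
  -- table of heights still holds `0` for the others.
  have h1 : ((G.rot.cw ^ i) d₀).snd ∈ L ↔ D.Adj ((G.rot.cw ^ i) d₀).snd d₀.fst := by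
    constructor
    · intro h2
      rcases hW.total (Walking.adj d₀ i) with h3 | h3
      · exact absurd (h.queue.mem_of_adj hW h.prefix_queue h2 h3) h.notMem
      · exact h3
    · intro h2
      exact h.queue.closed L _ h.pre ⟨(_, _), hW.adj h2⟩ h2 rfl
  by_cases h2 : D.Adj ((G.rot.cw ^ i) d₀).snd d₀.fst
  · rw [if_pos h2, h.frame.height _ (h1.2 h2)]
  · rw [if_neg h2, h.frame.unvisited _ (mt h1.1 h2)]

theorem cw_pow_snd_ne {i j : ℕ} (hij : i < j) (hj : j < G.period d₀) :
    ((G.rot.cw ^ i) d₀).snd ≠ ((G.rot.cw ^ j) d₀).snd := by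
  intro h
  have := PlaneGraph.Canon.cw_pow_inj (hij.trans hj) hj (PlaneGraph.dart_ext_iff.2
    ⟨by rw [PlaneGraph.fst_cw_pow, PlaneGraph.fst_cw_pow], h⟩)
  omega

/-- The overwritten entries belong to a vertex whose covering vertex has not been visited before, so
no recorded offset is lost. -/
theorem Walking.frame_upd (h : Walking G b z D X Y st par N L d₀ j Q ρ μ)
    (hW : G.WalkSpec b z D Γ X Y st par rk) (v : ℕ) :
    Frame G b z D X Y st par N L (upd (upd μ 9 (N.vtx ((G.rot.cw ^ j) d₀).snd) (N.vtx d₀.fst)) 10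
      (N.vtx ((G.rot.cw ^ j) d₀).snd) v) := by
  refine ⟨(h.frame.static.upd _ _ (by norm_num)).upd _ _ (by norm_num), fun y => ?_,
    fun y hy => ?_, fun y hy => ?_, fun y h1 h2 h3 h4 => ?_, fun y => ?_, fun i hi => ?_⟩
  · rw [upd_array_ne _ _ _ (by norm_num), upd_array_ne _ _ _ (by norm_num)]
    exact h.frame.start y
  · rw [upd_array_ne _ _ _ (by norm_num), upd_array_ne _ _ _ (by norm_num)]
    exact h.frame.height y hy
  · rw [upd_array_ne _ _ _ (by norm_num), upd_array_ne _ _ _ (by norm_num)]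
    exact h.frame.unvisited y hy
  · have hne : y ≠ ((G.rot.cw ^ j) d₀).snd := by
      rintro rfl
      exact h.par_notMem hW h1 h2 h3 (Walking.adj d₀ j) h4
    rw [upd_array_ne _ _ _ (by norm_num), upd_index_ne _ _ _ (vtx_ne hne),
      upd_index_ne _ _ _ (vtx_ne hne), upd_array_ne _ _ _ (by norm_num)]
    exact h.frame.cover y h1 h2 h3 h4
  · rw [upd_array_ne _ _ _ (by norm_num)]
    by_cases hne : y = ((G.rot.cw ^ j) d₀).snd
    · rw [hne, upd_same]; exact (N.vtx _).2
    · rw [upd_index_ne _ _ _ (vtx_ne hne)]; exact h.frame.par_lt y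
  · rw [upd_array_ne _ _ _ (by norm_num), upd_array_ne _ _ _ (by norm_num)]
    exact h.frame.zero i hi

theorem awp_walkStep (hW : G.WalkSpec b z D Γ X Y st par rk)
    (h : Walking G b z D X Y st par N L d₀ j Q ρ μ) (hj : j < G.period d₀)
    (hd₀ : d₀.fst ≠ b.snd → d₀ = st d₀.fst) (hw : 20 * Nat.card V ≤ w)
    (hm : Nat.card G.graph.Dart ≤ 6 * Nat.card V) (hT : 30 ≤ T) :
    AWP (Nat.card V) (Nat.card G.graph.Dart) w walkStep
      (fun ρ' μ' T' => ∃ Q', Walking G b z D X Y st par N L d₀ (j + 1) Q' ρ' μ' ∧ T ≤ T' + 30)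
      ρ μ T := by
  have hcard : 0 < Nat.card V := by have := (N.vtx z).2; omega
  set e := (G.rot.cw ^ j) d₀ with he
  set g := G.walkHeights D Y d₀ with hg
  have hef : e.fst = d₀.fst := PlaneGraph.fst_cw_pow _ _
  have hrange := hW.walk_le d₀ hd₀ (j + 1) hj
  rw [← hg, walkSum_succ] at hrange
  have hdd : (N.dart (G.rot.cw e) : ℕ) < Nat.card G.graph.Dart := (N.dart _).2
  have hd0 : (N.dart d₀ : ℕ) < Nat.card G.graph.Dart := (N.dart _).2
  have hgj : walkPrev g (j + 1) = g j := rfl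
  rw [hgj] at hrange
  have hp := h.r15
  rw [← hg] at hp
  have h14 := h.r14
  rw [← hg] at h14
  refine awp_seq (awp_ld (N.dart e) (N.vtx e.snd) h.r13 (dart_lt_size N _ (by norm_num))
    (h.frame.static.head e) (by omega) ?_)
  refine awp_seq (awp_ld (N.vtx e.snd) (g j) (by simp) (vtx_lt_size N _ (by norm_num))
    (h.height hW j) (by omega) ?_)
  refine awp_seq (awp_sub (g j - walkPrev g j) (by simp [hp]) (by omega) ?_)
  refine awp_seq (awp_sub (walkPrev g j - g j) (by simp [hp]) (by omega) ?_)
  refine awp_seq (awp_add (adist (g j) (walkPrev g j)) (by simp [adist]) (by omega) (by omega) ?_)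
  refine awp_seq (awp_add (1 + walkSum g (j + 1)) (by rw [walkSum_succ]; simp [h14]; ring)
    (by rw [walkSum_succ]; omega) (by omega) ?_)
  refine awp_seq (awp_move (g j) (by simp) (by omega) ?_)
  refine awp_seq (awp_sto (N.vtx e.snd) (N.vtx d₀.fst) (by simp) (vtx_lt_size N _ (by norm_num))
    (by simp [h.r11]) (by omega) ?_)
  refine awp_seq (awp_sto (N.vtx e.snd) (1 + walkSum g (j + 1)) (by simp)
    (vtx_lt_size N _ (by norm_num)) (by simp) (by omega) ?_)
  have hframe := h.frame_upd hW (1 + walkSum g (j + 1))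
  rw [← he] at hframe
  have hwr : ∀ i < j + 1,
      upd (upd μ 9 (N.vtx e.snd) (N.vtx d₀.fst)) 10 (N.vtx e.snd) (1 + walkSum g (j + 1)) 9
        (N.vtx ((G.rot.cw ^ i) d₀).snd) = N.vtx d₀.fst ∧
      upd (upd μ 9 (N.vtx e.snd) (N.vtx d₀.fst)) 10 (N.vtx e.snd) (1 + walkSum g (j + 1)) 10
        (N.vtx ((G.rot.cw ^ i) d₀).snd) = 1 + walkSum g (i + 1) := by
    intro i hi
    rcases Nat.lt_succ_iff_lt_or_eq.1 hi with h1 | rfl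
    · have hne := vtx_ne (N := N) (cw_pow_snd_ne h1 hj)
      rw [← he] at hne
      rw [upd_array_ne _ _ _ (by norm_num), upd_index_ne _ _ _ hne, upd_index_ne _ _ _ hne,
        upd_array_ne _ _ _ (by norm_num)]
      exact h.written i h1
    · rw [← he, upd_array_ne _ _ _ (by norm_num), upd_same, upd_same]
      exact ⟨rfl, rfl⟩
  have hq : Queue G D N (removed L d₀ j) Q (upd (upd μ 9 (N.vtx e.snd) (N.vtx d₀.fst)) 10
      (N.vtx e.snd) (1 + walkSum g (j + 1))) := by
    refine h.queue.congr ?_ ?_ <;>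
      rw [upd_array_ne _ _ _ (by norm_num), upd_array_ne _ _ _ (by norm_num)]
  generalize upd (upd μ 9 (N.vtx e.snd) (N.vtx d₀.fst)) 10 (N.vtx e.snd)
    (1 + walkSum g (j + 1)) = μ₁ at hframe hwr hq ⊢
  refine awp_seq (awp_ld (N.dart e) _ (by simp [h.r13, ← he]) (dart_lt_size N _ (by norm_num))
    (hframe.static.bit e) (by omega) ?_)
  refine awp_seq (AWP.mono (awp_relax (b := b) (z := z) (d := e) ?_ hq
    (notMem_removed h.notMem hj) ?_ ?_ (by simp) (by simp [h.r10]) hw (by omega)) ?_)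
  · refine h.regs.congr fun r hr => ?_
    rw [Function.update_of_ne (by omega), Function.update_of_ne (by omega),
      Function.update_of_ne (by omega), Function.update_of_ne (by omega),
      Function.update_of_ne (by omega), Function.update_of_ne (by omega),
      Function.update_of_ne (by omega), Function.update_of_ne (by omega)]
  · rw [hef]; exact h.pre.subset (by simp)
  · by_cases hb : D.Adj e.fst e.snd <;> simp [hb]
  rintro ρ' μ' T' ⟨Q', hQ', hqueue, h10, hreg, harr, hT'⟩
  have hframe' := hframe.congr harr
  have hregs : Regs G b z N ρ' := h.regs.congr fun r hr => by
    rw [hreg r (by omega) (by omega), Function.update_of_ne (by omega),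
      Function.update_of_ne (by omega), Function.update_of_ne (by omega),
      Function.update_of_ne (by omega), Function.update_of_ne (by omega),
      Function.update_of_ne (by omega), Function.update_of_ne (by omega),
      Function.update_of_ne (by omega)]
  have h9 : ρ' 9 = L.length := by rw [hreg 9 (by norm_num) (by norm_num)]; simp [h.r9]
  have h11 : ρ' 11 = N.vtx d₀.fst := by rw [hreg 11 (by norm_num) (by norm_num)]; simp [h.r11]
  have h12 : ρ' 12 = N.dart d₀ := by rw [hreg 12 (by norm_num) (by norm_num)]; simp [h.r12]
  have h13 : ρ' 13 = N.dart e := by rw [hreg 13 (by norm_num) (by norm_num)]; simp [h.r13, ← he]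
  have h14' : ρ' 14 = 1 + walkSum g (j + 1) := by rw [hreg 14 (by norm_num) (by norm_num)]; simp
  have h15 : ρ' 15 = walkPrev g (j + 1) := by
    rw [hreg 15 (by norm_num) (by norm_num)]; simp [hgj]
  have hcw : (G.rot.cw ^ (j + 1)) d₀ = G.rot.cw e := by
    rw [pow_succ', Equiv.Perm.mul_apply]
  refine awp_seq (awp_ld (N.dart e) (N.dart (G.rot.cw e)) h13 (dart_lt_size N _ (by norm_num))
    (hframe'.static.next e) (by omega) ?_)
  refine awp_seq (awp_sub ((N.dart (G.rot.cw e) : ℕ) - N.dart d₀) (by simp [h12]) (by omega) ?_)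
  refine awp_seq (awp_sub ((N.dart d₀ : ℕ) - N.dart (G.rot.cw e)) (by simp [h12]) (by omega) ?_)
  refine awp_add (adist (N.dart (G.rot.cw e)) (N.dart d₀)) (by simp [adist])
    (by unfold adist; omega) (by omega) ⟨Q', ⟨?_, hj, by simp [h9], by simp [h10], by simp [h11],
    by simp [h12], by rw [hcw]; simp, by rw [← hg]; simp [h14'],
    by rw [← hg]; simp [h15], ?_, h.pre.trans hQ', ?_, hframe',
    ?_⟩, by omega⟩
  · exact (((hregs.update _ _ (by norm_num)).update _ _ (by norm_num)).update _ _
      (by norm_num)).update _ _ (by norm_num)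
  -- The distance of the numbers of the next and the first dart is `0` exactly when the walk has
  -- closed.
  · rw [Function.update_self]
    constructor
    · intro h1
      refine lt_of_le_of_ne hj fun h2 => ?_
      rw [← hcw, h2, PlaneGraph.Canon.cw_pow_period] at h1
      simp [adist] at h1
    · intro h1
      by_contra h2
      have h3 : (N.dart (G.rot.cw e) : ℕ) = N.dart d₀ := by unfold adist at h2; omega
      have h4 := N.dart.injective (Fin.ext h3)
      rw [← hcw] at h4
      have := PlaneGraph.Canon.cw_pow_inj h1 (PlaneGraph.Canon.period_pos d₀)
        (h4.trans (by simp))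
      omega
  · rw [removed_succ]; exact hqueue
  · rw [harr 9 (by norm_num) (by norm_num), harr 10 (by norm_num) (by norm_num)]
    exact hwr

end RAMLayout

/-! ### Visiting all vertices -/

namespace RAMLayout

set_option linter.unusedSectionVars false

open RAMProg

variable {V : Type*} {G : PlaneGraph V} {b : G.graph.Dart} {z : V} {D : Digraph V}
  {Γ : V → ℝ × ℝ} {X Y : V → ℕ} {st : V → G.graph.Dart} {par : V → V} {rk : V → ℕ}
  {N : GraphNumbering G.graph} {ρ ρ' : ℕ → ℕ} {μ μ' : ℕ → ℕ → ℕ} {w T : ℕ}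

/-- The state when the vertices in `L` have been visited. -/
structure Visiting (G : PlaneGraph V) (b : G.graph.Dart) (z : V) (D : Digraph V)
    (X Y : V → ℕ) (st : V → G.graph.Dart) (par : V → V) (N : GraphNumbering G.graph)
    (L Q : List V) (ρ : ℕ → ℕ) (μ : ℕ → ℕ → ℕ) : Prop where
  regs : Regs G b z N ρ
  r9 : ρ 9 = L.length
  r10 : ρ 10 = Q.length
  pre : L <+: Q
  queue : Queue G D N {d | d.fst ∈ L} Q μ
  frame : Frame G b z D X Y st par N L μ

variable [Finite V] {Q L : List V} {d₀ : G.graph.Dart}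

/-- The arrays after the end of a walk, when the height of the vertex has been written. -/
theorem Walking.frame_finish (hW : G.WalkSpec b z D Γ X Y st par rk)
    (h : Walking G b z D X Y st par N L d₀ (G.period d₀) Q ρ μ)
    (hd₀ : d₀.fst ≠ b.snd → d₀ = st d₀.fst) {v : ℕ}
    (hv : d₀.fst ≠ b.snd → d₀.fst ≠ b.fst → v = Y d₀.fst) :
    Frame G b z D X Y st par N (L ++ [d₀.fst])
      (upd (upd (upd μ 8 (N.vtx d₀.fst) v) 8 (N.vtx b.snd) 0) 8 (N.vtx b.fst) 0) := by
  set μ₁ := upd (upd (upd μ 8 (N.vtx d₀.fst) v) 8 (N.vtx b.snd) 0) 8 (N.vtx b.fst) 0 with hμ₁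
  have harr : ∀ a, a ≠ 8 → μ₁ a = μ a := fun a ha => by
    rw [hμ₁, upd_array_ne _ _ _ ha, upd_array_ne _ _ _ ha, upd_array_ne _ _ _ ha]
  have hu : μ₁ 8 (N.vtx b.snd) = 0 := by
    rw [hμ₁, upd_index_ne _ _ _ (vtx_ne b.adj.ne'), upd_same]
  have hv0 : μ₁ 8 (N.vtx b.fst) = 0 := upd_same _ _ _ _
  have hx : d₀.fst ≠ b.snd → d₀.fst ≠ b.fst → μ₁ 8 (N.vtx d₀.fst) = Y d₀.fst := fun h1 h2 => by
    rw [hμ₁, upd_index_ne _ _ _ (vtx_ne h2), upd_index_ne _ _ _ (vtx_ne h1), upd_same, hv h1 h2]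
  have hother : ∀ y, y ≠ b.snd → y ≠ b.fst → y ≠ d₀.fst → μ₁ 8 (N.vtx y) = μ 8 (N.vtx y) :=
    fun y h1 h2 h3 => by
      rw [hμ₁, upd_index_ne _ _ _ (vtx_ne h2), upd_index_ne _ _ _ (vtx_ne h1),
        upd_index_ne _ _ _ (vtx_ne h3)]
  refine ⟨h.frame.static.congr fun a ha => harr a (by omega), ?_, ?_, ?_, ?_, ?_, ?_⟩
  · rw [harr 5 (by norm_num)]; exact h.frame.start
  · intro y hy
    by_cases h1 : y = b.snd
    · rw [h1, hu, hW.Y_first]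
    by_cases h2 : y = b.fst
    · rw [h2, hv0, hW.Y_second]
    by_cases h3 : y = d₀.fst
    · rw [h3]; exact hx (h3 ▸ h1) (h3 ▸ h2)
    · rw [hother y h1 h2 h3]
      exact h.frame.height y (by simpa [h3] using hy)
  · intro y hy
    by_cases h1 : y = b.snd
    · rw [h1, hu]
    by_cases h2 : y = b.fst
    · rw [h2, hv0]
    rw [List.mem_append, List.mem_singleton, not_or] at hy
    rw [hother y h1 h2 hy.2, h.frame.unvisited y hy.1]
  · rw [harr 9 (by norm_num), harr 10 (by norm_num)]
    intro y h1 h2 h3 h4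
    rw [List.mem_append, List.mem_singleton] at h4
    rcases h4 with h4 | h4
    · exact h.frame.cover y h1 h2 h3 h4
    -- The vertex just visited covers `y`; the entries of `y` were written at the step of its walk
    -- that met `y`.
    · have hne : par y ≠ b.snd := fun h5 =>
        (hW.source (par y)).2 h5 y (hW.par_adj y h1 h2 h3)
      obtain ⟨i, hi, hi', hX⟩ := hW.cover y h1 h2 h3 hne
      have hst : st (par y) = d₀ := by rw [h4]; exact (hd₀ (h4 ▸ hne)).symm
      rw [hst] at hi hi' hX
      obtain ⟨h6, h7⟩ := h.written i hi
      rw [hi'] at h6 h7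
      rw [h6, h7, h4]
      rw [h4] at hX
      exact ⟨rfl, by omega⟩
  · rw [harr 9 (by norm_num)]; exact h.frame.par_lt
  · rw [harr 11 (by norm_num)]; exact h.frame.zero

/-- Time is charged to darts: `30` units and one loop test for each dart at the visited vertex, and
`19` for the rest of the visit. -/
theorem awp_visit (hW : G.WalkSpec b z D Γ X Y st par rk)
    (h : Visiting G b z D X Y st par N L Q ρ μ) (hlt : L.length < Q.length)
    (hw : 20 * Nat.card V ≤ w) (hm : Nat.card G.graph.Dart ≤ 6 * Nat.card V)
    (hT : 31 * Nat.card G.graph.Dart + 19 ≤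
      T + 31 * {d : G.graph.Dart | d.fst ∈ L}.ncard) :
    AWP (Nat.card V) (Nat.card G.graph.Dart) w visit
      (fun ρ' μ' T' => ∃ x Q', Visiting G b z D X Y st par N (L ++ [x]) Q' ρ' μ' ∧
        T + 31 * {d : G.graph.Dart | d.fst ∈ L}.ncard ≤
          T' + 31 * {d : G.graph.Dart | d.fst ∈ L ++ [x]}.ncard + 19) ρ μ T := by
  have : Finite G.graph.Dart := PlaneGraph.finite_dart
  have hcard : 0 < Nat.card V := by have := (N.vtx z).2; omega
  have hle : ∀ A : Set G.graph.Dart, A.ncard ≤ Nat.card G.graph.Dart := fun A =>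
    (Set.ncard_le_ncard (Set.subset_univ _) (Set.toFinite _)).trans_eq (Set.ncard_univ _)
  obtain ⟨x, hx⟩ : ∃ x, L ++ [x] <+: Q := by
    obtain ⟨L', rfl⟩ := h.pre
    cases L' with
    | nil => simp at hlt
    | cons x L' => exact ⟨x, L', by simp⟩
  have hQn := length_le_card h.queue.nodup
  obtain ⟨d₀, rfl, hstart, hd₀⟩ := h.frame.start x
  have hpos := PlaneGraph.Canon.period_pos d₀
  have h1 := hle {d : G.graph.Dart | d.fst ∈ L}
  refine awp_seq (awp_ld L.length (N.vtx d₀.fst) h.r9 (by rw [size, if_neg (by norm_num)]; omega)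
    (h.queue.entry L _ hx) (by omega) ?_)
  refine awp_seq (awp_ld (N.vtx d₀.fst) (N.dart d₀) (by simp) (vtx_lt_size N _ (by norm_num))
    hstart (by omega) ?_)
  refine awp_seq (awp_move (N.dart d₀) (by simp) (by omega) ?_)
  refine awp_seq (awp_move 1 (by simp [h.regs.one]) (by omega) ?_)
  refine awp_seq (awp_const (by omega) (by omega) ?_)
  refine awp_seq (awp_move 1 (by simp [h.regs.one]) (by omega) ?_)
  refine awp_seq (awp_loop (fun ρ' μ' T' => ∃ j Q', Walking G b z D X Y st par N L d₀ j Q' ρ' μ' ∧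
    T + 31 * {d : G.graph.Dart | d.fst ∈ L}.ncard ≤
      T' + 8 + 31 * (removed L d₀ j).ncard) ⟨0, Q, ⟨?_, Nat.zero_le _, by simp [h.r9],
      by simp [h.r10], by simp, by simp, by simp, by simp [walkSum], by simp [walkPrev],
      by simpa using hpos, hx, ?_, h.frame, by simp⟩, ?_⟩ ?_)
  · refine h.regs.congr fun r hr => ?_
    rw [Function.update_of_ne (by omega), Function.update_of_ne (by omega),
      Function.update_of_ne (by omega), Function.update_of_ne (by omega),
      Function.update_of_ne (by omega), Function.update_of_ne (by omega)]
  · rw [removed_zero]; exact h.queue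
  · rw [removed_zero]; omega
  rintro ρ' μ' T' ⟨j, Q', hj, hT'⟩
  have h2 := hle (removed L d₀ j)
  refine ⟨by omega, fun hb => ?_, fun hb => ?_⟩
  · rw [hj.regs.zero, hj.r16] at hb
    have h3 := hle (removed L d₀ (j + 1))
    have h4 : (removed L d₀ (j + 1)).ncard = (removed L d₀ j).ncard + 1 := by
      rw [removed_succ, Set.ncard_insert_of_notMem (notMem_removed hj.notMem hb) (Set.toFinite _)]
    refine (awp_walkStep hW hj hb hd₀ hw hm (by omega)).mono ?_
    rintro ρ₂ μ₂ T₂ ⟨Q₂, h5, h6⟩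
    exact ⟨j + 1, Q₂, h5, by omega⟩
  · rw [hj.regs.zero, hj.r16] at hb
    obtain rfl : j = G.period d₀ := le_antisymm hj.le (not_lt.1 hb)
    rw [removed_period] at hT' h2
    have h3 := hW.walk_le d₀ hd₀ _ le_rfl
    set g := G.walkHeights D Y d₀ with hg
    have h14 := hj.r14
    have h15 := hj.r15
    rw [← hg] at h14 h15
    refine awp_seq (awp_add (1 + walkSum g (G.period d₀) + walkPrev g (G.period d₀))
      (by rw [h14, h15]) (by omega) (by omega) ?_)
    refine awp_seq (awp_add (1 + walkSum g (G.period d₀) + walkPrev g (G.period d₀) + 1)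
      (by simp [hj.regs.one]) (by omega) (by omega) ?_)
    refine awp_seq (awp_half _ rfl (by omega) ?_)
    refine awp_seq (awp_sto (N.vtx d₀.fst)
      ((1 + walkSum g (G.period d₀) + walkPrev g (G.period d₀) + 1) / 2) (by simp [hj.r11])
      (vtx_lt_size N _ (by norm_num)) (by simp) (by omega) ?_)
    refine awp_seq (awp_sto (N.vtx b.snd) 0 (by simp [hj.regs.first])
      (vtx_lt_size N _ (by norm_num)) (by simp [hj.regs.zero]) (by omega) ?_)
    refine awp_seq (awp_sto (N.vtx b.fst) 0 (by simp [hj.regs.second])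
      (vtx_lt_size N _ (by norm_num)) (by simp [hj.regs.zero]) (by omega) ?_)
    have hlt' : L.length + 1 ≤ Nat.card V := by omega
    refine awp_add (L.length + 1) (by simp [hj.r9, hj.regs.one]) (by omega) (by omega)
      ⟨d₀.fst, Q', ⟨?_, by simp, by simp [hj.r10], hj.pre, ?_, hj.frame_finish hW hd₀ ?_⟩, by omega⟩
    · exact (((hj.regs.update _ _ (by norm_num)).update _ _ (by norm_num)).update _ _
        (by norm_num)).update _ _ (by norm_num)
    · rw [← removed_period]
      refine hj.queue.congr ?_ ?_ <;>
        rw [upd_array_ne _ _ _ (by norm_num), upd_array_ne _ _ _ (by norm_num),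
          upd_array_ne _ _ _ (by norm_num)]
    · intro h5 h6
      have h7 := hW.height d₀.fst h5 h6
      rw [← hd₀ h5, ← hg] at h7
      omega

/-- The state when all vertices have been visited. -/
theorem awp_visits (hW : G.WalkSpec b z D Γ X Y st par rk) (hρ : Regs G b z N ρ)
    (hμ : Prepared G b D N st μ) (h9 : ρ 9 = 0) (h10 : ρ 10 = 1)
    (hw : 20 * Nat.card V ≤ w) (hm : Nat.card G.graph.Dart ≤ 6 * Nat.card V)
    (hT : 31 * Nat.card G.graph.Dart + 20 * Nat.card V + 1 ≤ T) :
    AWP (Nat.card V) (Nat.card G.graph.Dart) w (.loop 9 10 visit)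
      (fun ρ' μ' T' => ∃ Q : List V, Visiting G b z D X Y st par N Q Q ρ' μ' ∧ (∀ x, x ∈ Q) ∧
        T ≤ T' + (31 * Nat.card G.graph.Dart + 20 * Nat.card V + 1)) ρ μ T := by
  have : Finite G.graph.Dart := PlaneGraph.finite_dart
  have hle : ∀ A : Set G.graph.Dart, A.ncard ≤ Nat.card G.graph.Dart := fun A =>
    (Set.ncard_le_ncard (Set.subset_univ _) (Set.toFinite _)).trans_eq (Set.ncard_univ _)
  refine awp_loop (fun ρ' μ' T' => ∃ L Q, Visiting G b z D X Y st par N L Q ρ' μ' ∧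
    T ≤ T' + 31 * {d : G.graph.Dart | d.fst ∈ L}.ncard + 20 * L.length)
    ⟨[], [b.snd], ⟨hρ, h9, h10, ⟨[b.snd], rfl⟩, ⟨List.nodup_singleton _, fun y => ?_, by simp,
      ?_, ?_, ?_⟩, ⟨hμ.static, hμ.start, by simp, fun y _ => ?_, by simp, fun y => ?_, ?_⟩⟩, ?_⟩ ?_
  -- Initially the queue consists of `u`, the only vertex without in-neighbors.
  · rw [List.mem_singleton, ← hW.source]
    constructor
    · rintro h1 d hd rfl; exact absurd hd (h1 _)
    · intro h1 a ha
      have := h1 ⟨(a, y), hW.adj ha⟩ ha rfl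
      simp at this
  · intro L y hL d hd hdy
    have h1 : y = b.snd := List.mem_singleton.1 (hL.subset (by simp))
    exact absurd (hdy ▸ hd) ((hW.source y).2 h1 _)
  · intro L y hL
    have h1 : y = b.snd := List.mem_singleton.1 (hL.subset (by simp))
    have h2 := hL.length_le
    rw [List.length_append, List.length_singleton, List.length_singleton] at h2
    rw [show L.length = 0 by omega, hμ.queue, h1]
  · simpa using hμ.inDegrees
  · exact hμ.zero 8 le_rfl (by norm_num) _ (N.vtx y).2
  · rw [hμ.zero 9 (by norm_num) (by norm_num) _ (N.vtx y).2]
    have := (N.vtx y).2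
    omega
  · exact hμ.zero 11 (by norm_num) (by norm_num)
  · omega
  rintro ρ' μ' T' ⟨L, Q, hL, hT'⟩
  have hQn := length_le_card hL.queue.nodup
  have hLQ := hL.pre.length_le
  have h1 := hle {d : G.graph.Dart | d.fst ∈ L}
  refine ⟨by omega, fun hb => ?_, fun hb => ?_⟩
  · rw [hL.r9, hL.r10] at hb
    refine (awp_visit hW hL hb hw hm (by omega)).mono ?_
    rintro ρ₂ μ₂ T₂ ⟨x, Q₂, h5, h6⟩
    refine ⟨L ++ [x], Q₂, h5, ?_⟩
    rw [List.length_append, List.length_singleton]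
    omega
  · rw [hL.r9, hL.r10] at hb
    obtain rfl : L = Q := hL.pre.eq_of_length (by omega)
    refine ⟨L, hL, ?_, by omega⟩
    -- If the queue missed a vertex, then one of minimal rank; but all its in-neighbors would be in
    -- the queue, hence so would it.
    by_contra! hc
    obtain ⟨x, hx, hmin⟩ := Set.exists_min_image {x | x ∉ L} rk (Set.toFinite _) hc
    refine hx ((hL.queue.mem x).2 fun d hd hdx => ?_)
    by_contra h2
    have h3 := hmin d.fst h2
    have h4 := hW.rk_lt hd
    rw [hdx] at h4
    omega

end RAMLayout

/-! ### The pass that computes the abscissae -/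

namespace RAMLayout

set_option linter.unusedSectionVars false

open RAMProg

variable {V : Type*} {G : PlaneGraph V} {b : G.graph.Dart} {z : V} {D : Digraph V}
  {Γ : V → ℝ × ℝ} {X Y : V → ℕ} {st : V → G.graph.Dart} {par : V → V} {rk : V → ℕ}
  {N : GraphNumbering G.graph} {ρ ρ₀ : ℕ → ℕ} {μ μ₀ : ℕ → ℕ → ℕ} {w T : ℕ}

/-! ### The horizontal positions -/

/-- The horizontal positions of the vertices that are not in `S` have been found; the other arrays
hold `μ₀`. -/
structure Placed (X : V → ℕ) (N : GraphNumbering G.graph) (E : Set V) (μ₀ : ℕ → ℕ → ℕ) (S : Set V)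
    (μ : ℕ → ℕ → ℕ) : Prop where
  arrays : ∀ a, a ≠ 11 → μ a = μ₀ a
  zero : ∀ y ∈ S, y ∉ E → μ 11 (N.vtx y) = 0
  correct : ∀ y, y ∉ S → μ 11 (N.vtx y) = X y

theorem Placed.upd {E S : Set V} (h : Placed X N E μ₀ S μ) (x : V) :
    Placed X N E μ₀ (S \ {x}) (upd μ 11 (N.vtx x) (X x)) := by
  refine ⟨fun a ha => ?_, fun y hy hE => ?_, fun y hy => ?_⟩
  · rw [upd_array_ne _ _ _ ha, h.arrays a ha]
  · rw [upd_index_ne _ _ _ (vtx_ne hy.2)]; exact h.zero y hy.1 hE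
  · by_cases hx : y = x
    · rw [hx, upd_same]
    · rw [upd_index_ne _ _ _ (vtx_ne hx)]
      exact h.correct y fun h1 => hy ⟨h1, hx⟩

/-- This models the meaningless value written for `u`, `v` or `z`: the vertex counts as not placed
until `placeOuter` runs again. -/
theorem Placed.upd_insert {E S : Set V} (h : Placed X N E μ₀ S μ) {x : V} (hx : x ∈ E) (v : ℕ) :
    Placed X N E μ₀ (insert x S) (RAMLayout.upd μ 11 (N.vtx x) v) := by
  refine ⟨fun a ha => ?_, fun y hy hE => ?_, fun y hy => ?_⟩
  · rw [upd_array_ne _ _ _ ha, h.arrays a ha]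
  · have hne : y ≠ x := fun h1 => hE (h1 ▸ hx)
    rw [upd_index_ne _ _ _ (vtx_ne hne)]
    exact h.zero y (hy.resolve_left hne) hE
  · rw [Set.mem_insert_iff, not_or] at hy
    rw [upd_index_ne _ _ _ (vtx_ne hy.1)]
    exact h.correct y hy.2

/-- Valid for every entry, also one that is read through a meaningless covering vertex, so that the
following addition stays within the word size. -/
theorem Placed.le {E S : Set V} (h : Placed X N E μ₀ (S \ E) μ)
    (hX : ∀ x, X x ≤ 2 * Nat.card V) (y : V) : μ 11 (N.vtx y) ≤ 2 * Nat.card V := by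
  by_cases hy : y ∈ S \ E
  · rw [h.zero y hy hy.2]; exact Nat.zero_le _
  · rw [h.correct y hy]; exact hX y

variable [Finite V] {Q L : List V}

theorem awp_placeOuter {S : Set V} {P : (ℕ → ℕ) → (ℕ → ℕ → ℕ) → ℕ → Prop}
    (hW : G.WalkSpec b z D Γ X Y st par rk) (hρ : Regs G b z N ρ)
    (hμ : Placed X N {z, b.snd, b.fst} μ₀ S μ) (hz : μ₀ 8 (N.vtx z) = Y z)
    (hw : 20 * Nat.card V ≤ w) (hT : 9 ≤ T)
    (hP : ∀ ρ' μ', Regs G b z N ρ' → ρ' 9 = ρ 9 →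
      Placed X N {z, b.snd, b.fst} μ₀ (S \ {z, b.snd, b.fst}) μ' →
      P ρ' μ' (T - 9)) :
    AWP (Nat.card V) (Nat.card G.graph.Dart) w placeOuter P ρ μ T := by
  have hcard : 0 < Nat.card V := by have := (N.vtx z).2; omega
  have hYz := hW.Y_le z
  refine awp_seq (awp_ld (N.vtx z) (Y z) hρ.last (vtx_lt_size N _ (by norm_num))
    (by rw [hμ.arrays 8 (by norm_num), hz]) (by omega) ?_)
  refine awp_seq (awp_sto (N.vtx z) (X z) (by simp [hρ.last]) (vtx_lt_size N _ (by norm_num))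
    (by simp [hW.X_last]) (by omega) ?_)
  refine awp_seq (awp_sto (N.vtx b.snd) (X b.snd) (by simp [hρ.first])
    (vtx_lt_size N _ (by norm_num)) (by simp [hW.X_first, hρ.zero]) (by omega) ?_)
  refine awp_seq (awp_add (X b.fst) (by simp [hW.X_second]) (by rw [hW.X_second]; omega)
    (by omega) ?_)
  refine awp_sto (N.vtx b.fst) (X b.fst) (by simp [hρ.second]) (vtx_lt_size N _ (by norm_num))
    (by simp) (by omega) ?_
  have h1 := ((hμ.upd z).upd b.snd).upd b.fst
  have h2 : ((S \ {z}) \ {b.snd}) \ {b.fst} = S \ {z, b.snd, b.fst} := by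
    ext y; simp only [Set.mem_sdiff, Set.mem_insert_iff, Set.mem_singleton_iff]; tauto
  rw [h2] at h1
  rw [show T - 2 - 2 - 2 - 1 - 2 = T - 9 by omega]
  exact hP _ _ ((hρ.update _ _ (by norm_num)).update _ _ (by norm_num)) (by simp) h1

/-- The queue is traversed backwards, and `par y` comes after `y` in it, so the abscissa of `par y`
is known. -/
theorem awp_place (hW : G.WalkSpec b z D Γ X Y st par rk)
    (h₀ : Visiting G b z D X Y st par N Q Q ρ₀ μ₀) (hQ : ∀ x, x ∈ Q) {y : V}
    (hL : L ++ [y] <+: Q) (hρ : Regs G b z N ρ) (h9 : ρ 9 = L.length + 1)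
    (hμ : Placed X N {z, b.snd, b.fst} μ₀ ({x | x ∈ L ++ [y]} \ {z, b.snd, b.fst}) μ)
    (hw : 20 * Nat.card V ≤ w) (hT : 24 ≤ T) :
    AWP (Nat.card V) (Nat.card G.graph.Dart) w place
      (fun ρ' μ' T' => Regs G b z N ρ' ∧ ρ' 9 = L.length ∧
        Placed X N {z, b.snd, b.fst} μ₀ ({x | x ∈ L} \ {z, b.snd, b.fst}) μ' ∧
        T ≤ T' + 24) ρ μ T := by
  have hcard : 0 < Nat.card V := by have := (N.vtx z).2; omega
  have hlen : L.length < Nat.card V := by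
    have h1 := hL.length_le
    have h2 := length_le_card h₀.queue.nodup
    rw [List.length_append, List.length_singleton] at h1
    omega
  -- For `u`, `v` and `z` this need not be a covering vertex, but it is a valid index.
  obtain ⟨p, hp⟩ : ∃ p, μ₀ 9 (N.vtx y) = N.vtx p :=
    ⟨N.vtx.symm ⟨_, h₀.frame.par_lt y⟩, by simp⟩
  have hXp := hμ.le hW.X_le p
  have hYp := hW.Y_le p
  refine awp_seq (awp_sub L.length (by simp [h9, hρ.one]) (by omega) ?_)
  refine awp_seq (awp_ld L.length (N.vtx y) (by simp) (by rw [size, if_neg (by norm_num)]; omega)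
    (by rw [hμ.arrays 7 (by norm_num), h₀.queue.entry L y hL]) (by omega) ?_)
  refine awp_seq (awp_ld (N.vtx y) (N.vtx p) (by simp) (vtx_lt_size N _ (by norm_num))
    (by rw [hμ.arrays 9 (by norm_num), hp]) (by omega) ?_)
  refine awp_seq (awp_ld (N.vtx p) _ (by simp) (vtx_lt_size N _ (by norm_num)) rfl (by omega) ?_)
  refine awp_seq (awp_ld (N.vtx p) (Y p) (by simp) (vtx_lt_size N _ (by norm_num))
    (by rw [hμ.arrays 8 (by norm_num), h₀.frame.height p (hQ p)]) (by omega) ?_)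
  refine awp_seq (awp_add (μ 11 (N.vtx p) + Y p) (by simp) (by omega) (by omega) ?_)
  refine awp_seq (awp_ld (N.vtx y) (μ₀ 10 (N.vtx y)) (by simp) (vtx_lt_size N _ (by norm_num))
    (by rw [hμ.arrays 10 (by norm_num)]) (by omega) ?_)
  refine awp_seq (awp_sub (μ 11 (N.vtx p) + Y p - μ₀ 10 (N.vtx y)) (by simp) (by omega) ?_)
  refine awp_seq (awp_sto (N.vtx y) (μ 11 (N.vtx p) + Y p - μ₀ 10 (N.vtx y)) (by simp)
    (vtx_lt_size N _ (by norm_num)) (by simp) (by omega) ?_)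
  obtain ⟨S, hS, hpl⟩ : ∃ S : Set V, S \ {z, b.snd, b.fst} = {x | x ∈ L} \ {z, b.snd, b.fst} ∧
      Placed X N {z, b.snd, b.fst} μ₀ S
        (upd μ 11 (N.vtx y) (μ 11 (N.vtx p) + Y p - μ₀ 10 (N.vtx y))) := by
    by_cases hy : y ∈ ({z, b.snd, b.fst} : Set V)
    · refine ⟨_, ?_, hμ.upd_insert hy _⟩
      ext t
      simp only [Set.mem_sdiff, Set.mem_insert_iff (x := t) (a := y), Set.mem_ofPred_eq,
        List.mem_append, List.mem_singleton]
      constructor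
      · rintro ⟨rfl | ⟨h1 | rfl, h2⟩, h3⟩
        · exact absurd hy h3
        · exact ⟨h1, h3⟩
        · exact absurd hy h3
      · rintro ⟨h1, h2⟩; exact ⟨Or.inr ⟨Or.inl h1, h2⟩, h2⟩
    · have hy' := hy
      simp only [Set.mem_insert_iff, Set.mem_singleton_iff, not_or] at hy'
      obtain ⟨hyz, hyu, hyv⟩ := hy'
      obtain ⟨h1, h2⟩ := h₀.frame.cover y hyu hyv hyz (hQ _)
      have hpe : p = par y := N.vtx.injective (Fin.ext (hp.symm.trans h1))
      have hnd := hL.sublist.nodup h₀.queue.nodup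
      rw [List.nodup_append] at hnd
      have hyL : y ∉ L := fun h3 => hnd.2.2 _ h3 _ (List.mem_singleton_self _) rfl
      have hadj := hW.par_adj y hyu hyv hyz
      have hpL : p ∉ L ++ [y] := by
        rw [hpe, List.mem_append, List.mem_singleton]
        rintro (h3 | h3)
        · exact hyL (h₀.queue.mem_of_adj hW ((List.prefix_append _ _).trans hL) h3 hadj)
        · have := hW.rk_lt hadj
          rw [h3] at this
          exact lt_irrefl _ this
      have hX : μ 11 (N.vtx p) = X p := hμ.correct p fun h3 => hpL h3.1
      have hval : μ 11 (N.vtx p) + Y p - μ₀ 10 (N.vtx y) = X y := by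
        rw [hX, hpe]; omega
      rw [hval]
      refine ⟨_, ?_, hμ.upd y⟩
      ext t
      simp only [Set.mem_sdiff, Set.mem_singleton_iff (a := t) (b := y), Set.mem_ofPred_eq,
        List.mem_append, List.mem_singleton]
      constructor
      · rintro ⟨⟨⟨h1 | h1, h2⟩, h3⟩, h4⟩
        · exact ⟨h1, h2⟩
        · exact absurd h1 h3
      · rintro ⟨h1, h2⟩; exact ⟨⟨⟨Or.inl h1, h2⟩, fun h3 => hyL (h3 ▸ h1)⟩, h2⟩
  refine awp_placeOuter hW ?_ hpl (h₀.frame.height z (hQ z)) hw (by omega)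
    fun ρ' μ' h1 h2 h3 => ⟨h1, ?_, hS ▸ h3, by omega⟩
  · refine hρ.congr fun r hr => ?_
    repeat rw [Function.update_of_ne (by omega)]
  · rw [h2]; simp

/-- Per dart, `21` units for the preparation and `31` for the walks; per vertex, `20` for its visit
and `25` for its placement, loop tests included. -/
theorem awp_draw (hW : G.WalkSpec b z D Γ X Y st par rk) (hμ : Counted G D N st 0 μ)
    (h0 : ρ 0 = 0) (h1 : ρ 1 = 1) (h2 : ρ 2 = Nat.card V) (h3 : ρ 3 = Nat.card G.graph.Dart)
    (h4 : ρ 4 = N.dart b) (hw : 20 * Nat.card V ≤ w)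
    (hm : Nat.card G.graph.Dart ≤ 6 * Nat.card V)
    (hT : 52 * Nat.card G.graph.Dart + 45 * Nat.card V + 34 ≤ T) :
    AWP (Nat.card V) (Nat.card G.graph.Dart) w draw
      (fun ρ' μ' T' => ρ' 1 = 1 ∧ ρ' 2 = Nat.card V ∧
        (∀ x, μ' 11 (N.vtx x) = X x ∧ μ' 8 (N.vtx x) = Y x) ∧
        T ≤ T' + (52 * Nat.card G.graph.Dart + 45 * Nat.card V + 34)) ρ μ T := by
  refine awp_seq (awp_findOuter hμ.static hW.last h0 h1 h2 h3 h4 (by omega) fun ρ₁ hρ₁ => ?_)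
  refine awp_seq ((awp_prepare hW hρ₁ hμ (by omega) hm (by omega)).mono ?_)
  rintro ρ₂ μ₂ T₂ ⟨hρ₂, hμ₂, h9, h10, hT₂⟩
  refine awp_seq ((awp_visits hW hρ₂ hμ₂ h9 h10 hw hm (by omega)).mono ?_)
  rintro ρ₃ μ₃ T₃ ⟨Q, h₀, hQ, hT₃⟩
  have hlen : Q.length = Nat.card V := by
    have := Fintype.ofFinite V
    classical
    rw [← List.toFinset_card_of_nodup h₀.queue.nodup, Nat.card_eq_fintype_card,
      Finset.card_eq_iff_eq_univ]
    ext x; simp [hQ x]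
  have hpl : Placed X N {z, b.snd, b.fst} μ₃ Set.univ μ₃ :=
    ⟨fun _ _ => rfl, fun y _ _ => h₀.frame.zero _ (N.vtx y).2, by simp⟩
  refine awp_seq (awp_placeOuter hW h₀.regs hpl (h₀.frame.height z (hQ z)) hw (by omega)
    fun ρ₄ μ₄ hρ₄ _ hpl₄ => ?_)
  refine awp_seq (awp_move (Nat.card V) hρ₄.card (by omega) ?_)
  refine awp_loop (fun ρ' μ' T' => ∃ L : List V, L <+: Q ∧ Regs G b z N ρ' ∧ ρ' 9 = L.length ∧
    Placed X N {z, b.snd, b.fst} μ₃ ({x | x ∈ L} \ {z, b.snd, b.fst}) μ' ∧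
    T + 25 * L.length ≤ T' + (52 * Nat.card G.graph.Dart + 45 * Nat.card V + 33))
    ⟨Q, List.prefix_rfl, hρ₄.update _ _ (by norm_num), by simp [hlen], ?_, by omega⟩ ?_
  · convert hpl₄ using 2
    ext x; simp [hQ x]
  rintro ρ' μ' T' ⟨L, hL, hρ', hr9, hpl', hT'⟩
  have hLl := hL.length_le
  refine ⟨by omega, fun hb => ?_, fun hb => ?_⟩
  · rw [hρ'.zero, hr9] at hb
    obtain ⟨L', y, rfl⟩ : ∃ L' y, L = L' ++ [y] :=
      ⟨L.dropLast, L.getLast (List.ne_nil_of_length_pos hb),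
        (List.dropLast_append_getLast _).symm⟩
    rw [List.length_append, List.length_singleton] at hr9 hT' hLl
    refine (awp_place hW h₀ hQ hL hρ' hr9 hpl' hw (by omega)).mono ?_
    rintro ρ₅ μ₅ T₅ ⟨e1, e2, e3, e4⟩
    exact ⟨L', (List.prefix_append _ _).trans hL, e1, e2, e3, by omega⟩
  · rw [hρ'.zero, hr9] at hb
    obtain rfl : L = [] := List.eq_nil_of_length_eq_zero (by omega)
    refine ⟨hρ'.one, hρ'.card, fun x => ⟨hpl'.correct x (by simp), ?_⟩, ?_⟩
    · rw [hpl'.arrays 8 (by norm_num), h₀.frame.height x (hQ x)]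
    · simp only [List.length_nil] at hT'; omega

end RAMLayout

/-! ### Input, output and the total running time -/

namespace RAMProg

variable {w : ℕ} {s : RAMState} {T : ℕ} {Q : RAMState → ℕ → Prop}

theorem wp_const {r c : ℕ} (hc : c < w) (hT : 1 ≤ T)
    (hQ : Q ⟨Function.update s.reg r c, s.mem⟩ (T - 1)) : WP w (.instr (.const r c)) Q s T :=
  wp_instr hc hT hQ

theorem wp_move {r a : ℕ} (v : ℕ) (hv : s.reg a = v) (hvw : v < w) (hT : 1 ≤ T)
    (hQ : Q ⟨Function.update s.reg r v, s.mem⟩ (T - 1)) : WP w (.instr (.move r a)) Q s T := by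
  subst hv; exact wp_instr hvw hT hQ

theorem wp_add {r a b : ℕ} (v : ℕ) (hv : s.reg a + s.reg b = v) (hvw : v < w) (hT : 1 ≤ T)
    (hQ : Q ⟨Function.update s.reg r v, s.mem⟩ (T - 1)) : WP w (.instr (.add r a b)) Q s T := by
  subst hv; exact wp_instr hvw hT hQ

theorem wp_load {r a : ℕ} (v : ℕ) (hv : s.mem (s.reg a) = v) (hvw : v < w) (hT : 1 ≤ T)
    (hQ : Q ⟨Function.update s.reg r v, s.mem⟩ (T - 1)) : WP w (.instr (.load r a)) Q s T := by
  subst hv; exact wp_instr hvw hT hQ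

theorem wp_store {r a : ℕ} (i v : ℕ) (hi : s.reg a = i) (hv : s.reg r = v) (hvw : v < w)
    (hT : 1 ≤ T) (hQ : Q ⟨s.reg, Function.update s.mem i v⟩ (T - 1)) :
    WP w (.instr (.store a r)) Q s T := by
  subst hi hv; exact wp_instr hvw hT hQ

end RAMProg

namespace RAMLayout

set_option linter.unusedSectionVars false

open RAMProg

local infixr:67 ";;" => RAMProg.seq

/-- Read the header of the input. -/
def readSizes : RAMProg :=
  .instr (.const 1 1) ;; .instr (.load 2 0) ;; .instr (.load 3 1) ;; .instr (.add 9 1 1) ;;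
  .instr (.load 4 9) ;; .instr (.add 9 9 1) ;; .instr (.move 50 9)

/-- Compute the addresses of the arrays. -/
def computeBases : RAMProg :=
  .instr (.add 51 50 3) ;; .instr (.add 52 51 3) ;; .instr (.add 53 52 3) ;;
  .instr (.add 54 53 3) ;; .instr (.add 55 54 3) ;; .instr (.add 56 55 2) ;;
  .instr (.add 57 56 2) ;; .instr (.add 58 57 2) ;; .instr (.add 59 58 2) ;;
  .instr (.add 60 59 2) ;; .instr (.add 61 60 2)

/-- Copy the coordinates of one vertex. -/
def copyVertex : RAMProg :=
  .instr (.add 49 61 9) ;; .instr (.load 10 49) ;; .instr (.store 9 10) ;;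
  .instr (.add 49 58 9) ;; .instr (.load 10 49) ;; .instr (.add 49 2 9) ;;
  .instr (.store 49 10) ;; .instr (.add 9 9 1)

/-- Copy the coordinates to the first cells of the memory. -/
def writeOutput : RAMProg := .instr (.const 9 0) ;; .loop 9 2 copyVertex

/-- The program that constructs the drawing. -/
def drawingProgram : RAMProg := readSizes ;; computeBases ;; draw ;; writeOutput

variable {V : Type*} {G : PlaneGraph V} {b : G.graph.Dart} {z : V} {D : Digraph V}
  {Γ : V → ℝ × ℝ} {X Y : V → ℕ} {st : V → G.graph.Dart} {par : V → V} {rk : V → ℕ}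
  {N : GraphNumbering G.graph} {ρ : ℕ → ℕ} {μ : ℕ → ℕ → ℕ} {w T : ℕ} {s : RAMState}

/-- The contents of the registers when the header has been read. -/
def headerRegs (n m k : ℕ) : ℕ → ℕ :=
  fun r => if r = 1 then 1 else if r = 2 then n else if r = 3 then m else if r = 4 then k
    else if r = 9 then 3 else 0

/-- The arrays in a memory. -/
def arraysOf (n m : ℕ) (f : ℕ → ℕ) (a i : ℕ) : ℕ :=
  if a < 12 ∧ i < size n m a then f (base n m a + i) else 0

theorem arraysOf_of_lt {n m a i : ℕ} {f : ℕ → ℕ} (ha : a < 12) (hi : i < size n m a) :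
    arraysOf n m f a i = f (base n m a + i) := if_pos ⟨ha, hi⟩

theorem wp_readSizes {Q : RAMState → ℕ → Prop} {n m k : ℕ} (hreg : ∀ r, s.reg r = 0)
    (h0 : s.mem 0 = n) (h1 : s.mem 1 = m) (h2 : s.mem 2 = k) (hn : n < w) (hm : m < w) (hk : k < w)
    (hw : 3 < w) (hT : 7 ≤ T)
    (hQ : ∀ reg : ℕ → ℕ, (∀ r < 40, reg r = headerRegs n m k r) → reg 50 = 3 →
      Q ⟨reg, s.mem⟩ (T - 7)) :
    WP w readSizes Q s T := by
  refine wp_seq (wp_const (by omega) (by omega) ?_)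
  refine wp_seq (wp_load n (by simp [hreg, h0]) (by omega) (by omega) ?_)
  refine wp_seq (wp_load m (by simp [h1]) (by omega) (by omega) ?_)
  refine wp_seq (wp_add 2 (by simp) (by omega) (by omega) ?_)
  refine wp_seq (wp_load k (by simp [h2]) (by omega) (by omega) ?_)
  refine wp_seq (wp_add 3 (by simp) (by omega) (by omega) ?_)
  refine wp_move 3 (by simp) (by omega) (by omega) (hQ _ (fun r hr => ?_) (by simp))
  rw [Function.update_of_ne (by omega)]
  simp only [Function.update_apply, hreg, headerRegs]
  split_ifs <;> first | rfl | omega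

theorem wp_computeBases {Q : RAMState → ℕ → Prop} {n m : ℕ} (h2 : s.reg 2 = n) (h3 : s.reg 3 = m)
    (h50 : s.reg 50 = 3) (hn : 0 < n) (hm : m ≤ 6 * n) (hw : 40 * n ≤ w) (hT : 11 ≤ T)
    (hQ : ∀ reg : ℕ → ℕ, (∀ r < 40, reg r = s.reg r) → (∀ a < 12, reg (50 + a) = base n m a) →
      Q ⟨reg, s.mem⟩ (T - 11)) :
    WP w computeBases Q s T := by
  refine wp_seq (wp_add (3 + m) (by rw [h50, h3]) (by omega) (by omega) ?_)
  refine wp_seq (wp_add (3 + 2 * m) (by simp [h3]; ring) (by omega) (by omega) ?_)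
  refine wp_seq (wp_add (3 + 3 * m) (by simp [h3]; ring) (by omega) (by omega) ?_)
  refine wp_seq (wp_add (3 + 4 * m) (by simp [h3]; ring) (by omega) (by omega) ?_)
  refine wp_seq (wp_add (3 + 5 * m) (by simp [h3]; ring) (by omega) (by omega) ?_)
  refine wp_seq (wp_add (3 + 5 * m + n) (by simp [h2]) (by omega) (by omega) ?_)
  refine wp_seq (wp_add (3 + 5 * m + 2 * n) (by simp [h2]; ring) (by omega) (by omega) ?_)
  refine wp_seq (wp_add (3 + 5 * m + 3 * n) (by simp [h2]; ring) (by omega) (by omega) ?_)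
  refine wp_seq (wp_add (3 + 5 * m + 4 * n) (by simp [h2]; ring) (by omega) (by omega) ?_)
  refine wp_seq (wp_add (3 + 5 * m + 5 * n) (by simp [h2]; ring) (by omega) (by omega) ?_)
  refine wp_add (3 + 5 * m + 6 * n) (by simp [h2]; ring) (by omega) (by omega)
    (hQ _ (fun r hr => ?_) fun a ha => ?_)
  · dsimp only
    rw [Function.update_of_ne (by omega), Function.update_of_ne (by omega),
      Function.update_of_ne (by omega), Function.update_of_ne (by omega),
      Function.update_of_ne (by omega), Function.update_of_ne (by omega),
      Function.update_of_ne (by omega), Function.update_of_ne (by omega),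
      Function.update_of_ne (by omega), Function.update_of_ne (by omega),
      Function.update_of_ne (by omega)]
  · interval_cases a <;> simp [base, h50]

theorem rep_of_header {n m k : ℕ} {reg mem : ℕ → ℕ}
    (hreg : ∀ r < 40, reg r = headerRegs n m k r) (hbase : ∀ a < 12, reg (50 + a) = base n m a)
    (hn : 0 < n) (hk : k < m) (hm : m ≤ 6 * n) (hw : 40 * n ≤ w)
    (hmem : ∀ a < 12, ∀ i < size n m a, mem (base n m a + i) < w) :
    Rep n m w ⟨reg, mem⟩ (headerRegs n m k) (arraysOf n m mem) := by
  refine ⟨hreg, hbase, fun a ha i hi => ?_, fun r => ?_, fun a i => ?_, fun a ha => ?_⟩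
  · rw [arraysOf_of_lt ha hi]
  · unfold headerRegs
    split_ifs <;> omega
  · unfold arraysOf
    split_ifs with h
    · exact hmem a h.1 i h.2
    · omega
  -- The last array ends at `3 + 5 m + 7 n`, which is at most `40 n` because `m ≤ 6 n` and `n ≥ 1`.
  · interval_cases a <;> simp [base, size] <;> omega

/-- The output occupies the cells below `2 n`, and the arrays `8` and `11` start at `3 + 5 m + 3 n`
or later, so copying destroys nothing that is still to be read. -/
theorem wp_writeOutput {n m : ℕ} {xs ys : ℕ → ℕ} (h1 : s.reg 1 = 1) (h2 : s.reg 2 = n)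
    (h61 : s.reg 61 = base n m 11) (h58 : s.reg 58 = base n m 8)
    (hx : ∀ i < n, s.mem (base n m 11 + i) = xs i) (hy : ∀ i < n, s.mem (base n m 8 + i) = ys i)
    (hxs : ∀ i < n, xs i < w) (hys : ∀ i < n, ys i < w) (hn : 0 < n)
    (hw : base n m 11 + n < w) (hT : 9 * n + 2 ≤ T) :
    WP w writeOutput (fun s' _ => ∀ i < n, s'.mem i = xs i ∧ s'.mem (n + i) = ys i) s T := by
  have hb11 : base n m 11 = 3 + 5 * m + 6 * n := rfl
  have hb8 : base n m 8 = 3 + 5 * m + 3 * n := rfl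
  rw [hb11] at h61 hx hw
  rw [hb8] at h58 hy
  refine wp_seq (wp_const (by omega) (by omega) ?_)
  refine wp_loop (fun s' T' => s'.reg 1 = 1 ∧ s'.reg 2 = n ∧ s'.reg 61 = 3 + 5 * m + 6 * n ∧
    s'.reg 58 = 3 + 5 * m + 3 * n ∧ (∀ i < n, s'.mem (3 + 5 * m + 6 * n + i) = xs i) ∧
    (∀ i < n, s'.mem (3 + 5 * m + 3 * n + i) = ys i) ∧ s'.reg 9 ≤ n ∧
    (∀ i < s'.reg 9, s'.mem i = xs i ∧ s'.mem (n + i) = ys i) ∧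
    9 * n + 1 ≤ T' + 9 * s'.reg 9) ?_ ?_
  · simp only [Function.update_self]
    refine ⟨by simp [h1], by simp [h2], by simp [h61], by simp [h58], hx, hy, by omega, by simp,
      by omega⟩
  rintro s' T' ⟨e1, e2, e61, e58, ex, ey, e9, eo, eT⟩
  refine ⟨by omega, fun hb => ?_, fun hb => ?_⟩
  · rw [e2] at hb
    generalize hi : s'.reg 9 = i at *
    refine wp_seq (wp_add (3 + 5 * m + 6 * n + i) (by rw [e61, hi]) (by omega) (by omega) ?_)
    refine wp_seq (wp_load (xs i) (by simp [ex i hb]) (hxs i hb) (by omega) ?_)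
    refine wp_seq (wp_store i (xs i) (by simp [hi]) (by simp) (hxs i hb) (by omega) ?_)
    refine wp_seq (wp_add (3 + 5 * m + 3 * n + i) (by simp [e58, hi]) (by omega) (by omega) ?_)
    refine wp_seq (wp_load (ys i) ?_ (hys i hb) (by omega) ?_)
    · simp only [Function.update_self]
      rw [Function.update_of_ne (by omega), ey i hb]
    refine wp_seq (wp_add (n + i) (by simp [e2, hi]) (by omega) (by omega) ?_)
    refine wp_seq (wp_store (n + i) (ys i) (by simp) (by simp) (hys i hb) (by omega) ?_)
    refine wp_add (i + 1) (by simp [e1, hi]) (by omega) (by omega) ?_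
    simp only [Function.update_self]
    refine ⟨by simp [e1], by simp [e2], by simp [e61], by simp [e58], fun k hk => ?_,
      fun k hk => ?_, by omega, fun k hk => ?_, by omega⟩
    · rw [Function.update_of_ne (by omega), Function.update_of_ne (by omega), ex k hk]
    · rw [Function.update_of_ne (by omega), Function.update_of_ne (by omega), ey k hk]
    · rcases Nat.lt_succ_iff_lt_or_eq.1 hk with h | rfl
      · rw [Function.update_of_ne (by omega), Function.update_of_ne (by omega),
          Function.update_of_ne (by omega), Function.update_of_ne (by omega)]
        exact eo k h
      · rw [Function.update_of_ne (by omega), Function.update_self, Function.update_self]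
        exact ⟨rfl, rfl⟩
  · rw [e2] at hb
    have : s'.reg 9 = n := by omega
    rw [this] at eo
    exact eo

variable [Finite V]

theorem mem_lt_of_isInput (hin : IsInput G b D N s) (hw : 10 * Nat.card V ≤ w)
    (hm : Nat.card G.graph.Dart ≤ 6 * Nat.card V) :
    ∀ a < 12, ∀ i < size (Nat.card V) (Nat.card G.graph.Dart) a,
      s.mem (base (Nat.card V) (Nat.card G.graph.Dart) a + i) < w := by
  have hcard : 0 < Nat.card V := by have := (N.vtx b.fst).2; omega
  have hv : ∀ x, (N.vtx x : ℕ) < w := fun x => by have := (N.vtx x).2; omega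
  have hd : ∀ d, (N.dart d : ℕ) < w := fun d => by have := (N.dart d).2; omega
  intro a ha i hi
  by_cases h5 : a < 5
  · obtain ⟨d, rfl⟩ : ∃ d, (N.dart d : ℕ) = i := by
      rw [size, if_pos h5] at hi
      exact ⟨N.dart.symm ⟨i, hi⟩, by simp⟩
    rw [base, if_pos h5]
    interval_cases a
    · have := hin.tail d; simp only [zero_mul, add_zero]; rw [this]; exact hv _
    · have := hin.head d; rw [one_mul, this]; exact hv _
    · rw [hin.twin d]; exact hd _
    · rw [hin.next d]; exact hd _
    · rw [hin.bit d]; split_ifs <;> omega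
  · rw [size, if_neg h5] at hi
    rw [base, if_neg h5]
    by_cases h6 : a = 5
    · subst h6
      obtain ⟨x, rfl⟩ : ∃ x, (N.vtx x : ℕ) = i := ⟨N.vtx.symm ⟨i, hi⟩, by simp⟩
      have := hin.outDart x
      simp only [Nat.sub_self, zero_mul, add_zero]
      rw [this]; exact hd _
    · rw [hin.rest]
      · omega
      · have := Nat.mul_le_mul_right (Nat.card V) (show 1 ≤ a - 5 by omega)
        omega

/-- The darts `outDart` of the input serve as provisional starts of the walks. -/
theorem counted_of_isInput (st : V → G.graph.Dart) (hin : IsInput G b D N s) :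
    Counted G D N st 0 (arraysOf (Nat.card V) (Nat.card G.graph.Dart) s.mem) := by
  have hzero : ∀ a, 6 ≤ a → a < 12 → ∀ i < Nat.card V,
      arraysOf (Nat.card V) (Nat.card G.graph.Dart) s.mem a i = 0 := fun a ha ha' i hi => by
    rw [arraysOf_of_lt ha' (by rw [size, if_neg (by omega)]; exact hi), base, if_neg (by omega),
      hin.rest]
    have := Nat.mul_le_mul_right (Nat.card V) (show 1 ≤ a - 5 by omega)
    omega
  refine ⟨⟨fun d => ?_, fun d => ?_, fun d => ?_, fun d => ?_, fun d => ?_⟩, fun y => ?_,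
    fun x => ⟨N.outDart x, N.fst_outDart x, ?_, ?_⟩, fun a ha => hzero a (by omega)⟩
  · rw [arraysOf_of_lt (by norm_num) (dart_lt_size N _ (by norm_num)), ← hin.tail]
    congr 1; simp [base]
  · rw [arraysOf_of_lt (by norm_num) (dart_lt_size N _ (by norm_num)), ← hin.head]
    congr 1; simp [base]
  · rw [arraysOf_of_lt (by norm_num) (dart_lt_size N _ (by norm_num)), ← hin.twin]
    congr 1
  · rw [arraysOf_of_lt (by norm_num) (dart_lt_size N _ (by norm_num)), ← hin.next]
    congr 1
  · rw [arraysOf_of_lt (by norm_num) (dart_lt_size N _ (by norm_num)), ← hin.bit]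
    congr 1
  · rw [hzero 6 le_rfl (by norm_num) _ (N.vtx y).2]
    simp
  · rw [arraysOf_of_lt (by norm_num) (vtx_lt_size N _ (by norm_num)), ← hin.outDart]
    congr 1; simp [base]
  · rintro ⟨d, -, -, -, h⟩; omega

/-- The program constructs the drawing in linear time. -/
theorem drawingProgram_exec (hW : G.WalkSpec b z D Γ X Y st par rk) (hin : IsInput G b D N s)
    (hw : 50 * Nat.card V ≤ w) (hm : Nat.card G.graph.Dart ≤ 6 * Nat.card V) :
    ∃ t s', t ≤ 500 * Nat.card V ∧ drawingProgram.Exec w s t s' ∧ IsOutput N Γ s' := by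
  have hcard : 0 < Nat.card V := by have := (N.vtx b.fst).2; omega
  -- The time consists of `7 + 11` units for the header, the time of `awp_draw`, and `9 n + 2` for
  -- the output.
  have hwp : WP w drawingProgram (fun s' _ => ∀ i (hi : i < Nat.card V),
      s'.mem i = X (N.vtx.symm ⟨i, hi⟩) ∧ s'.mem (Nat.card V + i) = Y (N.vtx.symm ⟨i, hi⟩)) s
      (52 * Nat.card G.graph.Dart + 54 * Nat.card V + 54) := by
    have hb := (N.dart b).2
    refine wp_seq (wp_readSizes hin.reg hin.numVertices hin.numDarts hin.base (by omega) (by omega)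
      (by omega) (by omega) (by omega) fun reg hreg h50 => ?_)
    refine wp_seq (wp_computeBases (n := Nat.card V) (m := Nat.card G.graph.Dart)
      (hreg 2 (by norm_num)) (hreg 3 (by norm_num)) h50 hcard hm
      (by omega) (by omega) fun reg' hreg' hbase => ?_)
    have hs₁ := rep_of_header (w := w) (fun r hr => (hreg' r hr).trans (hreg r hr)) hbase hcard
      hb hm (by omega) (mem_lt_of_isInput hin (by omega) hm)
    have hd := awp_draw (T := 52 * Nat.card G.graph.Dart + 54 * Nat.card V + 54 - 7 - 11) (w := w)
      hW (counted_of_isInput st hin)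
      (ρ := headerRegs (Nat.card V) (Nat.card G.graph.Dart) (N.dart b)) rfl rfl rfl rfl rfl
      (by omega) hm (by omega)
    refine wp_seq ((hd _ hs₁).mono ?_)
    rintro s₂ T₂ ⟨ρ₂, μ₂, hs₂, h1, h2, hXY, hT₂⟩
    have hadd := hs₂.addr_lt 11 (by norm_num)
    have hb : base (Nat.card V) (Nat.card G.graph.Dart) 11 =
      3 + 5 * Nat.card G.graph.Dart + 6 * Nat.card V := rfl
    have hs : size (Nat.card V) (Nat.card G.graph.Dart) 11 = Nat.card V := rfl
    refine (wp_writeOutput (n := Nat.card V) (m := Nat.card G.graph.Dart)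
      (xs := fun i => μ₂ 11 i) (ys := fun i => μ₂ 8 i)
      ((hs₂.reg 1 (by norm_num)).trans h1) ((hs₂.reg 2 (by norm_num)).trans h2)
      (hs₂.regBase 11 (by norm_num)) (hs₂.regBase 8 (by norm_num))
      (fun i hi => hs₂.mem 11 (by norm_num) i hi) (fun i hi => hs₂.mem 8 (by norm_num) i hi)
      (fun i _ => hs₂.mem_lt 11 i) (fun i _ => hs₂.mem_lt 8 i) hcard (by omega)
      (by omega)).mono ?_
    intro s₃ T₃ h i hi
    have h3 := hXY (N.vtx.symm ⟨i, hi⟩)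
    rw [Equiv.apply_symm_apply] at h3
    rw [(h i hi).1, (h i hi).2]
    exact h3
  obtain ⟨t, s', T', h1, h2, h3⟩ := hwp
  -- With `m ≤ 6 n` the time is at most `366 n + 54 ≤ 500 n`.
  refine ⟨t, s', by omega, h1, fun x => ?_⟩
  obtain ⟨h4, h5⟩ := h3 (N.vtx x) (N.vtx x).2
  rw [h4, h5, hW.drawing]
  simp

end RAMLayout

/-! ### The first three vertices and the proof of the theorem -/

namespace PlaneGraph

/-- Deleting `c` leaves only `x` and `a`; they stay connected, so they are adjacent. -/
theorem adj_of_biconnected {W : Type*} {H : SimpleGraph W} (h : Biconnected H) {x a c : W}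
    (hall : ∀ y, y = x ∨ y = a ∨ y = c) (hxa : x ≠ a) (hxc : x ≠ c) (hac : a ≠ c) :
    H.Adj x a := by
  obtain ⟨p⟩ := h.2 c ⟨x, hxc⟩ ⟨a, hac⟩
  cases p with
  | nil => exact absurd rfl hxa
  | @cons _ y _ hadj _ =>
    have h1 : H.Adj x y := hadj
    rcases hall y with h2 | h2 | h2
    · exact absurd h2.symm h1.ne
    · rwa [h2] at h1
    · exact absurd h2 y.2

variable {V : Type*} {G : PlaneGraph V} {b : G.graph.Dart} {π : V ≃ Fin (Nat.card V)} {x z : V}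

theorem eq_of_val_eq {y y' : V} (h : (π y : ℕ) = π y') : y = y' := π.injective (Fin.ext h)

/-- The first three vertices of a canonical ordering form a triangle. -/
theorem IsCanonicalOrdering.adj_of_eq_two (h : G.IsCanonicalOrdering b π) (hcard : 3 < Nat.card V)
    (hx : (π x : ℕ) = 2) : G.graph.Adj x b.snd ∧ G.graph.Adj x b.fst := by
  have h0 := h.first
  have h1 := h.second
  obtain ⟨t, ht⟩ : ∃ t, (π t : ℕ) = 3 := ⟨π.symm ⟨3, hcard⟩, by simp⟩
  have hb := h.biconnected t ht.ge
  rw [ht] at hb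
  have hxS : x ∈ firstVertices π 3 := show (π x : ℕ) < 3 by omega
  have huS : b.snd ∈ firstVertices π 3 := show (π b.snd : ℕ) < 3 by omega
  have hvS : b.fst ∈ firstVertices π 3 := show (π b.fst : ℕ) < 3 by omega
  have hxu : x ≠ b.snd := by rintro rfl; omega
  have hxv : x ≠ b.fst := by rintro rfl; omega
  have hall : ∀ y : firstVertices π 3, y = ⟨x, hxS⟩ ∨ y = ⟨b.snd, huS⟩ ∨ y = ⟨b.fst, hvS⟩ := by
    rintro ⟨y, hy⟩
    have hy' : (π y : ℕ) < 3 := hy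
    simp only [Subtype.mk.injEq]
    rcases (by omega : (π y : ℕ) = 2 ∨ (π y : ℕ) = 0 ∨ (π y : ℕ) = 1) with h2 | h2 | h2
    · exact Or.inl (eq_of_val_eq (h2.trans hx.symm))
    · exact Or.inr (Or.inl (eq_of_val_eq (h2.trans h0.symm)))
    · exact Or.inr (Or.inr (eq_of_val_eq (h2.trans h1.symm)))
  have hu : (G.graph.induce (firstVertices π 3)).Adj ⟨x, hxS⟩ ⟨b.snd, huS⟩ :=
    adj_of_biconnected hb hall (by simpa using hxu) (by simpa using hxv) (by simp)
  have hv : (G.graph.induce (firstVertices π 3)).Adj ⟨x, hxS⟩ ⟨b.fst, hvS⟩ :=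
    adj_of_biconnected hb (c := ⟨b.snd, huS⟩) (fun y => by have := hall y; tauto)
      (by simpa using hxv) (by simpa using hxu) (by simp)
  exact ⟨hu, hv⟩

/-- If there are only three vertices, the ordering imposes no biconnectivity, and the triangle comes
from the biconnectivity of the graph itself. -/
theorem canon_of_biconnected (h : G.IsCanonicalOrdering b π) (hcard : 3 ≤ Nat.card V)
    (hG : Biconnected G.graph) : G.Canon b π := by
  refine ⟨h, hcard, fun x hx => ?_⟩
  rcases hcard.lt_or_eq with h3 | h3
  · exact h.adj_of_eq_two h3 hx
  have h0 := h.first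
  have h1 := h.second
  have hxu : x ≠ b.snd := by rintro rfl; omega
  have hxv : x ≠ b.fst := by rintro rfl; omega
  have hall : ∀ y, y = x ∨ y = b.snd ∨ y = b.fst := by
    intro y
    have hy := (π y).2
    rcases (by omega : (π y : ℕ) = 2 ∨ (π y : ℕ) = 0 ∨ (π y : ℕ) = 1) with h2 | h2 | h2
    · exact Or.inl (eq_of_val_eq (h2.trans hx.symm))
    · exact Or.inr (Or.inl (eq_of_val_eq (h2.trans h0.symm)))
    · exact Or.inr (Or.inr (eq_of_val_eq (h2.trans h1.symm)))
  exact ⟨adj_of_biconnected hG hall hxu hxv b.adj.ne',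
    adj_of_biconnected hG (fun y => by have := hall y; tauto) hxv hxu b.adj.ne⟩

/-- If there are only three vertices, the third one is `z`, and the outer cycle is the required
triangle. -/
theorem outer_of_isOuterCycle {u v : V} {hvu : G.graph.Adj v u} {huz : G.graph.Adj u z}
    {hzv : G.graph.Adj z v} (ho : G.IsOuterCycle hvu huz hzv)
    (h : G.IsCanonicalOrderingTo ⟨(v, u), hvu⟩ z π) : Canon.Outer G ⟨(v, u), hvu⟩ π z := by
  obtain ⟨h1, h2⟩ := h
  obtain ⟨-, f1, f2, f3⟩ := ho
  have h3 : (π u : ℕ) = 0 := h1.first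
  have h4 : (π v : ℕ) = 1 := h1.second
  have hcard : 3 ≤ Nat.card V := by
    by_contra hlt
    rcases (by omega : (π z : ℕ) = 0 ∨ (π z : ℕ) = 1) with h5 | h5
    · exact huz.ne (eq_of_val_eq (h3.trans h5.symm))
    · exact hzv.ne (eq_of_val_eq (h5.trans h4.symm))
  refine ⟨⟨h1, hcard, fun x hx => ?_⟩, h2, by rw [f1], by rw [f1, f2], by rw [f1, f2, f3]⟩
  rcases hcard.lt_or_eq with h5 | h5
  · exact h1.adj_of_eq_two h5 hx
  · have : x = z := eq_of_val_eq (π := π) (by omega)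
    subst this
    exact ⟨huz.symm, hzv⟩

end PlaneGraph

theorem fifty_mul_le_pow {n c : ℕ} (hn : 3 ≤ n) (hc : 5 ≤ c) : 50 * n ≤ n ^ c := by
  calc 50 * n ≤ n ^ 4 * n :=
        Nat.mul_le_mul_right _ ((by norm_num : 50 ≤ 3 ^ 4).trans (Nat.pow_le_pow_left hn 4))
    _ = n ^ 5 := (pow_succ _ 4).symm
    _ ≤ n ^ c := Nat.pow_le_pow_right (by omega) hc

theorem mainTheorem3 :
    (∃ (p : RAMProg) (c : ℕ), ∀ (V : Type*) [Finite V] (G : PlaneGraph V) (u v z : V)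
      (hvu : G.graph.Adj v u) (huz : G.graph.Adj u z) (hzv : G.graph.Adj z v),
      G.IsMaximal → G.IsOuterCycle hvu huz hzv →
      ∃ f : G.canonicalOrientations ⟨(v, u), hvu⟩ z → G.canonicalDrawings ⟨(v, u), hvu⟩ z,
        Function.Bijective f ∧
        (∀ (D : G.canonicalOrientations ⟨(v, u), hvu⟩ z) (π : V ≃ Fin (Nat.card V)),
          G.IsCanonicalOrderingTo ⟨(v, u), hvu⟩ z π → G.orientation π = D →
          (f D : V → ℝ × ℝ) = G.fppDrawing ⟨(v, u), hvu⟩ π) ∧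
        ComputesLinear p c G ⟨(v, u), hvu⟩ (G.canonicalOrientations ⟨(v, u), hvu⟩ z)
          (fun D => (f D : V → ℝ × ℝ))) ∧
    (∀ (V : Type*) [Finite V] (H : PlaneGraph V) (u v : V) (hvu : H.graph.Adj v u),
      3 ≤ Nat.card V → Biconnected H.graph → H.InternallyTriangulated →
      H.outer = H.rot.leftFace ⟨(v, u), hvu⟩ →
      ∀ π τ : V ≃ Fin (Nat.card V),
        H.IsCanonicalOrdering ⟨(v, u), hvu⟩ π → H.IsCanonicalOrdering ⟨(v, u), hvu⟩ τ →
        H.orientation π = H.orientation τ →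
        H.fppDrawing ⟨(v, u), hvu⟩ π = H.fppDrawing ⟨(v, u), hvu⟩ τ) := by
  refine ⟨⟨RAMLayout.drawingProgram, 500, fun V _ G u v z hvu huz hzv _ ho => ?_⟩,
    fun V _ H u v hvu hcard hH _ _ π τ hπ hτ hO => ?_⟩
  -- `f` draws with an arbitrarily chosen ordering of each orientation; `hdraw` shows that the
  -- choice is irrelevant.
  · choose ord hord hori using fun D : G.canonicalOrientations ⟨(v, u), hvu⟩ z => D.2
    have houter := fun D => PlaneGraph.outer_of_isOuterCycle ho (hord D)
    have hdraw : ∀ (D : G.canonicalOrientations ⟨(v, u), hvu⟩ z) (π : V ≃ Fin (Nat.card V)),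
        G.IsCanonicalOrderingTo ⟨(v, u), hvu⟩ z π → G.orientation π = D →
        G.fppDrawing ⟨(v, u), hvu⟩ (ord D) = G.fppDrawing ⟨(v, u), hvu⟩ π := fun D π hπ hD =>
      (houter D).canon.fppDrawing_eq (PlaneGraph.outer_of_isOuterCycle ho hπ).canon
        ((hori D).trans hD.symm)
    refine ⟨fun D => ⟨G.fppDrawing ⟨(v, u), hvu⟩ (ord D), ord D, hord D, rfl⟩, ⟨?_, ?_⟩, hdraw, ?_⟩
    · intro D D' h
      have h1 := (houter D).canon.orientation_eq (houter D').canon (congrArg Subtype.val h)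
      exact Subtype.ext ((hori D).symm.trans (h1.trans (hori D')))
    · rintro ⟨Γ, π, hπ, rfl⟩
      exact ⟨⟨G.orientation π, π, hπ, rfl⟩, Subtype.ext (hdraw _ π hπ rfl)⟩
    -- The constant `500` is the time factor and also the exponent of the word bound `n ^ 500`; for
    -- the latter, exponent `5` would suffice since `n ≥ 3`.
    · intro D N s hin
      obtain ⟨X, Y, st, par, rk, hW⟩ := (houter D).exists_walkSpec
      rw [hori D] at hW
      exact RAMLayout.drawingProgram_exec hW hin
        (fifty_mul_le_pow (houter D).canon.card (by decide)) (houter D).canon.card_dart_le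
  · exact (PlaneGraph.canon_of_biconnected hπ hcard hH).fppDrawing_eq
      (PlaneGraph.canon_of_biconnected hτ hcard hH) hO
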